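/- Let $N\ge 1$ be an integer, $0<\alpha<1$, $0<\beta<2$, $1<p<1+\frac{2\beta}{N}$, $\frac N2<k<\frac{\beta}{p-1}$, $s\ge 0$, $\lambda,\gamma\in\mathbb C$ with $\operatorname{Re}(\gamma\lambda)>0$, and let $u_0\in H^s(\mathbb R^N)$ be complex-valued with, for almost every $x$, $$\operatorname{Re}\left(i^\alpha\gamma u_0(x)\right)\ \ge\ |x|^{-k}\ \text{ if } |x|>1,\qquad \operatorname{Re}\left(i^\alpha\gamma u_0(x)\right)\ \ge\ 0\ \text{ if } |x|\le 1,$$ where $i^\alpha=e^{i\pi\alpha/2}$. For $\varepsilon>0$ and $T>0$ consider $$i^\alpha\,{}^cD^\alpha_{0|t}u-(-\Delta)^{\beta/2}u=\lambda|u|^p\ \text{ in }(0,T)\times\mathbb R^N,\qquad u(0,\cdot)=\varepsilon u_0, \tag{P}$$ where ${}^cD^\alpha_{0|t}f(t)=\frac{d}{dt}\frac{1}{\Gamma(1-\alpha)}\int_0^t(t-\tau)^{-\alpha}(f(\tau)-f(0))\,d\tau$ is the Caputo derivative and $(-\Delta)^{\beta/2}v(x)=\frac{4^{\beta/2}\Gamma((N+\beta)/2)}{\pi^{N/2}|\Gamma(-\beta/2)|}\,\mathrm{p.v.}\!\int_{\mathbb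 R^N}\frac{v(x)-v(y)}{|x-y|^{N+\beta}}\,dy$. Let $$X(T)=C([0,T),L^2(\mathbb R^N))\cap C^1([0,T),H^{-\beta/2}(\mathbb R^N))\cap L^\infty((0,T),L^p(\mathbb R^N)).$$ A function $u\in X(T)$ is a distributional solution of (P) if $u(0)=\varepsilon u_0$ and, for every real-valued $\varphi\in C_c^\infty((0,T)\times\mathbb R^N)$, $$\lambda\int_0^T\!\!\int|u|^p\varphi\,dx\,dt+\varepsilon i^\alpha\int_0^T\!\!\int u_0\,{}^cD^\alpha_{t|T}\varphi\,dx\,dt=i^\alpha\int_0^T\!\!\int u\,{}^cD^\alpha_{t|T}\varphi\,dx\,dt-\int_0^T\!\!\int u\,(-\Delta)^{\beta/2}\varphi\,dx\,dt,$$ where ${}^cD^\alpha_{t|T}\varphi(t,x)=-\frac{1}{\Gamma(1-\alpha)}\int_t^T(\tau-t)^{-\alpha}\partial_\tau\varphi(\tau,x)\,d\tau$. Put $\phi(x)=(1+|x|^2)^{-(N+\beta)/2}$, $A_0=\int_{\mathbb R^N}\phi\,dx$, $\omega_N$ the surface measure of the unit sphere of $\mathbb R^N$, $C_{1/2}=(p-1)p^{-\frac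 p{p-1}}2^{\frac1{p-1}}$, $$D=\tfrac12\operatorname{Re}(\gamma\lambda)\,|\gamma|^{-p}A_0^{-(p-1)},\qquad \kappa_1=\frac1{p-1}-\frac{\min(N,k)}{\beta},$$ $$I_1=\begin{cases}2^{-N-\beta-1}\omega_N(N-k)^{-1},&k<N,\\ 2^{-N-\beta}\omega_N\int_1^2r^{N-1-k}\,dr,&k\ge N.\end{cases}$$ Then $\kappa_1>0$, and there is a constant $K>0$ with $|(-\Delta)^{\beta/2}\phi|\le K\phi$ on $\mathbb R^N$. For every such $K$, let $C>0$ be given by $$C^p=2\,C_{1/2}\,(\operatorname{Re}(\gamma\lambda))^{-\frac p{p-1}}\,|\gamma|^{\frac{p^2}{p-1}}A_0^{p}\,K^{\frac p{p-1}},$$ $$B_1=(p-1)^{-\frac1\alpha}D^{-\frac1\alpha}\,\Gamma(1+\alpha)^{\frac1\alpha}\,2^{\frac1{\alpha\kappa_1}}\,C^{\frac{\min(N,k)(p-1)}{\alpha\beta\kappa_1}}\,I_1^{-\frac1{\alpha\kappa_1}}.$$ Then there exists $\varepsilon_2>0$ such that for every $\varepsilon\in(0,\varepsilon_2]$ there is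 $R>0$ for which $$g_0:=\operatorname{Re}\Big(i^\alpha\gamma\int_{\mathbb R^N}\varepsilon u_0(x)\,\phi(x/R)\,dx\Big)-C\,R^{N-\frac\beta{p-1}}>0,$$ and, with $B:=D\,R^{-N(p-1)}$, the maximal existence time $T_b$ (the supremum of the $T>0$ for which there is a nonnegative solution $g\in C([0,T))$) of $${}^cD^\alpha_{0|t}g=B\,g^p,\qquad g(0)=g_0,$$ is finite and satisfies $$\left(\frac{\Gamma(1+\alpha)}{B\,g_0^{p-1}\min\{2^p,\,p^p(p-1)^{-(p-1)}\}}\right)^{1/\alpha}\le T_b\le\left(\frac{\Gamma(1+\alpha)}{B\,g_0^{p-1}\max\{p-1,\,2^{-p\alpha/(p-1)}\}}\right)^{1/\alpha};$$ for every $T>T_b$ there is no distributional solution $u\in X(T)$ of (P); and $$T_b\le B_1\,\varepsilon^{-\frac1{\alpha\kappa_1}}.$$ -/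

import Mathlib

open MeasureTheory Filter Topology Set
open scoped ContDiff SchwartzMap

noncomputable section

namespace FracSchrodinger

/-- The Euclidean space `ℝ^N`. -/
abbrev E (N : ℕ) : Type := EuclideanSpace ℝ (Fin N)

/-- The complex Hilbert space `L²(ℝ^N)`. -/
abbrev L2 (N : ℕ) : Type := Lp ℂ 2 (volume : Measure (E N))

/-! ### Fractional calculus in time -/

/-- Left-sided Riemann-Liouville integral
`I^σ_{0|t} g (t) = Γ(σ)⁻¹ ∫_0^t (t - s)^{-(1-σ)} g(s) ds`. -/
def leftFracIntegral (σ : ℝ) (g : ℝ → ℝ) (t : ℝ) : ℝ :=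
  1 / Real.Gamma σ * ∫ s in (0 : ℝ)..t, (t - s) ^ (-(1 - σ)) * g s

/-- Right-sided Riemann-Liouville integral
`I^σ_{t|T} g (t) = Γ(σ)⁻¹ ∫_t^T (s - t)^{-(1-σ)} g(s) ds`. -/
def rightFracIntegral (σ T : ℝ) (g : ℝ → ℝ) (t : ℝ) : ℝ :=
  1 / Real.Gamma σ * ∫ s in t..T, (s - t) ^ (-(1 - σ)) * g s

/-- Right-sided Caputo derivative `ᶜD^δ_{t|T} f = - I^{1-δ}_{t|T} f'`
(it is applied to smooth functions only). -/
def rightCaputo (δ T : ℝ) (f : ℝ → ℝ) (t : ℝ) : ℝ :=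
  -rightFracIntegral (1 - δ) T (deriv f) t

/-- The left-sided Caputo derivative `ᶜD^δ_{0|t} f (t) = d/dt I^{1-δ}_{0|t} [f - f(0)] (t)`
exists at `t` and equals `d`. -/
def HasLeftCaputoAt (δ : ℝ) (f : ℝ → ℝ) (d t : ℝ) : Prop :=
  HasDerivAt (leftFracIntegral (1 - δ) (fun s => f s - f 0)) d t

/-- `g` is a nonnegative continuous solution on `[0,T)` of `ᶜD^α_{0|t} g = B g^p`, `g(0) = g₀`. -/
structure IsODESolution (α p B g₀ T : ℝ) (g : ℝ → ℝ) : Prop where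
  continuousOn : ContinuousOn g (Ico 0 T)
  nonneg : ∀ t ∈ Ico (0 : ℝ) T, 0 ≤ g t
  initial : g 0 = g₀
  equation : ∀ t ∈ Ioo (0 : ℝ) T, HasLeftCaputoAt α g (B * g t ^ p) t

/-- `Tb` is the (finite) maximal existence time of the solution of
`ᶜD^α_{0|t} g = B g^p`, `g(0) = g₀`: the least upper bound of all `T > 0` such that there is a
solution on `[0,T)`. -/
def IsMaximalTime (α p B g₀ Tb : ℝ) : Prop :=
  IsLUB {T : ℝ | 0 < T ∧ ∃ g : ℝ → ℝ, IsODESolution α p B g₀ T g} Tb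

/-- `(Γ(1+α) / (B g₀^{p-1} G(p)))^{1/α}`, with `G(p) = min(2^p, p^p / (p-1)^{p-1})`. -/
def lowerTime (α p B g₀ : ℝ) : ℝ :=
  (Real.Gamma (1 + α) /
    (B * g₀ ^ (p - 1) * min (2 ^ p) (p ^ p / (p - 1) ^ (p - 1)))) ^ (1 / α)

/-- `(Γ(1+α) / (B g₀^{p-1} H(p,α)))^{1/α}`, with `H(p,α) = max(p-1, 2^{-pα/(p-1)})`. -/
def upperTime (α p B g₀ : ℝ) : ℝ :=
  (Real.Gamma (1 + α) /
    (B * g₀ ^ (p - 1) * max (p - 1) (2 ^ (-(p * α / (p - 1)))))) ^ (1 / α)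

/-! ### The fractional Laplacian -/

/-- The normalization constant `4^s Γ(N/2+s) / (π^{N/2} |Γ(-s)|)`. -/
def fracLaplacianConst (N : ℕ) (s : ℝ) : ℝ :=
  4 ^ s * Real.Gamma (N / 2 + s) / (Real.pi ^ ((N : ℝ) / 2) * |Real.Gamma (-s)|)

/-- The fractional Laplacian `(-Δ)^s` as a principal value singular integral. -/
def fracLaplacian {N : ℕ} (s : ℝ) (v : E N → ℝ) (x : E N) : ℝ :=
  fracLaplacianConst N s *
    limUnder (𝓝[>] (0 : ℝ)) (fun r : ℝ =>
      ∫ y in {y : E N | r < ‖x - y‖}, (v x - v y) / ‖x - y‖ ^ ((N : ℝ) + 2 * s))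

/-! ### Distributional solutions -/

/-- `u ∈ X(T) = C([0,T), L²) ∩ C¹([0,T), H^{-β/2}) ∩ L^∞((0,T), L^p)`. Membership in
`C¹([0,T), H^{-β/2})` says that the image under the Bessel potential of order `-β/2`, which
identifies `H^{-β/2}` with `L²`, is `C¹` with values in `L²`. -/
structure MemX (N : ℕ) (β p T : ℝ) (u : ℝ → L2 N) : Prop where
  continuousOn : ContinuousOn u (Ico 0 T)
  c1 : ∃ w : ℝ → L2 N, ContDiffOn ℝ 1 w (Ico 0 T) ∧ ∀ t ∈ Ico (0 : ℝ) T,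
    TemperedDistribution.besselPotential (E N) ℂ (-(β / 2)) (u t : 𝓢'(E N, ℂ)) =
      (w t : 𝓢'(E N, ℂ))
  bounded : ∃ C : NNReal, ∀ᵐ t : ℝ ∂(volume.restrict (Ioo 0 T)),
    eLpNorm (u t) (ENNReal.ofReal p) (volume : Measure (E N)) ≤ C

/-- Real-valued test functions `φ ∈ C_c^∞((0,T) × ℝ^N)`. -/
def IsTestFunction (N : ℕ) (T : ℝ) (φ : ℝ × E N → ℝ) : Prop :=
  ContDiff ℝ ∞ φ ∧ HasCompactSupport φ ∧ tsupport φ ⊆ Ioo (0 : ℝ) T ×ˢ (univ : Set (E N))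

/-- `u` is a distributional solution on `(0,T) × ℝ^N` of
`i^α ᶜD^α_{0|t} u - (-Δ)^{β/2} u = lam |u|^p` with `u(0) = ε u₀`: the initial value is attained
and the equation, tested with any `φ ∈ C_c^∞((0,T) × ℝ^N)`, holds with
`ᶜD^α_{0|t} u = d/dt I^{1-α}_{0|t} [u - ε u₀]` transposed to `ᶜD^α_{t|T} φ`. -/
def IsDistributionalSolution (N : ℕ) (α β p ε : ℝ) (lam : ℂ) (u₀ : L2 N) (T : ℝ)
    (u : ℝ → L2 N) : Prop :=
  u 0 = ε • u₀ ∧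
  ∀ φ : ℝ × E N → ℝ, IsTestFunction N T φ →
    lam * (∫ t in (0 : ℝ)..T, ∫ x : E N, ((‖u t x‖ ^ p * φ (t, x) : ℝ) : ℂ)) +
      (ε : ℂ) * Complex.I ^ (α : ℂ) * (∫ t in (0 : ℝ)..T, ∫ x : E N,
        u₀ x * (rightCaputo α T (fun τ => φ (τ, x)) t : ℂ)) =
    Complex.I ^ (α : ℂ) * (∫ t in (0 : ℝ)..T, ∫ x : E N,
        u t x * (rightCaputo α T (fun τ => φ (τ, x)) t : ℂ)) -
      ∫ t in (0 : ℝ)..T, ∫ x : E N,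
        u t x * (fracLaplacian (β / 2) (fun y => φ (t, y)) x : ℂ)

/-! ### The weight and the constants -/

/-- The weight `φ(x) = (1 + |x|²)^{-(N+β)/2}`. -/
def weight (N : ℕ) (β : ℝ) (x : E N) : ℝ :=
  (1 + ‖x‖ ^ 2) ^ (-(((N : ℝ) + β) / 2))

/-- `K > 0` is a constant with `|(-Δ)^{β/2} φ| ≤ K φ` on `ℝ^N`, for the weight `φ`. -/
def IsWeightConst (N : ℕ) (β K : ℝ) : Prop :=
  0 < K ∧ ∀ x : E N, |fracLaplacian (β / 2) (weight N β) x| ≤ K * weight N β x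

/-- `A₀ = ∫ φ`. -/
def weightMass (N : ℕ) (β : ℝ) : ℝ := ∫ x : E N, weight N β x

/-- `C_{1/2} = (p-1) p^{-p/(p-1)} 2^{1/(p-1)}`. -/
def youngConst (p : ℝ) : ℝ := (p - 1) * p ^ (-(p / (p - 1))) * 2 ^ (1 / (p - 1))

/-- The constant `C_{N,p,β,λ,γ}`; its `p`-th power is
`2 C_{1/2} (Re γλ)^{-p/(p-1)} |γ|^{p²/(p-1)} A₀^p K^{p/(p-1)}`. -/
def constC (N : ℕ) (β p : ℝ) (lam γ : ℂ) (K : ℝ) : ℝ :=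
  (2 * youngConst p * (γ * lam).re ^ (-(p / (p - 1))) * ‖γ‖ ^ (p ^ 2 / (p - 1)) *
    weightMass N β ^ p * K ^ (p / (p - 1))) ^ (1 / p)

/-- The constant `D_{N,p,β,λ,γ} = 2⁻¹ Re(γλ) |γ|^{-p} A₀^{-(p-1)}`. -/
def constD (N : ℕ) (β p : ℝ) (lam γ : ℂ) : ℝ :=
  2⁻¹ * (γ * lam).re * ‖γ‖ ^ (-p) * weightMass N β ^ (-(p - 1))

/-- `M_R(0) = Re (i^α γ ∫ v(x) φ(x/R) dx)` for the initial value `v`. -/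
def initialMoment (N : ℕ) (α β : ℝ) (γ : ℂ) (R : ℝ) (v : L2 N) : ℝ :=
  (Complex.I ^ (α : ℂ) * γ * ∫ x : E N, v x * (weight N β (R⁻¹ • x) : ℂ)).re

/-- `κ₁ = 1/(p-1) - min(N,k)/β`. -/
def kappa₁ (N : ℕ) (β p k : ℝ) : ℝ := 1 / (p - 1) - min (N : ℝ) k / β

/-- `ω_N`, the surface measure of the unit sphere of `ℝ^N`. -/
def sphereArea (N : ℕ) : ℝ := ((volume : Measure (E N)).toSphere univ).toReal

/-- The constant `I₁`. -/
def constI₁ (N : ℕ) (β k : ℝ) : ℝ :=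
  if k < N then 2 ^ (-(N : ℝ) - β - 1) * sphereArea N * ((N : ℝ) - k)⁻¹
  else 2 ^ (-(N : ℝ) - β) * sphereArea N * ∫ r in (1 : ℝ)..2, r ^ ((N : ℝ) - 1 - k)

/-- The constant `B₁`. -/
def constB₁ (N : ℕ) (α β p k : ℝ) (lam γ : ℂ) (K : ℝ) : ℝ :=
  (p - 1) ^ (-(1 / α)) * constD N β p lam γ ^ (-(1 / α)) * Real.Gamma (1 + α) ^ (1 / α) *
    2 ^ (1 / (α * kappa₁ N β p k)) *
    constC N β p lam γ K ^ (min (N : ℝ) k * (p - 1) / (α * β * kappa₁ N β p k)) *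
    constI₁ N β k ^ (-(1 / (α * kappa₁ N β p k)))

end FracSchrodinger

end

noncomputable section

namespace FracSchrodinger
/-! ### Riemann-Liouville integrals -/

/-! The equation is tested against the scaled weight φ_R(x) = φ(x/R), and the real moment M(t) =
Re(i^α γ ∫ u(t) φ_R) is followed in time. The tail of φ is that of the kernel of (-Δ)^{β/2}, so
|(-Δ)^{β/2} φ| ≤ K φ, and by scaling the Laplacian term costs at most |γ| K R^{-β} S with S = ∫ |u|
φ_R. Jensen's inequality bounds the nonlinear term below by a multiple of S^p. Half of that multiple
dominates B|M|^p because |M| ≤ |γ| S. The other half absorbs the Laplacian term by Young's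
inequality, with a remainder which is exactly B m^p for m = C R^{N-β/(p-1)}. Hence ᶜD^α M ≥ B(|M|^p
- m^p) (`moment_inequality`).

If M(0) > m, then M stays above m, and (M - m)^p + m^p ≤ M^p makes M - m a supersolution of ᶜD^α g =
B g^p with g(0) = g₀ (`IsDistributionalSolution.isSupersolution`). Picard iteration started from g₀
increases and stays below any supersolution, so a genuine solution exists on the same time interval.
No solution u can therefore outlive T_b. Constant supersolutions bound T_b from below. From above it
is bounded by comparison with an explicit blowing-up subsolution and by an iteration over
geometrically shrinking time steps (`exists_isMaximalTime`).

Two points need care. The Caputo inequality is only weak in time. The semigroup law I^a I^{1-a} =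
I^1 yields a positivity principle, namely that Z ≥ 0 whenever I^{1-a} Z is nondecreasing; this
converts differential statements, classical or weak, into integral ones
(`nonneg_of_monotoneOn_leftFracIntegral`, `le_of_weak_caputo_inequality`). Moreover φ_R has no
compact support. Products of φ_R with cutoffs are tame in the sense of `IsTame` with a constant
independent of the cutoff, which gives dominated convergence for the fractional Laplacians
(`IsDistributionalSolution.identity_weight`).

The lifespan bound comes from the scale. The data give a moment of size at least ε I₁ R^{N-min(N,k)}
for large R. Taking R so that this equals 2m gives g₀ ≥ m, and then the upper bound for T_b is a
constant times R^{β/α}, that is, a power of ε. -/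

lemma intervalIntegrable_kernel {a : ℝ} (ha : 0 < a) (t s r : ℝ) :
    IntervalIntegrable (fun x => (t - x) ^ (-(1 - a))) volume s r := by
  have h := (intervalIntegral.intervalIntegrable_rpow' (a := t - s) (b := t - r)
    (r := -(1 - a)) (by linarith)).comp_sub_left t
  simpa using h

lemma integral_kernel {a : ℝ} (ha : 0 < a) (s t : ℝ) :
    ∫ x in s..t, (t - x) ^ (-(1 - a)) = (t - s) ^ a / a := by
  rw [intervalIntegral.integral_comp_sub_left (fun x => x ^ (-(1 - a))) t,
    integral_rpow (Or.inl (by linarith))]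
  have h : -(1 - a) + 1 = a := by ring
  rw [h, sub_self, Real.zero_rpow ha.ne', sub_zero]

/-- This is a Beta integral whose parameters 1 - a and a add up to 1, so the length of the interval
enters with exponent 0 and the factor Γ(1) disappears. -/
lemma integral_beta_kernel {a : ℝ} (ha : 0 < a) (ha1 : a < 1) {s t : ℝ} (hst : s < t) :
    ∫ r in s..t, (t - r) ^ (-(1 - a)) * (r - s) ^ (-(1 - (1 - a))) =
      Real.Gamma a * Real.Gamma (1 - a) := by
  have h1 := Complex.betaIntegral_scaled ((1 - a : ℝ) : ℂ) (a : ℂ) (sub_pos.2 hst)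
  have h2 := Complex.Gamma_mul_Gamma_eq_betaIntegral (s := ((1 - a : ℝ) : ℂ)) (t := (a : ℂ))
    (by rw [Complex.ofReal_re]; linarith) (by rw [Complex.ofReal_re]; linarith)
  have h3 : ((1 - a : ℝ) : ℂ) + a = 1 := by push_cast; ring
  rw [h3] at h1 h2
  rw [sub_self, Complex.cpow_zero, one_mul] at h1
  rw [Complex.Gamma_one, one_mul, ← h1, Complex.Gamma_ofReal, Complex.Gamma_ofReal] at h2
  have h4 : ∫ r in s..t, (t - r) ^ (-(1 - a)) * (r - s) ^ (-(1 - (1 - a))) =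
      ∫ x in (0 : ℝ)..(t - s), ((t - s) - x) ^ (-(1 - a)) * x ^ (-(1 - (1 - a))) := by
    have := intervalIntegral.integral_comp_sub_right
      (fun x => ((t - s) - x) ^ (-(1 - a)) * x ^ (-(1 - (1 - a)))) (a := s) (b := t) s
    simp only [sub_self, sub_sub_sub_cancel_right] at this
    exact this
  rw [h4]
  apply Complex.ofReal_injective
  rw [← intervalIntegral.integral_ofReal]
  push_cast
  rw [mul_comm, h2]
  apply intervalIntegral.integral_congr
  intro x hx
  rw [uIcc_of_le (sub_pos.2 hst).le] at hx
  simp only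
  rw [mul_comm, Complex.ofReal_cpow hx.1, Complex.ofReal_cpow (by linarith [hx.2])]
  push_cast
  congr 2 <;> ring

/-- A non-integrable function has Bochner integral 0, whereas the Beta value is positive. -/
lemma intervalIntegrable_beta_kernel {a : ℝ} (ha : 0 < a) (ha1 : a < 1) {s t : ℝ} (hst : s < t) :
    IntervalIntegrable (fun r => (t - r) ^ (-(1 - a)) * (r - s) ^ (-(1 - (1 - a))))
      volume s t := by
  apply intervalIntegral.intervalIntegrable_of_integral_ne_zero
  rw [integral_beta_kernel ha ha1 hst]
  exact (mul_pos (Real.Gamma_pos_of_pos ha) (Real.Gamma_pos_of_pos (by linarith))).ne'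

/-- Fubini's theorem on the triangle `0 < s < r < t`. -/
lemma integral_triangle_swap {t : ℝ} (ht : 0 ≤ t) {f : ℝ → ℝ → ℝ}
    (hm : AEStronglyMeasurable (Function.uncurry f)
      ((volume.restrict (Ioc 0 t)).prod (volume.restrict (Ioc 0 t))))
    (h1 : ∀ᵐ s ∂(volume.restrict (Ioc 0 t)), IntervalIntegrable (fun r => f r s) volume s t)
    {G : ℝ → ℝ} (hG : IntegrableOn G (Ioc 0 t))
    (h2 : ∀ᵐ s ∂(volume.restrict (Ioc 0 t)), ∫ r in s..t, |f r s| ≤ G s) :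
    ∫ r in (0 : ℝ)..t, ∫ s in (0 : ℝ)..r, f r s = ∫ s in (0 : ℝ)..t, ∫ r in s..t, f r s := by
  set μ := volume.restrict (Ioc 0 t) with hμ
  -- Extending f by zero off the triangle turns both iterated integrals into integrals over a
  -- square, where the usual Fubini theorem applies.
  let g : ℝ × ℝ → ℝ := indicator {z : ℝ × ℝ | z.2 ≤ z.1} (Function.uncurry f)
  have hS : MeasurableSet {z : ℝ × ℝ | z.2 ≤ z.1} :=
    (isClosed_le continuous_snd continuous_fst).measurableSet
  have hgm : AEStronglyMeasurable g (μ.prod μ) := hm.indicator hS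
  have hsec : ∀ s, s ∈ Ioc 0 t → ∀ (φ : ℝ → ℝ → ℝ),
      ∫ r, indicator {z : ℝ × ℝ | z.2 ≤ z.1} (Function.uncurry φ) (r, s) ∂μ
        = ∫ r in s..t, φ r s := by
    intro s hs φ
    have : (fun r => indicator {z : ℝ × ℝ | z.2 ≤ z.1} (Function.uncurry φ) (r, s)) =
        indicator (Ici s) (fun r => φ r s) := by
      ext r; simp [indicator]
    rw [this, integral_indicator measurableSet_Ici, hμ, Measure.restrict_restrict measurableSet_Ici,
      intervalIntegral.integral_of_le hs.2, ← integral_Icc_eq_integral_Ioc]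
    congr 2
    ext r; simp only [mem_inter_iff, mem_Ici, mem_Ioc, mem_Icc]
    exact ⟨fun h => ⟨h.1, h.2.2⟩, fun h => ⟨h.1, lt_of_lt_of_le hs.1 h.1, h.2⟩⟩
  have hgi : Integrable g (μ.prod μ) := by
    rw [integrable_prod_iff' hgm]
    constructor
    · filter_upwards [h1, ae_restrict_mem measurableSet_Ioc] with s hs hs'
      have : (fun r => g (r, s)) = indicator (Ici s) (fun r => f r s) := by
        ext r; simp [g, indicator]
      rw [this, integrable_indicator_iff measurableSet_Ici, IntegrableOn, hμ,
        Measure.restrict_restrict measurableSet_Ici]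
      rw [intervalIntegrable_iff_integrableOn_Icc_of_le hs'.2] at hs
      apply hs.mono_set
      intro r hr
      exact ⟨hr.1, hr.2.2⟩
    · refine Integrable.mono' hG hgm.norm.prod_swap.integral_prod_right' ?_
      filter_upwards [ae_restrict_mem measurableSet_Ioc, h2] with s hs hs2
      rw [← hsec s hs (fun r s => |f r s|)] at hs2
      rw [Real.norm_of_nonneg (integral_nonneg fun _ => norm_nonneg _)]
      refine le_trans (le_of_eq ?_) hs2
      congr 1; ext r
      simp only [g, indicator]
      split_ifs <;> simp
  have hswap := integral_integral_swap (f := fun r s => g (r, s)) hgi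
  have hl : ∫ r, ∫ s, g (r, s) ∂μ ∂μ = ∫ r in (0 : ℝ)..t, ∫ s in (0 : ℝ)..r, f r s := by
    rw [intervalIntegral.integral_of_le ht]
    apply setIntegral_congr_fun measurableSet_Ioc
    intro r hr
    have : (fun s => g (r, s)) = indicator (Iic r) (fun s => f r s) := by
      ext s; simp [g, indicator]
    simp only [this]
    rw [integral_indicator measurableSet_Iic, hμ, Measure.restrict_restrict measurableSet_Iic,
      intervalIntegral.integral_of_le hr.1.le]
    congr 2
    ext s; simp only [mem_inter_iff, mem_Iic, mem_Ioc]
    exact ⟨fun h => ⟨h.2.1, h.1⟩, fun h => ⟨h.2, h.1, h.2.trans hr.2⟩⟩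
  have hr : ∫ s, ∫ r, g (r, s) ∂μ ∂μ = ∫ s in (0 : ℝ)..t, ∫ r in s..t, f r s := by
    rw [intervalIntegral.integral_of_le ht]
    apply setIntegral_congr_fun measurableSet_Ioc
    intro s hs
    exact hsec s hs f
  rw [← hl, ← hr, hswap]

lemma ae_lt_right (t : ℝ) : ∀ᵐ s ∂(volume.restrict (Ioc 0 t)), s < t := by
  have h : ∀ᵐ s : ℝ, s ≠ t := by simp [ae_iff]
  filter_upwards [ae_restrict_mem measurableSet_Ioc, ae_restrict_of_ae h] with s hs hs'
  exact lt_of_le_of_ne hs.2 hs'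

/-- The semigroup law `I^a I^{1-a} = I^1`. -/
theorem leftFracIntegral_leftFracIntegral {a : ℝ} (ha : 0 < a) (ha1 : a < 1) {t : ℝ} (ht : 0 ≤ t)
    {F : ℝ → ℝ} (hF : IntervalIntegrable F volume 0 t) :
    leftFracIntegral a (leftFracIntegral (1 - a) F) t = ∫ s in (0 : ℝ)..t, F s := by
  have hG : 0 < Real.Gamma a * Real.Gamma (1 - a) :=
    mul_pos (Real.Gamma_pos_of_pos ha) (Real.Gamma_pos_of_pos (by linarith))
  have hGa := (Real.Gamma_pos_of_pos ha).ne'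
  have hGa' := (Real.Gamma_pos_of_pos (sub_pos.2 ha1)).ne'
  have hFi : IntegrableOn F (Ioc 0 t) := (intervalIntegrable_iff_integrableOn_Ioc_of_le ht).1 hF
  -- The inner integral over r is the Beta integral, constant in s, so integrability of F alone
  -- provides the majorant for Fubini.
  have hFG : IntegrableOn (fun s => (Real.Gamma a * Real.Gamma (1 - a)) * |F s|) (Ioc 0 t) :=
    hFi.norm.const_mul _
  have key := integral_triangle_swap ht
    (f := fun r s => (t - r) ^ (-(1 - a)) * (r - s) ^ (-(1 - (1 - a))) * F s) ?_ ?_ hFG ?_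
  · have hL : ∫ r in (0 : ℝ)..t, ∫ s in (0 : ℝ)..r,
        (t - r) ^ (-(1 - a)) * (r - s) ^ (-(1 - (1 - a))) * F s =
        (Real.Gamma a * Real.Gamma (1 - a)) * leftFracIntegral a (leftFracIntegral (1 - a) F) t := by
      simp only [leftFracIntegral, mul_assoc, intervalIntegral.integral_const_mul]
      rw [← mul_assoc (Real.Gamma (1 - a)), ← intervalIntegral.integral_const_mul]
      field_simp
      rw [← intervalIntegral.integral_const_mul]
      congr 1; ext r; field_simp
    have hR : ∫ s in (0 : ℝ)..t, ∫ r in s..t,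
        (t - r) ^ (-(1 - a)) * (r - s) ^ (-(1 - (1 - a))) * F s =
        (Real.Gamma a * Real.Gamma (1 - a)) * ∫ s in (0 : ℝ)..t, F s := by
      rw [← intervalIntegral.integral_const_mul]
      rw [intervalIntegral.integral_of_le ht, intervalIntegral.integral_of_le ht]
      apply integral_congr_ae
      filter_upwards [ae_lt_right t] with s hs
      rw [intervalIntegral.integral_mul_const, integral_beta_kernel ha ha1 hs]
    rw [hL, hR] at key
    exact mul_left_cancel₀ hG.ne' key
  · have h1 : Measurable fun z : ℝ × ℝ => (t - z.1) ^ (-(1 - a)) * (z.1 - z.2) ^ (-(1 - (1 - a))) := by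
      fun_prop
    exact h1.aestronglyMeasurable.mul hFi.aestronglyMeasurable.comp_snd
  · filter_upwards [ae_lt_right t] with s hs
    exact (intervalIntegrable_beta_kernel ha ha1 hs).mul_const _
  · filter_upwards [ae_lt_right t] with s hs
    rw [← integral_beta_kernel ha ha1 hs, ← intervalIntegral.integral_mul_const]
    apply le_of_eq
    apply intervalIntegral.integral_congr
    intro r hr
    rw [uIcc_of_le hs.le] at hr
    simp only [abs_mul]
    rw [abs_of_nonneg (Real.rpow_nonneg (sub_nonneg.2 hr.2) _),
      abs_of_nonneg (Real.rpow_nonneg (sub_nonneg.2 hr.1) _)]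
-- Monotonicity and continuity of fractional integrals
lemma leftFracIntegral_zero (a : ℝ) (f : ℝ → ℝ) : leftFracIntegral a f 0 = 0 := by
  simp [leftFracIntegral]

lemma leftFracIntegral_congr {a t : ℝ} (ht : 0 ≤ t) {f g : ℝ → ℝ} (h : ∀ s ∈ Icc 0 t, f s = g s) :
    leftFracIntegral a f t = leftFracIntegral a g t := by
  unfold leftFracIntegral
  congr 1
  apply intervalIntegral.integral_congr
  intro s hs
  rw [uIcc_of_le ht] at hs
  simp only [h s hs]

lemma intervalIntegrable_kernel_mul {a : ℝ} (ha : 0 < a) {b M : ℝ} {f : ℝ → ℝ}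
    (hm : AEStronglyMeasurable f (volume.restrict (Ioc 0 b)))
    (hb : ∀ s ∈ Ioc 0 b, |f s| ≤ M) (t : ℝ) {s r : ℝ} (hs : 0 ≤ s) (hsr : s ≤ r) (hr : r ≤ b) :
    IntervalIntegrable (fun x => (t - x) ^ (-(1 - a)) * f x) volume s r := by
  rw [intervalIntegrable_iff_integrableOn_Ioc_of_le hsr]
  have hk : IntegrableOn (fun x => (t - x) ^ (-(1 - a))) (Ioc s r) :=
    (intervalIntegrable_iff_integrableOn_Ioc_of_le hsr).1 (intervalIntegrable_kernel ha t s r)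
  have hsub : Ioc s r ⊆ Ioc 0 b := fun x hx => ⟨lt_of_le_of_lt hs hx.1, hx.2.trans hr⟩
  refine hk.mul_bdd (c := M) (hm.mono_measure (Measure.restrict_mono hsub le_rfl)) ?_
  filter_upwards [ae_restrict_mem measurableSet_Ioc] with x hx
  exact hb x (hsub hx)

lemma intervalIntegrable_kernel_mul_of_continuousOn {a : ℝ} (ha : 0 < a) {T : ℝ} {f : ℝ → ℝ}
    (hf : ContinuousOn f (Ico 0 T)) {t : ℝ} (ht : t ∈ Ico 0 T) :
    IntervalIntegrable (fun x => (t - x) ^ (-(1 - a)) * f x) volume 0 t := by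
  apply (intervalIntegrable_kernel ha t 0 t).mul_continuousOn
  rw [uIcc_of_le ht.1]
  exact hf.mono fun x hx => ⟨hx.1, lt_of_le_of_lt hx.2 ht.2⟩

lemma leftFracIntegral_sub {a t : ℝ} {f g : ℝ → ℝ}
    (hf : IntervalIntegrable (fun x => (t - x) ^ (-(1 - a)) * f x) volume 0 t)
    (hg : IntervalIntegrable (fun x => (t - x) ^ (-(1 - a)) * g x) volume 0 t) :
    leftFracIntegral a (fun s => f s - g s) t = leftFracIntegral a f t - leftFracIntegral a g t := by
  unfold leftFracIntegral
  rw [← mul_sub, ← intervalIntegral.integral_sub hf hg]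
  simp only [mul_sub]

lemma leftFracIntegral_neg (a t : ℝ) (f : ℝ → ℝ) :
    leftFracIntegral a (fun s => -f s) t = -leftFracIntegral a f t := by
  unfold leftFracIntegral
  rw [← mul_neg, ← intervalIntegral.integral_neg]
  simp only [mul_neg]

lemma leftFracIntegral_mono {a t : ℝ} (ha : 0 < a) (ht : 0 ≤ t) {f g : ℝ → ℝ}
    (hf : IntervalIntegrable (fun x => (t - x) ^ (-(1 - a)) * f x) volume 0 t)
    (hg : IntervalIntegrable (fun x => (t - x) ^ (-(1 - a)) * g x) volume 0 t)
    (h : ∀ s ∈ Ico 0 t, f s ≤ g s) :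
    leftFracIntegral a f t ≤ leftFracIntegral a g t := by
  unfold leftFracIntegral
  apply mul_le_mul_of_nonneg_left _ (by have := Real.Gamma_pos_of_pos ha; positivity)
  apply intervalIntegral.integral_mono_on_of_le_Ioo ht hf hg
  intro s hs
  exact mul_le_mul_of_nonneg_left (h s ⟨hs.1.le, hs.2⟩) (Real.rpow_nonneg (by linarith [hs.2]) _)

lemma leftFracIntegral_nonneg {a t : ℝ} (ha : 0 < a) (ht : 0 ≤ t) {f : ℝ → ℝ}
    (h : ∀ s ∈ Icc 0 t, 0 ≤ f s) : 0 ≤ leftFracIntegral a f t := by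
  unfold leftFracIntegral
  apply mul_nonneg (by have := Real.Gamma_pos_of_pos ha; positivity)
  apply intervalIntegral.integral_nonneg ht
  intro s hs
  exact mul_nonneg (Real.rpow_nonneg (by linarith [hs.2]) _) (h s hs)

lemma leftFracIntegral_const {a : ℝ} (ha : 0 < a) (c t : ℝ) :
    leftFracIntegral a (fun _ => c) t = c * t ^ a / Real.Gamma (1 + a) := by
  unfold leftFracIntegral
  rw [intervalIntegral.integral_mul_const, integral_kernel ha, sub_zero, add_comm 1 a,
    Real.Gamma_add_one ha.ne']
  have := (Real.Gamma_pos_of_pos ha).ne'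
  field_simp

/-- The fractional integral of a bounded function is Hölder continuous. -/
lemma abs_leftFracIntegral_sub_le {a : ℝ} (ha : 0 < a) (ha1 : a < 1) {b M : ℝ} {f : ℝ → ℝ}
    (hm : AEStronglyMeasurable f (volume.restrict (Ioc 0 b)))
    (hb : ∀ s ∈ Ioc 0 b, |f s| ≤ M) {t r : ℝ} (ht : 0 ≤ t) (htr : t ≤ r) (hr : r ≤ b) :
    |leftFracIntegral a f r - leftFracIntegral a f t| ≤
      1 / Real.Gamma a * (2 * M * ((r - t) ^ a / a)) := by
  have hG : 0 < 1 / Real.Gamma a := one_div_pos.2 (Real.Gamma_pos_of_pos ha)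
  -- For b = 0 the bound on f is vacuous and M may be negative; both sides are then 0.
  rcases eq_or_lt_of_le (ht.trans (htr.trans hr)) with hb0 | hb0
  · have h1 : t = 0 := by linarith
    have h2 : r = 0 := by linarith
    subst h1 h2
    simp [Real.zero_rpow ha.ne']
  have hM : 0 ≤ M := (abs_nonneg _).trans (hb b ⟨hb0, le_rfl⟩)
  have i1 := intervalIntegrable_kernel_mul ha hm hb r le_rfl ht (htr.trans hr)
  have i2 := intervalIntegrable_kernel_mul ha hm hb r ht htr hr
  have i3 := intervalIntegrable_kernel_mul ha hm hb t le_rfl ht (htr.trans hr)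
  unfold leftFracIntegral
  rw [← mul_sub, abs_mul, abs_of_pos hG]
  apply mul_le_mul_of_nonneg_left _ hG.le
  -- On [0,t] the kernel decreases as the endpoint moves from t to r, so the kernel difference has a
  -- sign and its integral is explicit, at most (r-t)^a/a. The piece over [t,r] contributes
  -- (r-t)^a/a as well, which explains the factor 2.
  rw [← intervalIntegral.integral_add_adjacent_intervals i1 i2, add_sub_right_comm,
    ← intervalIntegral.integral_sub i1 i3]
  have e1 : |∫ x in (0 : ℝ)..t, ((r - x) ^ (-(1 - a)) * f x - (t - x) ^ (-(1 - a)) * f x)| ≤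
      ∫ x in (0 : ℝ)..t, ((t - x) ^ (-(1 - a)) - (r - x) ^ (-(1 - a))) * M := by
    rw [← Real.norm_eq_abs]
    apply intervalIntegral.norm_integral_le_of_norm_le ht
    · have h : ∀ᵐ x : ℝ, x ≠ t := by simp [ae_iff]
      filter_upwards [h] with x hx hx'
      have hxt : x < t := lt_of_le_of_ne hx'.2 hx
      rw [Real.norm_eq_abs, ← sub_mul, abs_mul, abs_sub_comm]
      have hmono : (r - x) ^ (-(1 - a)) ≤ (t - x) ^ (-(1 - a)) :=
        Real.rpow_le_rpow_of_nonpos (by linarith) (by linarith) (by linarith)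
      rw [abs_of_nonneg (sub_nonneg.2 hmono)]
      exact mul_le_mul_of_nonneg_left (hb x ⟨hx'.1, by linarith⟩) (sub_nonneg.2 hmono)
    · exact ((intervalIntegrable_kernel ha t 0 t).sub (intervalIntegrable_kernel ha r 0 t)).mul_const M
  have e2 : |∫ x in t..r, (r - x) ^ (-(1 - a)) * f x| ≤ ∫ x in t..r, (r - x) ^ (-(1 - a)) * M := by
    rw [← Real.norm_eq_abs]
    apply intervalIntegral.norm_integral_le_of_norm_le htr
    · refine Eventually.of_forall fun x hx => ?_
      have h0 : 0 ≤ (r - x) ^ (-(1 - a)) := Real.rpow_nonneg (by linarith [hx.2]) _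
      rw [Real.norm_eq_abs, abs_mul, abs_of_nonneg h0]
      exact mul_le_mul_of_nonneg_left (hb x ⟨by linarith [hx.1], hx.2.trans hr⟩) h0
    · exact (intervalIntegrable_kernel ha r t r).mul_const M
  rw [intervalIntegral.integral_mul_const,
    intervalIntegral.integral_sub (intervalIntegrable_kernel ha t 0 t)
      (intervalIntegrable_kernel ha r 0 t), integral_kernel ha 0 t] at e1
  have e3 : ∫ x in (0 : ℝ)..t, (r - x) ^ (-(1 - a)) = r ^ a / a - (r - t) ^ a / a := by
    rw [eq_sub_iff_add_eq, ← integral_kernel ha t r,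
      intervalIntegral.integral_add_adjacent_intervals (intervalIntegrable_kernel ha r 0 t)
        (intervalIntegrable_kernel ha r t r), integral_kernel ha 0 r, sub_zero]
  rw [e3, sub_zero] at e1
  rw [intervalIntegral.integral_mul_const, integral_kernel ha] at e2
  have e4 : t ^ a / a ≤ r ^ a / a := by gcongr
  have e5 : (t ^ a / a - (r ^ a / a - (r - t) ^ a / a)) * M ≤ (r - t) ^ a / a * M :=
    mul_le_mul_of_nonneg_right (by linarith) hM
  refine (abs_add_le _ _).trans ?_
  linarith

lemma continuousOn_leftFracIntegral_of_bounded {a : ℝ} (ha : 0 < a) (ha1 : a < 1) {b M : ℝ}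
    {f : ℝ → ℝ} (hm : AEStronglyMeasurable f (volume.restrict (Ioc 0 b)))
    (hb : ∀ s ∈ Ioc 0 b, |f s| ≤ M) : ContinuousOn (leftFracIntegral a f) (Icc 0 b) := by
  intro t ht
  rw [ContinuousWithinAt, tendsto_iff_dist_tendsto_zero]
  have hlim : Tendsto (fun r => 1 / Real.Gamma a * (2 * M * (|r - t| ^ a / a))) (𝓝[Icc 0 b] t)
      (𝓝 0) := by
    have : ContinuousAt (fun r => 1 / Real.Gamma a * (2 * M * (|r - t| ^ a / a))) t := by
      have h : ContinuousAt (fun r => |r - t| ^ a) t :=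
        ContinuousAt.rpow_const (by fun_prop) (Or.inr ha.le)
      fun_prop
    have h2 := this.tendsto.mono_left (nhdsWithin_le_nhds (s := Icc 0 b))
    simpa [Real.zero_rpow ha.ne'] using h2
  refine tendsto_of_tendsto_of_tendsto_of_le_of_le' tendsto_const_nhds hlim
    (Eventually.of_forall fun _ => dist_nonneg) ?_
  filter_upwards [self_mem_nhdsWithin] with r hr
  rw [Real.dist_eq]
  rcases le_total t r with h | h
  · rw [abs_of_nonneg (sub_nonneg.2 h)]
    exact abs_leftFracIntegral_sub_le ha ha1 hm hb ht.1 h hr.2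
  · rw [abs_sub_comm, abs_sub_comm r t, abs_of_nonneg (sub_nonneg.2 h)]
    exact abs_leftFracIntegral_sub_le ha ha1 hm hb hr.1 h ht.2

lemma continuousOn_Ico_of_forall_Icc {T : ℝ} {f : ℝ → ℝ}
    (h : ∀ b ∈ Ico 0 T, ContinuousOn f (Icc 0 b)) : ContinuousOn f (Ico 0 T) := by
  intro t ht
  obtain ⟨b, hb1, hb2⟩ := exists_between ht.2
  have hb : b ∈ Ico 0 T := ⟨ht.1.trans hb1.le, hb2⟩
  refine (h b hb t ⟨ht.1, hb1.le⟩).mono_of_mem_nhdsWithin ?_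
  have : Iio b ∈ 𝓝[Ico 0 T] t := mem_nhdsWithin_of_mem_nhds (Iio_mem_nhds hb1)
  filter_upwards [this, self_mem_nhdsWithin] with x hx hx'
  exact ⟨hx'.1, le_of_lt hx⟩

lemma continuousOn_leftFracIntegral {a : ℝ} (ha : 0 < a) (ha1 : a < 1) {T : ℝ} {f : ℝ → ℝ}
    (hf : ContinuousOn f (Ico 0 T)) : ContinuousOn (leftFracIntegral a f) (Ico 0 T) := by
  apply continuousOn_Ico_of_forall_Icc
  intro b hb
  have hc : ContinuousOn f (Icc 0 b) := hf.mono fun x hx => ⟨hx.1, lt_of_le_of_lt hx.2 hb.2⟩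
  obtain ⟨M, hM⟩ := isCompact_Icc.exists_bound_of_continuousOn hc
  exact continuousOn_leftFracIntegral_of_bounded ha ha1
    ((hc.mono Ioc_subset_Icc_self).aestronglyMeasurable measurableSet_Ioc)
    fun s hs => hM s (Ioc_subset_Icc_self hs)

lemma hasDerivAt_integral_of_continuousOn {T t : ℝ} {f : ℝ → ℝ} (hf : ContinuousOn f (Ico 0 T))
    (ht : t ∈ Ioo 0 T) : HasDerivAt (fun r => ∫ s in (0 : ℝ)..r, f s) (f t) t := by
  have hct : ContinuousAt f t := hf.continuousAt (Ico_mem_nhds ht.1 ht.2)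
  apply intervalIntegral.integral_hasDerivAt_right
  · apply ContinuousOn.intervalIntegrable
    rw [uIcc_of_le ht.1.le]
    exact hf.mono fun x hx => ⟨hx.1, lt_of_le_of_lt hx.2 ht.2⟩
  · exact (hf.mono Ioo_subset_Ico_self).stronglyMeasurableAtFilter isOpen_Ioo t ht
  · exact hct

lemma intervalIntegrable_of_continuousOn_Ico {T t : ℝ} {f : ℝ → ℝ} (hf : ContinuousOn f (Ico 0 T))
    (ht : t ∈ Ico 0 T) : IntervalIntegrable f volume 0 t := by
  apply ContinuousOn.intervalIntegrable
  rw [uIcc_of_le ht.1]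
  exact hf.mono fun x hx => ⟨hx.1, lt_of_le_of_lt hx.2 ht.2⟩

/-- After the reflection the kernel no longer depends on t, which appears only in the argument of f
and in the endpoint. Monotonicity of f can then be used pointwise. -/
lemma leftFracIntegral_eq_reflect (a t : ℝ) (f : ℝ → ℝ) :
    leftFracIntegral a f t = 1 / Real.Gamma a * ∫ x in (0 : ℝ)..t, x ^ (-(1 - a)) * f (t - x) := by
  unfold leftFracIntegral
  have := intervalIntegral.integral_comp_sub_left (a := 0) (b := t)
    (fun x => x ^ (-(1 - a)) * f (t - x)) t
  simp only [sub_sub_cancel, sub_zero, sub_self] at this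
  rw [this]

/-- The fractional integral of a nonnegative nondecreasing function is nondecreasing. -/
lemma monotoneOn_leftFracIntegral {a : ℝ} (ha : 0 < a) {T : ℝ} {ν : ℝ → ℝ}
    (hν : ContinuousOn ν (Ico 0 T)) (hmono : MonotoneOn ν (Ico 0 T))
    (h0 : ∀ t ∈ Ico 0 T, 0 ≤ ν t) : MonotoneOn (leftFracIntegral a ν) (Ico 0 T) := by
  intro t ht r hr htr
  have hi : ∀ t ∈ Ico 0 T, IntervalIntegrable (fun x => x ^ (-(1 - a)) * ν (t - x)) volume 0 t := by
    intro t ht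
    apply (intervalIntegral.intervalIntegrable_rpow' (by linarith)).mul_continuousOn
    rw [uIcc_of_le ht.1]
    exact hν.comp (by fun_prop) fun x hx => ⟨by linarith [hx.2], by linarith [hx.1, ht.2]⟩
  rw [leftFracIntegral_eq_reflect, leftFracIntegral_eq_reflect]
  apply mul_le_mul_of_nonneg_left _ (by have := Real.Gamma_pos_of_pos ha; positivity)
  have hir := hi r hr
  have hir1 : IntervalIntegrable (fun x => x ^ (-(1 - a)) * ν (r - x)) volume 0 t :=
    hir.mono_set (by rw [uIcc_of_le ht.1, uIcc_of_le hr.1]; exact Icc_subset_Icc le_rfl htr)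
  have hir2 : IntervalIntegrable (fun x => x ^ (-(1 - a)) * ν (r - x)) volume t r :=
    hir.mono_set (by rw [uIcc_of_le htr, uIcc_of_le hr.1]; exact Icc_subset_Icc ht.1 le_rfl)
  rw [← intervalIntegral.integral_add_adjacent_intervals hir1 hir2]
  have e1 : ∫ x in (0 : ℝ)..t, x ^ (-(1 - a)) * ν (t - x) ≤
      ∫ x in (0 : ℝ)..t, x ^ (-(1 - a)) * ν (r - x) := by
    apply intervalIntegral.integral_mono_on ht.1 (hi t ht) hir1
    intro x hx
    apply mul_le_mul_of_nonneg_left _ (Real.rpow_nonneg hx.1 _)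
    exact hmono ⟨by linarith [hx.2], by linarith [hx.1, ht.2]⟩
      ⟨by linarith [hx.2], by linarith [hx.1, hr.2]⟩ (by linarith)
  have e2 : 0 ≤ ∫ x in t..r, x ^ (-(1 - a)) * ν (r - x) := by
    apply intervalIntegral.integral_nonneg htr
    intro x hx
    exact mul_nonneg (Real.rpow_nonneg (ht.1.trans hx.1) _)
      (h0 _ ⟨by linarith [hx.2], by linarith [hx.1, ht.1, hr.2]⟩)
  linarith

/-- If `I^{1-a} Z` is nondecreasing, then `Z` is nonnegative. -/
theorem nonneg_of_monotoneOn_leftFracIntegral {a : ℝ} (ha : 0 < a) (ha1 : a < 1) {T : ℝ}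
    {Z : ℝ → ℝ} (hZ : ContinuousOn Z (Ico 0 T))
    (hmono : MonotoneOn (leftFracIntegral (1 - a) Z) (Ico 0 T)) : ∀ t ∈ Ioo 0 T, 0 ≤ Z t := by
  intro t ht
  have hT : (0 : ℝ) ∈ Ico 0 T := ⟨le_rfl, ht.1.trans ht.2⟩
  have h0 : ∀ t ∈ Ico 0 T, 0 ≤ leftFracIntegral (1 - a) Z t := by
    intro t ht
    have := hmono hT ht ht.1
    rwa [leftFracIntegral_zero] at this
  -- I^{1-a} Z vanishes at 0 and is nondecreasing, hence nonnegative. Applying I^a keeps it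
  -- nondecreasing and produces the primitive of Z, whose derivative is Z.
  have h1 := monotoneOn_leftFracIntegral ha
    (continuousOn_leftFracIntegral (by linarith) (by linarith) hZ) hmono h0
  have h2 : MonotoneOn (fun r => ∫ s in (0 : ℝ)..r, Z s) (Ioo 0 T) := by
    intro r hr s hs hrs
    have := h1 (Ioo_subset_Ico_self hr) (Ioo_subset_Ico_self hs) hrs
    rwa [leftFracIntegral_leftFracIntegral ha ha1 hr.1.le
        (intervalIntegrable_of_continuousOn_Ico hZ (Ioo_subset_Ico_self hr)),
      leftFracIntegral_leftFracIntegral ha ha1 hs.1.le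
        (intervalIntegrable_of_continuousOn_Ico hZ (Ioo_subset_Ico_self hs))] at this
  have h3 := h2.derivWithin_nonneg (x := t)
  rwa [derivWithin_of_isOpen isOpen_Ioo ht, (hasDerivAt_integral_of_continuousOn hZ ht).deriv] at h3
/-! ### The fractional ordinary differential equation -/

lemma ContinuousOn.const_mul_rpow {h : ℝ → ℝ} {S : Set ℝ} (hh : ContinuousOn h S) (B : ℝ) {p : ℝ}
    (hp : 0 ≤ p) : ContinuousOn (fun s => B * h s ^ p) S :=
  continuousOn_const.mul (hh.rpow_const fun _ _ => Or.inr hp)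

/-- For Z = g - g(0) - I^α(B g^p) the semigroup law gives I^{1-α} Z derivative 0. It is thus both
nondecreasing and nonincreasing, and the positivity principle applied to Z and to -Z forces Z = 0.
-/
theorem IsODESolution.integral_eq {α p B g₀ T : ℝ} {g : ℝ → ℝ} (hα₀ : 0 < α) (hα₁ : α < 1)
    (hp : 0 ≤ p) (hg : IsODESolution α p B g₀ T g) :
    ∀ t ∈ Ico 0 T, g t = g₀ + leftFracIntegral α (fun s => B * g s ^ p) t := by
  set f : ℝ → ℝ := fun s => B * g s ^ p with hf
  have hfc : ContinuousOn f (Ico 0 T) := ContinuousOn.const_mul_rpow hg.continuousOn B hp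
  have h1α : 0 < 1 - α := by linarith
  set V : ℝ → ℝ := fun s => g s - g 0 with hV
  have hVc : ContinuousOn V (Ico 0 T) := hg.continuousOn.sub continuousOn_const
  have hIc : ContinuousOn (leftFracIntegral α f) (Ico 0 T) := continuousOn_leftFracIntegral hα₀ hα₁ hfc
  have hcomp : ∀ t ∈ Ico 0 T,
      leftFracIntegral (1 - α) (fun s => V s - leftFracIntegral α f s) t =
        leftFracIntegral (1 - α) V t - ∫ s in (0 : ℝ)..t, f s := by
    intro t ht
    have h2 := leftFracIntegral_leftFracIntegral (a := 1 - α) h1α (by linarith) ht.1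
      (intervalIntegrable_of_continuousOn_Ico hfc ht)
    rw [sub_sub_cancel] at h2
    rw [leftFracIntegral_sub (intervalIntegrable_kernel_mul_of_continuousOn h1α hVc ht)
      (intervalIntegrable_kernel_mul_of_continuousOn h1α hIc ht), h2]
  have hZc : ContinuousOn (fun s => V s - leftFracIntegral α f s) (Ico 0 T) := hVc.sub hIc
  have hJc := continuousOn_leftFracIntegral h1α (by linarith) hZc
  have hd : ∀ t ∈ Ioo 0 T, HasDerivAt
      (leftFracIntegral (1 - α) (fun s => V s - leftFracIntegral α f s)) 0 t := by
    intro t ht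
    have h3 := (hg.equation t ht).sub (hasDerivAt_integral_of_continuousOn hfc ht)
    rw [sub_self] at h3
    refine h3.congr_of_eventuallyEq ?_
    filter_upwards [Ico_mem_nhds ht.1 ht.2] with r hr
    exact hcomp r hr
  have hm1 : MonotoneOn (leftFracIntegral (1 - α) (fun s => V s - leftFracIntegral α f s))
      (Ico 0 T) := by
    apply monotoneOn_of_deriv_nonneg (convex_Ico 0 T) hJc
    · rw [interior_Ico]
      exact fun t ht => (hd t ht).differentiableAt.differentiableWithinAt
    · rw [interior_Ico]
      exact fun t ht => (hd t ht).deriv.ge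
  have hm2 : AntitoneOn (leftFracIntegral (1 - α) (fun s => V s - leftFracIntegral α f s))
      (Ico 0 T) := by
    apply antitoneOn_of_deriv_nonpos (convex_Ico 0 T) hJc
    · rw [interior_Ico]
      exact fun t ht => (hd t ht).differentiableAt.differentiableWithinAt
    · rw [interior_Ico]
      exact fun t ht => (hd t ht).deriv.le
  have hz1 := nonneg_of_monotoneOn_leftFracIntegral hα₀ hα₁ hZc hm1
  have hz2 := nonneg_of_monotoneOn_leftFracIntegral hα₀ hα₁ hZc.fun_neg (by
    intro r hr s hs hrs
    rw [leftFracIntegral_neg, leftFracIntegral_neg]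
    exact neg_le_neg (hm2 hr hs hrs))
  intro t ht
  rcases eq_or_lt_of_le ht.1 with h0 | h0
  · subst h0; rw [leftFracIntegral_zero, hg.initial, add_zero]
  · have e1 := hz1 t ⟨h0, ht.2⟩
    have e2 := hz2 t ⟨h0, ht.2⟩
    have e3 := hg.initial
    simp only [hV] at e1 e2
    linarith

/-- Applying I^{1-α} to the integral equation gives the primitive of B g^p by the semigroup law, and
this is differentiable because g is continuous. -/
theorem isODESolution_of_integral_eq {α p B g₀ T : ℝ} {g : ℝ → ℝ} (hα₀ : 0 < α) (hα₁ : α < 1)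
    (hp : 0 ≤ p) (hT : 0 < T) (hc : ContinuousOn g (Ico 0 T)) (h0 : ∀ t ∈ Ico 0 T, 0 ≤ g t)
    (h : ∀ t ∈ Ico 0 T, g t = g₀ + leftFracIntegral α (fun s => B * g s ^ p) t) :
    IsODESolution α p B g₀ T g := by
  have hfc : ContinuousOn (fun s => B * g s ^ p) (Ico 0 T) := ContinuousOn.const_mul_rpow hc B hp
  have hg0 : g 0 = g₀ := by
    rw [h 0 ⟨le_rfl, hT⟩, leftFracIntegral_zero, add_zero]
  refine ⟨hc, h0, hg0, fun t ht => ?_⟩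
  refine (hasDerivAt_integral_of_continuousOn hfc ht).congr_of_eventuallyEq ?_
  filter_upwards [Ico_mem_nhds ht.1 ht.2] with r hr
  have h2 := leftFracIntegral_leftFracIntegral (a := 1 - α) (by linarith) (by linarith) hr.1
    (intervalIntegrable_of_continuousOn_Ico hfc hr)
  rw [sub_sub_cancel] at h2
  rw [← h2]
  apply leftFracIntegral_congr hr.1
  intro s hs
  rw [hg0, h s ⟨hs.1, lt_of_le_of_lt hs.2 hr.2⟩]
  ring

/-! ### Supersolutions and monotone iteration -/

/-- `h` is a nonnegative continuous supersolution on `[0,T)` of the integral equation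
`g = g₀ + I^α (B g^p)`. -/
structure IsSupersolution (α p B g₀ T : ℝ) (h : ℝ → ℝ) : Prop where
  continuousOn : ContinuousOn h (Ico 0 T)
  nonneg : ∀ t ∈ Ico (0 : ℝ) T, 0 ≤ h t
  le : ∀ t ∈ Ico (0 : ℝ) T, g₀ + leftFracIntegral α (fun s => B * h s ^ p) t ≤ h t

lemma IsODESolution.isSupersolution {α p B g₀ T : ℝ} {g : ℝ → ℝ} (hα₀ : 0 < α) (hα₁ : α < 1)
    (hp : 0 ≤ p) (hg : IsODESolution α p B g₀ T g) : IsSupersolution α p B g₀ T g :=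
  ⟨hg.continuousOn, hg.nonneg, fun t ht => (hg.integral_eq hα₀ hα₁ hp t ht).ge⟩

lemma IsSupersolution.initial_le {α p B g₀ T : ℝ} {h : ℝ → ℝ} (hα₀ : 0 < α) (hB : 0 < B)
    (hh : IsSupersolution α p B g₀ T h) : ∀ t ∈ Ico 0 T, g₀ ≤ h t := by
  intro t ht
  have h1 := hh.le t ht
  have h2 : 0 ≤ leftFracIntegral α (fun s => B * h s ^ p) t :=
    leftFracIntegral_nonneg hα₀ ht.1 fun s hs =>
      mul_nonneg hB.le (Real.rpow_nonneg (hh.nonneg s ⟨hs.1, lt_of_le_of_lt hs.2 ht.2⟩) _)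
  linarith

/-- The Picard iterates of the integral equation `g = g₀ + I^α (B g^p)`. -/
def picardIterate (α p B g₀ : ℝ) : ℕ → ℝ → ℝ
  | 0 => fun _ => g₀
  | n + 1 => fun t => g₀ + leftFracIntegral α (fun s => B * picardIterate α p B g₀ n s ^ p) t

/-- Below a supersolution there is a solution. -/
theorem IsSupersolution.exists_isODESolution {α p B g₀ T : ℝ} {h : ℝ → ℝ} (hα₀ : 0 < α)
    (hα₁ : α < 1) (hp : 0 ≤ p) (hB : 0 < B) (hg₀ : 0 < g₀) (hT : 0 < T)
    (hh : IsSupersolution α p B g₀ T h) : ∃ g, IsODESolution α p B g₀ T g := by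
  set G := picardIterate α p B g₀ with hG
  have hhge := hh.initial_le hα₀ hB
  have hpowmono : ∀ {x y : ℝ}, 0 ≤ x → x ≤ y → B * x ^ p ≤ B * y ^ p := fun hx hxy =>
    mul_le_mul_of_nonneg_left (Real.rpow_le_rpow hx hxy hp) hB.le
  have hGc : ∀ n, ContinuousOn (G n) (Ico 0 T) := by
    intro n
    induction n with
    | zero => exact continuousOn_const
    | succ n ih =>
      exact continuousOn_const.add
        (continuousOn_leftFracIntegral hα₀ hα₁ (ContinuousOn.const_mul_rpow ih B hp))
  have hint : ∀ {f : ℝ → ℝ}, ContinuousOn f (Ico 0 T) → ∀ t ∈ Ico 0 T,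
      IntervalIntegrable (fun x => (t - x) ^ (-(1 - α)) * (B * f x ^ p)) volume 0 t :=
    fun hf t ht => intervalIntegrable_kernel_mul_of_continuousOn hα₀
      (ContinuousOn.const_mul_rpow hf B hp) ht
  have hGge : ∀ n, ∀ t ∈ Ico 0 T, g₀ ≤ G n t := by
    intro n
    induction n with
    | zero => exact fun t _ => le_rfl
    | succ n ih =>
      intro t ht
      have : 0 ≤ leftFracIntegral α (fun s => B * G n s ^ p) t :=
        leftFracIntegral_nonneg hα₀ ht.1 fun s hs => mul_nonneg hB.le
          (Real.rpow_nonneg (hg₀.le.trans (ih s ⟨hs.1, lt_of_le_of_lt hs.2 ht.2⟩)) _)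
      change g₀ ≤ g₀ + leftFracIntegral α (fun s => B * G n s ^ p) t
      linarith
  have hGh : ∀ n, ∀ t ∈ Ico 0 T, G n t ≤ h t := by
    intro n
    induction n with
    | zero => exact hhge
    | succ n ih =>
      intro t ht
      refine le_trans (add_le_add le_rfl ?_) (hh.le t ht)
      apply leftFracIntegral_mono hα₀ ht.1 (hint (hGc n) t ht) (hint hh.continuousOn t ht)
      intro s hs
      have hs' : s ∈ Ico 0 T := ⟨hs.1, hs.2.trans ht.2⟩
      exact hpowmono (hg₀.le.trans (hGge n s hs')) (ih s hs')
  have hGs : ∀ n, ∀ t ∈ Ico 0 T, G n t ≤ G (n + 1) t := by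
    intro n
    induction n with
    | zero => exact fun t ht => hGge 1 t ht
    | succ n ih =>
      intro t ht
      refine add_le_add le_rfl ?_
      apply leftFracIntegral_mono hα₀ ht.1 (hint (hGc n) t ht) (hint (hGc (n + 1)) t ht)
      intro s hs
      have hs' : s ∈ Ico 0 T := ⟨hs.1, hs.2.trans ht.2⟩
      exact hpowmono (hg₀.le.trans (hGge n s hs')) (ih s hs')
  have hbdd : ∀ t ∈ Ico 0 T, BddAbove (range fun n => G n t) := fun t ht =>
    ⟨h t, by rintro _ ⟨n, rfl⟩; exact hGh n t ht⟩
  -- The iterates increase and are bounded by h, so the supremum is a finite pointwise limit; the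
  -- integrand built from h dominates when passing to the limit in the equation.
  set g : ℝ → ℝ := fun t => ⨆ n, G n t with hg
  have hlim : ∀ t ∈ Ico 0 T, Tendsto (fun n => G n t) atTop (𝓝 (g t)) := fun t ht =>
    tendsto_atTop_ciSup (monotone_nat_of_le_succ fun n => hGs n t ht) (hbdd t ht)
  have hgge : ∀ t ∈ Ico 0 T, g₀ ≤ g t := fun t ht => ge_of_tendsto' (hlim t ht) fun n => hGge n t ht
  have hgh : ∀ t ∈ Ico 0 T, g t ≤ h t := fun t ht => le_of_tendsto' (hlim t ht) fun n => hGh n t ht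
  have hsub : ∀ t ∈ Ico 0 T, Ioc 0 t ⊆ Ico 0 T := fun t ht s hs => ⟨hs.1.le, lt_of_le_of_lt hs.2 ht.2⟩
  have hplim : ∀ t ∈ Ico 0 T, Tendsto (fun n => B * G n t ^ p) atTop (𝓝 (B * g t ^ p)) :=
    fun t ht => ((hlim t ht).rpow_const (Or.inr hp)).const_mul B
  have hgm : ∀ t ∈ Ico 0 T,
      AEStronglyMeasurable (fun s => B * g s ^ p) (volume.restrict (Ioc 0 t)) := by
    intro t ht
    apply aestronglyMeasurable_of_tendsto_ae atTop (f := fun n s => B * G n s ^ p)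
    · intro n
      exact (ContinuousOn.const_mul_rpow ((hGc n).mono (hsub t ht)) B hp).aestronglyMeasurable
        measurableSet_Ioc
    · filter_upwards [ae_restrict_mem measurableSet_Ioc] with s hs
      exact hplim s (hsub t ht hs)
  have heq : ∀ t ∈ Ico 0 T, g t = g₀ + leftFracIntegral α (fun s => B * g s ^ p) t := by
    intro t ht
    have h1 : Tendsto (fun n => G (n + 1) t) atTop (𝓝 (g t)) :=
      (hlim t ht).comp (tendsto_add_atTop_nat 1)
    refine tendsto_nhds_unique h1 (Tendsto.const_add g₀ ?_)
    unfold leftFracIntegral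
    apply Tendsto.const_mul
    apply intervalIntegral.tendsto_integral_filter_of_dominated_convergence
      (fun x => (t - x) ^ (-(1 - α)) * (B * h x ^ p))
    · refine Eventually.of_forall fun n => ?_
      rw [uIoc_of_le ht.1]
      exact ((intervalIntegrable_iff_integrableOn_Ioc_of_le ht.1).1
        (hint (hGc n) t ht)).aestronglyMeasurable
    · refine Eventually.of_forall fun n => Eventually.of_forall fun x hx => ?_
      rw [uIoc_of_le ht.1] at hx
      have hx' := hsub t ht hx
      have hk : 0 ≤ (t - x) ^ (-(1 - α)) := Real.rpow_nonneg (by linarith [hx.2]) _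
      have hG0 := hg₀.le.trans (hGge n x hx')
      rw [Real.norm_eq_abs, abs_of_nonneg (mul_nonneg hk (mul_nonneg hB.le (Real.rpow_nonneg hG0 _)))]
      exact mul_le_mul_of_nonneg_left (hpowmono hG0 (hGh n x hx')) hk
    · exact hint hh.continuousOn t ht
    · refine Eventually.of_forall fun x hx => ?_
      rw [uIoc_of_le ht.1] at hx
      exact (hplim x (hsub t ht hx)).const_mul _
  -- A monotone limit need not be continuous. Continuity is recovered from the equation, because the
  -- fractional integral of a bounded measurable function is Hölder continuous.
  have hgc : ContinuousOn g (Ico 0 T) := by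
    apply continuousOn_Ico_of_forall_Icc
    intro b hb
    have hIcc : Icc 0 b ⊆ Ico 0 T := fun x hx => ⟨hx.1, lt_of_le_of_lt hx.2 hb.2⟩
    obtain ⟨M, hM⟩ := isCompact_Icc.exists_bound_of_continuousOn
      ((ContinuousOn.const_mul_rpow hh.continuousOn B hp).mono hIcc)
    have h2 : ContinuousOn (leftFracIntegral α (fun s => B * g s ^ p)) (Icc 0 b) := by
      apply continuousOn_leftFracIntegral_of_bounded hα₀ hα₁ (M := M) (hgm b hb)
      intro s hs
      have hs' := hsub b hb hs
      have hg0 := hg₀.le.trans (hgge s hs')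
      rw [abs_of_nonneg (mul_nonneg hB.le (Real.rpow_nonneg hg0 _))]
      exact (hpowmono hg0 (hgh s hs')).trans ((le_abs_self _).trans (hM s (Ioc_subset_Icc_self hs)))
    exact (continuousOn_const.add h2).congr fun t ht => heq t (hIcc ht)
  exact ⟨g, isODESolution_of_integral_eq hα₀ hα₁ hp hT hgc
    (fun t ht => hg₀.le.trans (hgge t ht)) heq⟩
/-! ### Bounds for the maximal existence time -/

/-- Strict comparison of a subsolution with a supersolution having a larger initial value. -/
theorem IsSupersolution.lt_of_subsolution {α p B g₀ w₀ T τ : ℝ} {h w : ℝ → ℝ} (hα₀ : 0 < α)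
    (hp : 0 ≤ p) (hB : 0 < B) (hh : IsSupersolution α p B g₀ T h) (hτ : τ ≤ T) (hw₀ : w₀ < g₀)
    (hwc : ContinuousOn w (Ico 0 τ)) (hwn : ∀ t ∈ Ico 0 τ, 0 ≤ w t)
    (hw : ∀ t ∈ Ico 0 τ, w t ≤ w₀ + leftFracIntegral α (fun s => B * w s ^ p) t) :
    ∀ t ∈ Ico 0 τ, w t < h t := by
  intro t₁ ht₁
  by_contra hcon
  have hsub : Icc 0 t₁ ⊆ Ico 0 τ := fun x hx => ⟨hx.1, lt_of_le_of_lt hx.2 ht₁.2⟩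
  have hhc : ContinuousOn h (Ico 0 τ) := hh.continuousOn.mono (Ico_subset_Ico le_rfl hτ)
  have hcl : IsClosed {t ∈ Icc 0 t₁ | h t ≤ w t} :=
    isClosed_Icc.isClosed_le (hhc.mono hsub) (hwc.mono hsub)
  have hcpt : IsCompact {t ∈ Icc 0 t₁ | h t ≤ w t} :=
    isCompact_Icc.of_isClosed_subset hcl fun x hx => hx.1
  -- At the first time t with h ≤ w the two functions are still ordered on [0,t). The fractional
  -- integrals up to t are then ordered too, and the gap w₀ < g₀ gives w(t) < h(t).
  obtain ⟨t, ⟨ht, hht⟩, hmin⟩ := hcpt.exists_isLeast ⟨t₁, ⟨ht₁.1, le_rfl⟩, not_lt.1 hcon⟩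
  have htτ := hsub ht
  have htT : t ∈ Ico 0 T := ⟨htτ.1, lt_of_lt_of_le htτ.2 hτ⟩
  have hle : leftFracIntegral α (fun s => B * w s ^ p) t ≤
      leftFracIntegral α (fun s => B * h s ^ p) t := by
    apply leftFracIntegral_mono hα₀ ht.1
      (intervalIntegrable_kernel_mul_of_continuousOn hα₀
        (ContinuousOn.const_mul_rpow hwc B hp) htτ)
      (intervalIntegrable_kernel_mul_of_continuousOn hα₀
        (ContinuousOn.const_mul_rpow hhc B hp) htτ)
    intro s hs
    have hs1 : s ∈ Icc 0 t₁ := ⟨hs.1, hs.2.le.trans ht.2⟩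
    have hlt : w s < h s := by
      by_contra hc
      exact absurd (hmin ⟨hs1, not_lt.1 hc⟩) (not_le.2 hs.2)
    exact mul_le_mul_of_nonneg_left (Real.rpow_le_rpow (hwn s (hsub hs1)) hlt.le hp) hB.le
  have h1 := hh.le t htT
  have h2 := hw t htτ
  linarith

/-- The function `(a - c t^α)^{-1/(p-1)}` is a subsolution. -/
lemma explicit_subsolution {α p B a τ : ℝ} (hα₀ : 0 < α) (hα₁ : α < 1) (hp : 1 < p) (hB : 0 < B)
    (hpos : ∀ t ∈ Ico 0 τ, 0 < a - (p - 1) * B / Real.Gamma (1 + α) * t ^ α) :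
    ∀ t ∈ Ico 0 τ, (a - (p - 1) * B / Real.Gamma (1 + α) * t ^ α) ^ (-(1 / (p - 1))) ≤
      a ^ (-(1 / (p - 1))) + leftFracIntegral α (fun s => B *
        ((a - (p - 1) * B / Real.Gamma (1 + α) * s ^ α) ^ (-(1 / (p - 1)))) ^ p) t := by
  set c := (p - 1) * B / Real.Gamma (1 + α) with hc
  have hp1 : 0 < p - 1 := by linarith
  have hΓ : 0 < Real.Gamma (1 + α) := Real.Gamma_pos_of_pos (by linarith)
  have hΓα : 0 < Real.Gamma α := Real.Gamma_pos_of_pos hα₀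
  have hΓα' : 0 < Real.Gamma (1 - α) := Real.Gamma_pos_of_pos (by linarith)
  have hc0 : 0 < c := by positivity
  set y : ℝ → ℝ := fun t => a - c * t ^ α with hy
  set w : ℝ → ℝ := fun t => y t ^ (-(1 / (p - 1))) with hw
  have hwp : ∀ t ∈ Ico 0 τ, w t ^ p = y t ^ (-(1 / (p - 1)) - 1) := by
    intro t ht
    simp only [hw]
    rw [← Real.rpow_mul (hpos t ht).le]
    congr 1
    field_simp
    ring
  have hyc : ContinuousOn y (Ico 0 τ) := by
    apply continuousOn_const.sub
    exact continuousOn_const.mul (continuousOn_id.rpow_const fun _ _ => Or.inr hα₀.le)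
  have hwc : ContinuousOn w (Ico 0 τ) := hyc.rpow_const fun t ht => Or.inl (hpos t ht).ne'
  have hwpos : ∀ t ∈ Ico 0 τ, 0 < w t := fun t ht => Real.rpow_pos_of_pos (hpos t ht) _
  have hyanti : ∀ s r, 0 ≤ s → s ≤ r → y r ≤ y s := by
    intro s r hs hsr
    have := Real.rpow_le_rpow hs hsr hα₀.le
    have := mul_le_mul_of_nonneg_left this hc0.le
    simp only [hy]
    linarith
  have hwmono : ∀ s r, 0 ≤ s → s ≤ r → r < τ → w s ≤ w r := by
    intro s r hs hsr hr
    apply Real.rpow_le_rpow_of_nonpos (hpos r ⟨hs.trans hsr, hr⟩) (hyanti s r hs hsr)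
    have : 0 < 1 / (p - 1) := by positivity
    linarith
  have hwpc : ContinuousOn (fun s => B * w s ^ p) (Ico 0 τ) :=
    ContinuousOn.const_mul_rpow hwc B (by linarith)
  -- F is the derivative of w: the constant c is chosen so that w' = (B/Γ(α)) s^{α-1} w^p.
  set F : ℝ → ℝ := fun s => 1 / Real.Gamma α * (s ^ (-(1 - α)) * (B * w s ^ p)) with hF
  have hFi : ∀ t ∈ Ico 0 τ, IntervalIntegrable F volume 0 t := by
    intro t ht
    apply IntervalIntegrable.const_mul
    apply (intervalIntegral.intervalIntegrable_rpow' (by linarith)).mul_continuousOn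
    rw [uIcc_of_le ht.1]
    exact hwpc.mono fun x hx => ⟨hx.1, lt_of_le_of_lt hx.2 ht.2⟩
  have hw0 : w 0 = a ^ (-(1 / (p - 1))) := by
    simp [hw, hy, Real.zero_rpow hα₀.ne']
  intro t ht
  have hFTC : ∫ s in (0 : ℝ)..t, F s = w t - w 0 := by
    apply intervalIntegral.integral_eq_sub_of_hasDerivAt_of_le ht.1
    · exact hwc.mono fun x hx => ⟨hx.1, lt_of_le_of_lt hx.2 ht.2⟩
    · intro s hs
      have hs' : s ∈ Ico 0 τ := ⟨hs.1.le, hs.2.trans ht.2⟩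
      have d1 : HasDerivAt y (-(c * (α * s ^ (α - 1)))) s :=
        ((Real.hasDerivAt_rpow_const (Or.inl hs.1.ne')).const_mul c).const_sub a
      have d2 := d1.rpow_const (p := -(1 / (p - 1))) (Or.inl (hpos s hs').ne')
      have e : F s = -(c * (α * s ^ (α - 1))) * -(1 / (p - 1)) * y s ^ (-(1 / (p - 1)) - 1) := by
        simp only [hF]
        rw [hwp s hs', hc, show -(1 - α) = α - 1 by ring, add_comm 1 α, Real.Gamma_add_one hα₀.ne']
        have := hα₀.ne'
        field_simp
      rw [e]
      exact d2
    · exact hFi t ht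
  rcases eq_or_lt_of_le ht.1 with h0 | h0
  · subst h0
    rw [leftFracIntegral_zero, add_zero, ← hw0]
  -- The Caputo derivative of w is I^{1-α} w'. Since w increases, w(s)^p ≤ w(r)^p can be taken out,
  -- and the remaining Beta integral cancels the Gamma factors.
  have hIF : ∀ r ∈ Ico 0 t, leftFracIntegral (1 - α) F r ≤ B * w r ^ p := by
    intro r hr
    have hrτ : r ∈ Ico 0 τ := ⟨hr.1, hr.2.trans ht.2⟩
    rcases eq_or_lt_of_le hr.1 with h0 | h0
    · subst h0
      rw [leftFracIntegral_zero]
      exact mul_nonneg hB.le (Real.rpow_nonneg (hwpos _ hrτ).le _)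
    have hb := integral_beta_kernel (a := 1 - α) (by linarith) (by linarith) h0
    have hbi := intervalIntegrable_beta_kernel (a := 1 - α) (by linarith) (by linarith) h0
    rw [sub_sub_cancel] at hb hbi
    simp only [sub_zero] at hb hbi
    unfold leftFracIntegral
    have hle : ∫ s in (0 : ℝ)..r, (r - s) ^ (-(1 - (1 - α))) * F s ≤
        ∫ s in (0 : ℝ)..r, ((r - s) ^ (-(1 - (1 - α))) * s ^ (-(1 - α))) *
          (1 / Real.Gamma α * (B * w r ^ p)) := by
      have hsubr : Icc 0 r ⊆ Ico 0 τ := fun x hx => ⟨hx.1, lt_of_le_of_lt hx.2 hrτ.2⟩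
      have e : (fun s => (r - s) ^ (-(1 - (1 - α))) * F s) = fun s =>
          ((r - s) ^ (-(1 - (1 - α))) * s ^ (-(1 - α))) * (1 / Real.Gamma α * (B * w s ^ p)) := by
        ext s; simp only [hF]; ring
      rw [e]
      have hbi' : IntervalIntegrable (fun s => (r - s) ^ (-(1 - (1 - α))) * s ^ (-(1 - α)))
          volume 0 r := by simpa using hbi
      apply intervalIntegral.integral_mono_on_of_le_Ioo hr.1
      · apply hbi'.mul_continuousOn
        rw [uIcc_of_le hr.1]
        exact continuousOn_const.mul (hwpc.mono hsubr)
      · exact hbi'.mul_const _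
      · intro s hs
        apply mul_le_mul_of_nonneg_left _
          (mul_nonneg (Real.rpow_nonneg (by linarith [hs.2]) _) (Real.rpow_nonneg hs.1.le _))
        have := hwmono s r hs.1.le hs.2.le hrτ.2
        have := hwpos s (hsubr ⟨hs.1.le, hs.2.le⟩)
        gcongr
    rw [intervalIntegral.integral_mul_const] at hle
    have hb' : ∫ s in (0 : ℝ)..r, (r - s) ^ (-(1 - (1 - α))) * s ^ (-(1 - α)) =
        Real.Gamma (1 - α) * Real.Gamma α := by simpa using hb
    rw [hb'] at hle
    calc 1 / Real.Gamma (1 - α) * ∫ s in (0 : ℝ)..r, (r - s) ^ (-(1 - (1 - α))) * F s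
        ≤ 1 / Real.Gamma (1 - α) *
          (Real.Gamma (1 - α) * Real.Gamma α * (1 / Real.Gamma α * (B * w r ^ p))) := by
          gcongr
      _ = B * w r ^ p := by field_simp
  have hcomp := leftFracIntegral_leftFracIntegral hα₀ hα₁ ht.1 (hFi t ht)
  rw [hFTC] at hcomp
  have hwlt : 0 < w t - w 0 := by
    apply sub_pos.2
    apply Real.rpow_lt_rpow_of_neg (hpos t ht)
    · simp only [hy, Real.zero_rpow hα₀.ne']
      have : 0 < c * t ^ α := mul_pos hc0 (Real.rpow_pos_of_pos h0 _)
      linarith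
    · have : 0 < 1 / (p - 1) := by positivity
      linarith
  have hkey : w t - w 0 ≤ leftFracIntegral α (fun s => B * w s ^ p) t := by
    rw [← hcomp]
    apply leftFracIntegral_mono hα₀ ht.1 _
      (intervalIntegrable_kernel_mul_of_continuousOn hα₀ hwpc ht) hIF
    -- The semigroup law identifies this integral, up to a Gamma factor, with w(t) - w(0) > 0, so it
    -- is nonzero and the integrand is integrable.
    apply intervalIntegral.intervalIntegrable_of_integral_ne_zero
    intro hz
    rw [leftFracIntegral, hz, mul_zero] at hcomp
    exact hwlt.ne hcomp
  change w t ≤ _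
  rw [← hw0]
  linarith

/-- The explicit subsolution (a - c t^α)^{-1/(p-1)} becomes infinite at (a/c)^{1/α}. A supersolution
with larger initial value lies above it, so it cannot be continuous beyond that time. -/
theorem IsSupersolution.rpow_time_le {α p B g₀ T : ℝ} {h : ℝ → ℝ} (hα₀ : 0 < α) (hα₁ : α < 1)
    (hp : 1 < p) (hB : 0 < B) (hg₀ : 0 < g₀) (hT : 0 < T) (hh : IsSupersolution α p B g₀ T h) :
    T ^ α * (B * g₀ ^ (p - 1) * (p - 1)) ≤ Real.Gamma (1 + α) := by
  have hp1 : 0 < p - 1 := by linarith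
  have hΓ : 0 < Real.Gamma (1 + α) := Real.Gamma_pos_of_pos (by linarith)
  by_contra hcon
  rw [not_le] at hcon
  -- The comparison needs a strict gap between initial values. The negated bound is strict and
  -- continuous in the initial value, so it survives a slight decrease of g₀.
  obtain ⟨w₀, hw₀lt, hw₀pos, hw₀⟩ : ∃ w₀ < g₀, 0 < w₀ ∧
      Real.Gamma (1 + α) < T ^ α * (B * w₀ ^ (p - 1) * (p - 1)) := by
    have hct : ContinuousAt (fun x : ℝ => T ^ α * (B * x ^ (p - 1) * (p - 1))) g₀ := by
      have : ContinuousAt (fun x : ℝ => x ^ (p - 1)) g₀ :=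
        Real.continuousAt_rpow_const _ _ (Or.inl hg₀.ne')
      fun_prop
    have h1 : ∀ᶠ x in 𝓝[<] g₀, Real.Gamma (1 + α) < T ^ α * (B * x ^ (p - 1) * (p - 1)) :=
      nhdsWithin_le_nhds (hct.eventually (lt_mem_nhds hcon))
    have h2 : ∀ᶠ x in 𝓝[<] g₀, 0 < x := nhdsWithin_le_nhds (lt_mem_nhds hg₀)
    obtain ⟨x, h1, h2, h3⟩ := (h1.and (h2.and self_mem_nhdsWithin)).exists
    exact ⟨x, h3, h2, h1⟩
  set a := w₀ ^ (-(p - 1)) with ha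
  have ha0 : 0 < a := Real.rpow_pos_of_pos hw₀pos _
  have haw : a ^ (-(1 / (p - 1))) = w₀ := by
    rw [ha, ← Real.rpow_mul hw₀pos.le]
    have : -(p - 1) * -(1 / (p - 1)) = 1 := by field_simp
    rw [this, Real.rpow_one]
  set c := (p - 1) * B / Real.Gamma (1 + α) with hc
  have hc0 : 0 < c := by positivity
  set τ := (a / c) ^ (1 / α) with hτ
  have hτα : τ ^ α = a / c := by
    rw [hτ, ← Real.rpow_mul (by positivity), one_div_mul_cancel hα₀.ne', Real.rpow_one]
  have hτ0 : 0 < τ := by positivity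
  have hτT : τ < T := by
    rw [← Real.rpow_lt_rpow_iff hτ0.le hT.le hα₀, hτα, hc, ha, Real.rpow_neg hw₀pos.le]
    have : 0 < w₀ ^ (p - 1) := Real.rpow_pos_of_pos hw₀pos _
    rw [div_lt_iff₀ (by positivity), inv_lt_iff_one_lt_mul₀ this]
    calc (1 : ℝ) < T ^ α * (B * w₀ ^ (p - 1) * (p - 1)) / Real.Gamma (1 + α) := by
          rwa [one_lt_div hΓ]
      _ = _ := by ring
  have hpos : ∀ t ∈ Ico 0 τ, 0 < a - c * t ^ α := by
    intro t ht
    have h1 : t ^ α < τ ^ α := Real.rpow_lt_rpow ht.1 ht.2 hα₀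
    rw [hτα, lt_div_iff₀ hc0] at h1
    linarith
  have hsubsol := explicit_subsolution hα₀ hα₁ hp hB hpos
  rw [haw] at hsubsol
  have hlt := hh.lt_of_subsolution hα₀ (by linarith) hB hτT.le hw₀lt
    (w := fun t => (a - c * t ^ α) ^ (-(1 / (p - 1)))) (by
      apply ContinuousOn.rpow_const
      · exact continuousOn_const.sub (continuousOn_const.mul
          (continuousOn_id.rpow_const fun _ _ => Or.inr hα₀.le))
      · exact fun t ht => Or.inl (hpos t ht).ne')
    (fun t ht => Real.rpow_nonneg (hpos t ht).le _) hsubsol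
  obtain ⟨M, hM⟩ := (isCompact_Icc (a := (0 : ℝ)) (b := τ)).exists_bound_of_continuousOn
    (hh.continuousOn.mono fun x hx => ⟨hx.1, lt_of_le_of_lt hx.2 hτT⟩)
  set M' := |M| + 1 with hM'
  have hM'0 : 0 < M' := by positivity
  -- η is the value prescribed for a - c t^α: small enough that the subsolution exceeds the bound M
  -- of h on [0,τ], and at most a so that such a t ≥ 0 exists.
  set η := min a (M' ^ (-(p - 1))) with hη
  have hη0 : 0 < η := lt_min ha0 (Real.rpow_pos_of_pos hM'0 _)
  have hηa : η ≤ a := min_le_left _ _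
  have hbase : 0 ≤ (a - η) / c := div_nonneg (by linarith) hc0.le
  set t := ((a - η) / c) ^ (1 / α) with ht
  have htα : t ^ α = (a - η) / c := by
    rw [ht, ← Real.rpow_mul hbase, one_div_mul_cancel hα₀.ne', Real.rpow_one]
  have ht0 : 0 ≤ t := Real.rpow_nonneg hbase _
  have htτ : t < τ := by
    rw [← Real.rpow_lt_rpow_iff ht0 hτ0.le hα₀, htα, hτα]
    gcongr
    linarith
  have h1 := hlt t ⟨ht0, htτ⟩
  simp only [htα] at h1
  have h2 : a - c * ((a - η) / c) = η := by field_simp; ring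
  rw [h2] at h1
  have h3 : M' ≤ η ^ (-(1 / (p - 1))) := by
    have : M' = (M' ^ (-(p - 1))) ^ (-(1 / (p - 1))) := by
      rw [← Real.rpow_mul hM'0.le]
      have : -(p - 1) * -(1 / (p - 1)) = 1 := by field_simp
      rw [this, Real.rpow_one]
    rw [this]
    apply Real.rpow_le_rpow_of_nonpos hη0 (min_le_right _ _)
    have : 0 < 1 / (p - 1) := by positivity
    linarith
  have h4 := hM t ⟨ht0, htτ.le⟩
  rw [Real.norm_eq_abs] at h4
  have := le_abs_self (h t)
  have := le_abs_self M
  linarith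

/-- Only the part of the fractional integral over [r,t] is kept; it upgrades a constant lower bound
m into one that grows with t - r. -/
lemma IsSupersolution.le_of_le_on {α p B g₀ T m r : ℝ} {h : ℝ → ℝ} (hα₀ : 0 < α) (hp : 0 ≤ p)
    (hB : 0 < B) (hg₀ : 0 ≤ g₀) (hh : IsSupersolution α p B g₀ T h) (hm : 0 ≤ m) (hr : 0 ≤ r)
    (hle : ∀ t ∈ Ico r T, m ≤ h t) :
    ∀ t ∈ Ico r T, B * m ^ p * (t - r) ^ α / Real.Gamma (1 + α) ≤ h t := by
  intro t ht
  have ht' : t ∈ Ico 0 T := ⟨hr.trans ht.1, ht.2⟩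
  refine le_trans ?_ ((le_add_of_nonneg_left hg₀).trans (hh.le t ht'))
  have hi := intervalIntegrable_kernel_mul_of_continuousOn hα₀
    (ContinuousOn.const_mul_rpow hh.continuousOn B hp) ht'
  have hi1 : IntervalIntegrable (fun x => (t - x) ^ (-(1 - α)) * (B * h x ^ p)) volume 0 r :=
    hi.mono_set (by rw [uIcc_of_le hr, uIcc_of_le ht'.1]; exact Icc_subset_Icc le_rfl ht.1)
  have hi2 : IntervalIntegrable (fun x => (t - x) ^ (-(1 - α)) * (B * h x ^ p)) volume r t :=
    hi.mono_set (by rw [uIcc_of_le ht.1, uIcc_of_le ht'.1]; exact Icc_subset_Icc hr le_rfl)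
  unfold leftFracIntegral
  rw [← intervalIntegral.integral_add_adjacent_intervals hi1 hi2]
  have e1 : 0 ≤ ∫ x in (0 : ℝ)..r, (t - x) ^ (-(1 - α)) * (B * h x ^ p) := by
    apply intervalIntegral.integral_nonneg hr
    intro x hx
    exact mul_nonneg (Real.rpow_nonneg (by linarith [hx.2, ht.1]) _) (mul_nonneg hB.le
      (Real.rpow_nonneg (hh.nonneg x ⟨hx.1, by linarith [hx.2, ht.1, ht.2]⟩) _))
  have e2 : ∫ x in r..t, (t - x) ^ (-(1 - α)) * (B * m ^ p) ≤
      ∫ x in r..t, (t - x) ^ (-(1 - α)) * (B * h x ^ p) := by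
    apply intervalIntegral.integral_mono_on ht.1 ((intervalIntegrable_kernel hα₀ t r t).mul_const _)
      hi2
    intro x hx
    apply mul_le_mul_of_nonneg_left _ (Real.rpow_nonneg (by linarith [hx.2]) _)
    have := hle x ⟨hx.1, lt_of_le_of_lt hx.2 ht.2⟩
    gcongr
  rw [intervalIntegral.integral_mul_const, integral_kernel hα₀] at e2
  have hΓ := Real.Gamma_pos_of_pos hα₀
  calc B * m ^ p * (t - r) ^ α / Real.Gamma (1 + α)
      = 1 / Real.Gamma α * ((t - r) ^ α / α * (B * m ^ p)) := by
        rw [add_comm 1 α, Real.Gamma_add_one hα₀.ne']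
        field_simp
    _ ≤ _ := by gcongr; linarith

/-- The lower bound is improved by the factor ρ = 2^{α/(p-1)} over each time step of length θ x
2^{-n}, where x = 2^{1/(p-1)}. These lengths sum to 2θx = θ 2^{p/(p-1)}, and at that time h would
exceed every g₀ ρ^n. -/
theorem IsSupersolution.time_le_of_doubling {α p B g₀ T : ℝ} {h : ℝ → ℝ} (hα₀ : 0 < α)
    (hp : 1 < p) (hB : 0 < B) (hg₀ : 0 < g₀) (hh : IsSupersolution α p B g₀ T h) :
    T ≤ (Real.Gamma (1 + α) / (B * g₀ ^ (p - 1))) ^ (1 / α) * 2 ^ (p / (p - 1)) := by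
  have hp1 : 0 < p - 1 := by linarith
  have hΓ : 0 < Real.Gamma (1 + α) := Real.Gamma_pos_of_pos (by linarith)
  have hgp : 0 < g₀ ^ (p - 1) := Real.rpow_pos_of_pos hg₀ _
  set θ := (Real.Gamma (1 + α) / (B * g₀ ^ (p - 1))) ^ (1 / α) with hθ
  have hθ0 : 0 < θ := by positivity
  have hθα : θ ^ α = Real.Gamma (1 + α) / (B * g₀ ^ (p - 1)) := by
    rw [hθ, ← Real.rpow_mul (by positivity), one_div_mul_cancel hα₀.ne', Real.rpow_one]
  set x : ℝ := 2 ^ (1 / (p - 1)) with hx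
  have hx0 : 0 < x := by positivity
  have hx1 : 1 < x := Real.one_lt_rpow (by norm_num) (by positivity)
  have hxp : x ^ (p - 1) = 2 := by
    rw [hx, ← Real.rpow_mul (by norm_num), one_div_mul_cancel hp1.ne', Real.rpow_one]
  have h2x : (2 : ℝ) ^ (p / (p - 1)) = 2 * x := by
    rw [hx, show p / (p - 1) = 1 + 1 / (p - 1) by field_simp; ring,
      Real.rpow_add (by norm_num), Real.rpow_one]
  set ρ := x ^ α with hρ
  have hρ0 : 0 < ρ := by positivity
  have hρ1 : 1 < ρ := Real.one_lt_rpow hx1 hα₀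
  set r : ℕ → ℝ := fun n => θ * x * (2 * (1 - (1 / 2) ^ n)) with hr
  have hr0 : ∀ n, 0 ≤ r n := by
    intro n
    have : ((1 : ℝ) / 2) ^ n ≤ 1 := pow_le_one₀ (by norm_num) (by norm_num)
    have : 0 ≤ 2 * (1 - ((1 : ℝ) / 2) ^ n) := by linarith
    positivity
  have hrs : ∀ n, r (n + 1) - r n = θ * x * (1 / 2) ^ n := by
    intro n
    simp only [hr, pow_succ]
    ring
  have hclaim : ∀ n, ∀ t ∈ Ico (r n) T, g₀ * ρ ^ n ≤ h t := by
    intro n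
    induction n with
    | zero =>
      intro t ht
      rw [pow_zero, mul_one]
      exact hh.initial_le hα₀ hB t ⟨(hr0 0).trans ht.1, ht.2⟩
    | succ n ih =>
      intro t ht
      have hstep : 0 < θ * x * (1 / 2 : ℝ) ^ n := by positivity
      have h1 : θ * x * (1 / 2) ^ n ≤ t - r n := by linarith [hrs n, ht.1]
      have h2 := hh.le_of_le_on hα₀ (by linarith) hB hg₀.le (by positivity) (hr0 n) ih t
        ⟨by linarith, ht.2⟩
      refine le_trans ?_ h2
      have h3 : (θ * x * (1 / 2) ^ n) ^ α ≤ (t - r n) ^ α := Real.rpow_le_rpow hstep.le h1 hα₀.le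
      have h4 : (θ * x * (1 / 2) ^ n) ^ α =
          Real.Gamma (1 + α) / (B * g₀ ^ (p - 1)) * ρ * ((1 / 2 : ℝ) ^ α) ^ n := by
        rw [Real.mul_rpow (by positivity) (by positivity), Real.mul_rpow hθ0.le hx0.le, hθα,
          Real.rpow_pow_comm (by norm_num)]
      -- As x^{p-1} = 2, one has ρ^p = ρ 2^α. The surplus 2^{αn} compensates exactly the factor
      -- 2^{-αn} lost to the shorter step.
      have h5 : (ρ ^ n) ^ p = ρ ^ n * ((2 : ℝ) ^ α) ^ n := by
        have e1 : (ρ ^ n) ^ p = (ρ ^ p) ^ n := by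
          rw [← Real.rpow_natCast, ← Real.rpow_natCast, ← Real.rpow_mul hρ0.le,
            ← Real.rpow_mul hρ0.le, mul_comm]
        have e2 : ρ ^ p = ρ * 2 ^ α := by
          rw [← hxp, hρ, ← Real.rpow_mul hx0.le, ← Real.rpow_mul hx0.le, ← Real.rpow_add hx0]
          congr 1; ring
        rw [e1, e2, mul_pow]
      have h6 : (g₀ * ρ ^ n) ^ p = g₀ * g₀ ^ (p - 1) * (ρ ^ n * ((2 : ℝ) ^ α) ^ n) := by
        rw [Real.mul_rpow hg₀.le (by positivity), h5]
        congr 1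
        rw [← Real.rpow_one_add' hg₀.le (by linarith)]
        congr 1; ring
      have h7 : ((1 / 2 : ℝ) ^ α) ^ n * ((2 : ℝ) ^ α) ^ n = 1 := by
        rw [← mul_pow, ← Real.mul_rpow (by norm_num) (by norm_num)]
        norm_num
      calc g₀ * ρ ^ (n + 1) = B * (g₀ * ρ ^ n) ^ p * (θ * x * (1 / 2) ^ n) ^ α /
            Real.Gamma (1 + α) := by
            rw [h4, h6]
            have : B * (g₀ * g₀ ^ (p - 1) * (ρ ^ n * ((2 : ℝ) ^ α) ^ n)) *
                (Real.Gamma (1 + α) / (B * g₀ ^ (p - 1)) * ρ * ((1 / 2 : ℝ) ^ α) ^ n) /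
                Real.Gamma (1 + α) =
                g₀ * ρ ^ (n + 1) * (((1 / 2 : ℝ) ^ α) ^ n * ((2 : ℝ) ^ α) ^ n) := by
              rw [pow_succ]
              field_simp
            rw [this, h7, mul_one]
        _ ≤ _ := by gcongr
  by_contra hcon
  rw [not_le, h2x] at hcon
  have hts : ∀ n, θ * (2 * x) ∈ Ico (r n) T := by
    intro n
    refine ⟨?_, hcon⟩
    have h1 : 0 < ((1 : ℝ) / 2) ^ n := by positivity
    have h2 : 0 < θ * x := by positivity
    simp only [hr]
    nlinarith
  obtain ⟨n, hn⟩ := ((tendsto_pow_atTop_atTop_of_one_lt hρ1).const_mul_atTop hg₀).eventually_gt_atTop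
    (h (θ * (2 * x))) |>.exists
  exact absurd (hclaim n _ (hts n)) (not_le.2 hn)

/-- The two entries of the maximum correspond to the two arguments: p - 1 to the explicit
subsolution and 2^{-pα/(p-1)} to the shrinking time steps. -/
theorem IsSupersolution.time_le_upperTime {α p B g₀ T : ℝ} {h : ℝ → ℝ} (hα₀ : 0 < α) (hα₁ : α < 1)
    (hp : 1 < p) (hB : 0 < B) (hg₀ : 0 < g₀) (hT : 0 < T) (hh : IsSupersolution α p B g₀ T h) :
    T ≤ upperTime α p B g₀ := by
  have hp1 : 0 < p - 1 := by linarith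
  have hΓ : 0 < Real.Gamma (1 + α) := Real.Gamma_pos_of_pos (by linarith)
  have hgp : 0 < g₀ ^ (p - 1) := Real.rpow_pos_of_pos hg₀ _
  unfold upperTime
  rcases max_choice (p - 1) ((2 : ℝ) ^ (-(p * α / (p - 1)))) with hmax | hmax <;> rw [hmax]
  · have h1 := hh.rpow_time_le hα₀ hα₁ hp hB hg₀ hT
    rw [← le_div_iff₀ (by positivity)] at h1
    calc T = (T ^ α) ^ (1 / α) := by
          rw [← Real.rpow_mul hT.le, mul_one_div_cancel hα₀.ne', Real.rpow_one]
      _ ≤ _ := Real.rpow_le_rpow (by positivity) h1 (by positivity)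
  · refine (hh.time_le_of_doubling hα₀ hp hB hg₀).trans (le_of_eq ?_)
    rw [Real.rpow_neg (by norm_num), ← div_eq_mul_inv, div_div_eq_mul_div, mul_div_right_comm,
      Real.mul_rpow (by positivity) (by positivity), ← Real.rpow_mul (by norm_num)]
    congr 2
    field_simp

lemma lowerTime_pos {α p B g₀ : ℝ} (hα₀ : 0 < α) (hp : 1 < p) (hB : 0 < B) (hg₀ : 0 < g₀) :
    0 < lowerTime α p B g₀ := by
  have hp1 : 0 < p - 1 := by linarith
  have hΓ : 0 < Real.Gamma (1 + α) := Real.Gamma_pos_of_pos (by linarith)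
  have : 0 < min ((2 : ℝ) ^ p) (p ^ p / (p - 1) ^ (p - 1)) := lt_min (by positivity) (by positivity)
  unfold lowerTime
  positivity

/-- A constant function is a supersolution as long as it is large enough. -/
lemma isSupersolution_const {α p B g₀ T M : ℝ} (hα₀ : 0 < α) (hB : 0 < B) (hM : 0 ≤ M)
    (h : B * M ^ p * T ^ α / Real.Gamma (1 + α) ≤ M - g₀) :
    IsSupersolution α p B g₀ T fun _ => M := by
  refine ⟨continuousOn_const, fun _ _ => hM, fun t ht => ?_⟩
  rw [leftFracIntegral_const hα₀]
  have hΓ : 0 < Real.Gamma (1 + α) := Real.Gamma_pos_of_pos (by linarith)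
  have h1 : t ^ α ≤ T ^ α := Real.rpow_le_rpow ht.1 ht.2.le hα₀.le
  have h2 : B * M ^ p * t ^ α / Real.Gamma (1 + α) ≤ B * M ^ p * T ^ α / Real.Gamma (1 + α) := by
    gcongr
  linarith

/-- A constant M works as long as T^α ≤ Γ(1+α)(M - g₀)/(B M^p). The choices M = 2g₀ and M = p
g₀/(p-1) realise the two entries of the minimum with equality, the second being the maximiser of (M
- g₀)/M^p. -/
lemma exists_isSupersolution_lowerTime {α p B g₀ : ℝ} (hα₀ : 0 < α) (hp : 1 < p) (hB : 0 < B)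
    (hg₀ : 0 < g₀) : ∃ M, IsSupersolution α p B g₀ (lowerTime α p B g₀) fun _ => M := by
  have hp1 : 0 < p - 1 := by linarith
  have hΓ : 0 < Real.Gamma (1 + α) := Real.Gamma_pos_of_pos (by linarith)
  have hgp : 0 < g₀ ^ (p - 1) := Real.rpow_pos_of_pos hg₀ _
  have hmin : 0 < min ((2 : ℝ) ^ p) (p ^ p / (p - 1) ^ (p - 1)) :=
    lt_min (by positivity) (by positivity)
  have hgpp : g₀ ^ p = g₀ * g₀ ^ (p - 1) := by
    rw [← Real.rpow_one_add' hg₀.le (by linarith)]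
    congr 1; ring
  have hTα : lowerTime α p B g₀ ^ α = Real.Gamma (1 + α) /
      (B * g₀ ^ (p - 1) * min (2 ^ p) (p ^ p / (p - 1) ^ (p - 1))) := by
    unfold lowerTime
    rw [← Real.rpow_mul (by positivity), one_div_mul_cancel hα₀.ne', Real.rpow_one]
  rcases min_choice ((2 : ℝ) ^ p) (p ^ p / (p - 1) ^ (p - 1)) with h | h <;> rw [h] at hTα
  · refine ⟨2 * g₀, isSupersolution_const hα₀ hB (by positivity) (le_of_eq ?_)⟩
    rw [hTα, Real.mul_rpow (by norm_num) hg₀.le, hgpp]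
    field_simp
    ring
  · refine ⟨p / (p - 1) * g₀, isSupersolution_const hα₀ hB (by positivity) (le_of_eq ?_)⟩
    have hpp : (p - 1) ^ p = (p - 1) * (p - 1) ^ (p - 1) := by
      rw [← Real.rpow_one_add' hp1.le (by linarith)]
      congr 1; ring
    rw [hTα, Real.mul_rpow (by positivity) hg₀.le, Real.div_rpow (by linarith) hp1.le, hgpp, hpp]
    field_simp
    ring

/-- The maximal existence time is finite and satisfies the two-sided bound; no supersolution
lives longer. -/
theorem exists_isMaximalTime {α p B g₀ : ℝ} (hα₀ : 0 < α) (hα₁ : α < 1) (hp : 1 < p) (hB : 0 < B)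
    (hg₀ : 0 < g₀) : ∃ Tb, IsMaximalTime α p B g₀ Tb ∧ lowerTime α p B g₀ ≤ Tb ∧
      Tb ≤ upperTime α p B g₀ ∧
      ∀ T h, 0 < T → IsSupersolution α p B g₀ T h → T ≤ Tb := by
  obtain ⟨M, hM⟩ := exists_isSupersolution_lowerTime hα₀ hp hB hg₀
  have hlow := lowerTime_pos hα₀ hp hB hg₀
  have hmem : ∀ T h, 0 < T → IsSupersolution α p B g₀ T h →
      T ∈ {T : ℝ | 0 < T ∧ ∃ g : ℝ → ℝ, IsODESolution α p B g₀ T g} := fun T h hT hh =>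
    ⟨hT, hh.exists_isODESolution hα₀ hα₁ (by linarith) hB hg₀ hT⟩
  have hub : upperTime α p B g₀ ∈
      upperBounds {T : ℝ | 0 < T ∧ ∃ g : ℝ → ℝ, IsODESolution α p B g₀ T g} := by
    rintro T ⟨hT, g, hg⟩
    exact (hg.isSupersolution hα₀ hα₁ (by linarith)).time_le_upperTime hα₀ hα₁ hp hB hg₀ hT
  have hsup := isLUB_csSup ⟨_, hmem _ _ hlow hM⟩ ⟨_, hub⟩
  exact ⟨_, hsup, hsup.1 (hmem _ _ hlow hM), hsup.2 hub, fun T h hT hh => hsup.1 (hmem T h hT hh)⟩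
/-! ### The weight -/

lemma weight_pos (N : ℕ) (β : ℝ) (x : E N) : 0 < weight N β x :=
  Real.rpow_pos_of_pos (by positivity) _

lemma weight_le_one {N : ℕ} {β : ℝ} (hβ : 0 < β) (x : E N) : weight N β x ≤ 1 := by
  apply Real.rpow_le_one_of_one_le_of_nonpos (by nlinarith [sq_nonneg ‖x‖])
  have : (0 : ℝ) ≤ N := Nat.cast_nonneg N
  linarith

lemma continuous_weight (N : ℕ) (β : ℝ) : Continuous (weight N β) := by
  unfold weight
  apply Continuous.rpow_const (by fun_prop)
  intro x
  left
  positivity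

lemma weight_neg {N : ℕ} {β : ℝ} (x : E N) : weight N β (-x) = weight N β x := by
  simp [weight]

lemma integrable_weight {N : ℕ} {β : ℝ} (hβ : 0 < β) : Integrable (weight N β) := by
  have h := integrable_rpow_neg_one_add_norm_sq (E := E N) (μ := volume) (r := (N : ℝ) + β)
    (by rw [finrank_euclideanSpace_fin]; linarith)
  refine h.congr (Eventually.of_forall fun x => ?_)
  simp only [weight, neg_div]

lemma weightMass_pos {N : ℕ} {β : ℝ} (hβ : 0 < β) : 0 < weightMass N β := by
  unfold weightMass
  rw [integral_pos_iff_support_of_nonneg (fun x => (weight_pos N β x).le) (integrable_weight hβ)]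
  have : Function.support (weight N β) = univ := by
    ext x; simp [(weight_pos N β x).ne']
  rw [this]
  exact Measure.measure_univ_pos.2 (NeZero.ne _)

lemma weight_le_mul_of_le {N : ℕ} {β c : ℝ} (hβ : 0 < β) (hc : 0 < c) {x y : E N}
    (h : 1 + ‖x‖ ^ 2 ≤ c * (1 + ‖y‖ ^ 2)) :
    weight N β y ≤ c ^ (((N : ℝ) + β) / 2) * weight N β x := by
  have hN : (0 : ℝ) ≤ N := Nat.cast_nonneg N
  unfold weight
  have hx : 0 < 1 + ‖x‖ ^ 2 := by positivity
  have hy : 0 < 1 + ‖y‖ ^ 2 := by positivity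
  have h1 : (1 + ‖x‖ ^ 2) ^ (((N : ℝ) + β) / 2) ≤ (c * (1 + ‖y‖ ^ 2)) ^ (((N : ℝ) + β) / 2) :=
    Real.rpow_le_rpow hx.le h (by linarith)
  rw [Real.mul_rpow hc.le hy.le] at h1
  rw [Real.rpow_neg hx.le, Real.rpow_neg hy.le, ← div_eq_mul_inv,
    le_div_iff₀ (Real.rpow_pos_of_pos hx _), inv_mul_le_iff₀ (Real.rpow_pos_of_pos hy _)]
  linarith

/-- The larger of |x+h| and |h| is at least |x|/2, so the weight there is at most 4^{(N+β)/2} times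
the weight at x, and the other factor is kept. This is what lets the weight at x be pulled out of
the far part of the singular integral. -/
lemma weight_mul_weight_le {N : ℕ} {β : ℝ} (hβ : 0 < β) (x h : E N) :
    weight N β (x + h) * weight N β h ≤
      4 ^ (((N : ℝ) + β) / 2) * weight N β x * (weight N β (x + h) + weight N β h) := by
  have h0 := weight_pos N β x
  have h1 := weight_pos N β (x + h)
  have h2 := weight_pos N β h
  have hc : (0 : ℝ) < 4 ^ (((N : ℝ) + β) / 2) := by positivity
  have htri : ‖x‖ ^ 2 ≤ 2 * ‖x + h‖ ^ 2 + 2 * ‖h‖ ^ 2 := by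
    have e : ‖x‖ ≤ ‖x + h‖ + ‖h‖ := by
      have := norm_sub_le (x + h) h
      rwa [add_sub_cancel_right] at this
    have := pow_le_pow_left₀ (norm_nonneg x) e 2
    nlinarith [sq_nonneg (‖x + h‖ - ‖h‖)]
  rcases le_total ‖x + h‖ ‖h‖ with hle | hle
  · have h3 : ‖x + h‖ ^ 2 ≤ ‖h‖ ^ 2 := pow_le_pow_left₀ (norm_nonneg _) hle 2
    have h4 := weight_le_mul_of_le (β := β) hβ (c := 4) (by norm_num) (x := x) (y := h) (by linarith)
    nlinarith [mul_pos (mul_pos hc h0) h2]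
  · have h3 : ‖h‖ ^ 2 ≤ ‖x + h‖ ^ 2 := pow_le_pow_left₀ (norm_nonneg _) hle 2
    have h4 := weight_le_mul_of_le (β := β) hβ (c := 4) (by norm_num) (x := x) (y := x + h)
      (by linarith)
    nlinarith [mul_pos (mul_pos hc h0) h1]

/-! ### Functions controlled by the weight -/

/-- The negative second difference `2 v(x) - v(x+h) - v(x-h)`. -/
def secondDiff {N : ℕ} (v : E N → ℝ) (x h : E N) : ℝ := 2 * v x - v (x + h) - v (x - h)

/-- `v` and its first and second differences are bounded by `A` times the weight. -/
structure IsTame (N : ℕ) (β A : ℝ) (v : E N → ℝ) : Prop where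
  continuous : Continuous v
  bound : ∀ x, |v x| ≤ A * weight N β x
  diff : ∀ x h, ‖h‖ ≤ 1 → |v (x + h) - v x| ≤ A * weight N β x * ‖h‖
  secondDiff : ∀ x h, ‖h‖ ≤ 1 → |secondDiff v x h| ≤ A * weight N β x * ‖h‖ ^ 2

lemma IsTame.nonneg {N : ℕ} {β A : ℝ} {v : E N → ℝ} (hv : IsTame N β A v) : 0 ≤ A := by
  have h := (abs_nonneg _).trans (hv.bound 0)
  exact nonneg_of_mul_nonneg_left h (weight_pos N β 0)

/-- This is the discrete Leibniz rule. In the second difference the factor w contributes A L once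
through its own second difference and 2 A L through the two products of first differences, hence 1 +
3L. -/
lemma IsTame.mul {N : ℕ} {β A L : ℝ} {v w : E N → ℝ} (hv : IsTame N β A v) (hw : Continuous w)
    (hL : 0 ≤ L) (hw1 : ∀ x, |w x| ≤ 1) (hwd : ∀ x h, |w (x + h) - w x| ≤ L * ‖h‖)
    (hws : ∀ x h, |FracSchrodinger.secondDiff w x h| ≤ L * ‖h‖ ^ 2) :
    IsTame N β (A * (1 + 3 * L)) (fun x => v x * w x) := by
  have hA := hv.nonneg
  refine ⟨hv.continuous.mul hw, fun x => ?_, fun x h hh => ?_, fun x h hh => ?_⟩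
  · have hφ := weight_pos N β x
    rw [abs_mul]
    calc |v x| * |w x| ≤ (A * weight N β x) * 1 :=
          mul_le_mul (hv.bound x) (hw1 x) (abs_nonneg _) (by positivity)
      _ ≤ A * (1 + 3 * L) * weight N β x := by
          have : 0 ≤ A * L * weight N β x := by positivity
          linarith
  · have hφ := weight_pos N β x
    have e : v (x + h) * w (x + h) - v x * w x =
        (v (x + h) - v x) * w (x + h) + v x * (w (x + h) - w x) := by ring
    rw [e]
    refine (abs_add_le _ _).trans ?_
    rw [abs_mul, abs_mul]
    have e1 : |v (x + h) - v x| * |w (x + h)| ≤ (A * weight N β x * ‖h‖) * 1 :=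
      mul_le_mul (hv.diff x h hh) (hw1 _) (abs_nonneg _) (by positivity)
    have e2 : |v x| * |w (x + h) - w x| ≤ (A * weight N β x) * (L * ‖h‖) :=
      mul_le_mul (hv.bound x) (hwd x h) (abs_nonneg _) (by positivity)
    have : 0 ≤ A * L * weight N β x * ‖h‖ := by positivity
    linarith
  · have hφ := weight_pos N β x
    have e : FracSchrodinger.secondDiff (fun x => v x * w x) x h =
        FracSchrodinger.secondDiff v x h * w x + v x * FracSchrodinger.secondDiff w x h -
          (v (x + h) - v x) * (w (x + h) - w x) - (v (x + -h) - v x) * (w (x + -h) - w x) := by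
      simp only [FracSchrodinger.secondDiff, ← sub_eq_add_neg]; ring
    rw [e]
    have e1 : |FracSchrodinger.secondDiff v x h * w x| ≤ (A * weight N β x * ‖h‖ ^ 2) * 1 := by
      rw [abs_mul]
      exact mul_le_mul (hv.secondDiff x h hh) (hw1 _) (abs_nonneg _) (by positivity)
    have e2 : |v x * FracSchrodinger.secondDiff w x h| ≤ (A * weight N β x) * (L * ‖h‖ ^ 2) := by
      rw [abs_mul]
      exact mul_le_mul (hv.bound x) (hws x h) (abs_nonneg _) (by positivity)
    have e3 : |(v (x + h) - v x) * (w (x + h) - w x)| ≤ (A * weight N β x * ‖h‖) * (L * ‖h‖) := by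
      rw [abs_mul]
      exact mul_le_mul (hv.diff x h hh) (hwd x h) (abs_nonneg _) (by positivity)
    have e4 : |(v (x + -h) - v x) * (w (x + -h) - w x)| ≤
        (A * weight N β x * ‖h‖) * (L * ‖h‖) := by
      have h1 := hv.diff x (-h) (by rwa [norm_neg])
      have h2 := hwd x (-h)
      rw [norm_neg] at h1 h2
      rw [abs_mul]
      exact mul_le_mul h1 h2 (abs_nonneg _) (by positivity)
    rw [abs_le] at e1 e2 e3 e4 ⊢
    constructor <;> nlinarith

/-- R ≥ 1 keeps h/R in the unit ball. The constant grows with R, which is harmless because it is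
only used qualitatively, at fixed R; the sharp R-dependence comes from
`IsTame.fracLaplacian_comp_inv_smul`. -/
lemma IsTame.comp_inv_smul {N : ℕ} {β A R : ℝ} {v : E N → ℝ} (hβ : 0 < β) (hv : IsTame N β A v)
    (hR : 1 ≤ R) : IsTame N β (A * (R ^ 2) ^ (((N : ℝ) + β) / 2)) (fun x => v (R⁻¹ • x)) := by
  have hA := hv.nonneg
  have hR0 : 0 < R := by linarith
  have hRi : R⁻¹ ≤ 1 := inv_le_one_of_one_le₀ hR
  have hR2 : (1 : ℝ) ≤ R ^ 2 := one_le_pow₀ hR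
  have hw : ∀ x : E N, weight N β (R⁻¹ • x) ≤ (R ^ 2) ^ (((N : ℝ) + β) / 2) * weight N β x := by
    intro x
    apply weight_le_mul_of_le hβ (by positivity)
    rw [norm_smul, norm_inv, Real.norm_of_nonneg hR0.le, mul_pow, mul_add, ← mul_assoc, ← mul_pow,
      mul_inv_cancel₀ hR0.ne']
    linarith
  have hn : ∀ h : E N, ‖R⁻¹ • h‖ ≤ ‖h‖ := by
    intro h
    rw [norm_smul, norm_inv, Real.norm_of_nonneg hR0.le]
    exact mul_le_of_le_one_left (norm_nonneg _) hRi
  have hAw : ∀ x : E N, A * weight N β (R⁻¹ • x) ≤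
      A * (R ^ 2) ^ (((N : ℝ) + β) / 2) * weight N β x := fun x => by
    rw [mul_assoc]; exact mul_le_mul_of_nonneg_left (hw x) hA
  refine ⟨hv.continuous.comp (by fun_prop), fun x => (hv.bound _).trans (hAw x),
    fun x h hh => ?_, fun x h hh => ?_⟩
  · rw [smul_add]
    refine (hv.diff _ _ ((hn h).trans hh)).trans ?_
    exact mul_le_mul (hAw x) (hn h) (norm_nonneg _)
      (mul_nonneg (mul_nonneg hA (by positivity)) (weight_pos N β x).le)
  · have e : FracSchrodinger.secondDiff (fun x => v (R⁻¹ • x)) x h =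
        FracSchrodinger.secondDiff v (R⁻¹ • x) (R⁻¹ • h) := by
      simp only [FracSchrodinger.secondDiff, smul_add, smul_sub]
    rw [e]
    refine (hv.secondDiff _ _ ((hn h).trans hh)).trans ?_
    exact mul_le_mul (hAw x) (pow_le_pow_left₀ (norm_nonneg _) (hn h) 2) (by positivity)
      (mul_nonneg (mul_nonneg hA (by positivity)) (weight_pos N β x).le)

/-- The second difference is, up to sign, the increment over [0,1] of t ↦ f(t) - f(t-1), so the mean
value inequality applies twice. -/
lemma abs_second_difference_le {f f' f'' : ℝ → ℝ} {M : ℝ} (h1 : ∀ t, HasDerivAt f (f' t) t)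
    (h2 : ∀ t, HasDerivAt f' (f'' t) t) (hM : ∀ t ∈ Icc (-1 : ℝ) 1, |f'' t| ≤ M) :
    |2 * f 0 - f 1 - f (-1)| ≤ M := by
  have hd : ∀ t ∈ Icc (0 : ℝ) 1, HasDerivWithinAt (fun t => f t - f (t - 1)) (f' t - f' (t - 1))
      (Icc 0 1) t := fun t _ =>
    ((h1 t).sub ((h1 (t - 1)).comp_sub_const t 1)).hasDerivWithinAt
  have hb : ∀ t ∈ Icc (0 : ℝ) 1, ‖f' t - f' (t - 1)‖ ≤ M := by
    intro t ht
    have := (convex_Icc (-1 : ℝ) 1).norm_image_sub_le_of_norm_hasDerivWithin_le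
      (f := f') (f' := f'') (C := M) (x := t - 1) (y := t) (fun s _ => (h2 s).hasDerivWithinAt) hM
      ⟨by linarith [ht.1], by linarith [ht.2]⟩ ⟨by linarith [ht.1], by linarith [ht.2]⟩
    simpa using this
  have := (convex_Icc (0 : ℝ) 1).norm_image_sub_le_of_norm_hasDerivWithin_le hd hb
    (left_mem_Icc.2 zero_le_one) (right_mem_Icc.2 zero_le_one)
  simp only [sub_self, zero_sub, sub_zero, norm_one, mul_one, Real.norm_eq_abs] at this
  rw [abs_sub_comm] at this
  refine le_trans (le_of_eq ?_) this
  congr 1; ring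

lemma exists_isTame_weight (N : ℕ) {β : ℝ} (hβ : 0 < β) : ∃ A, IsTame N β A (weight N β) := by
  set m : ℝ := ((N : ℝ) + β) / 2 with hm
  have hN : (0 : ℝ) ≤ N := Nat.cast_nonneg N
  have hm0 : 0 < m := by rw [hm]; positivity
  have h3 : (1 : ℝ) ≤ 3 ^ m := Real.one_le_rpow (by norm_num) hm0.le
  let q : E N → E N → ℝ → ℝ := fun x h t => 1 + ‖x + t • h‖ ^ 2
  let q' : E N → E N → ℝ → ℝ := fun x h t => 2 * inner ℝ (x + t • h) h
  have hq1 : ∀ x h t, 1 ≤ q x h t := fun x h t => by simp only [q]; nlinarith [sq_nonneg ‖x + t • h‖]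
  have hlin : ∀ (x h : E N) (t : ℝ), HasDerivAt (fun t : ℝ => x + t • h) h t := by
    intro x h t
    simpa using ((hasDerivAt_id t).smul_const h).const_add x
  have hq : ∀ x h t, HasDerivAt (q x h) (q' x h t) t := by
    intro x h t
    exact ((hlin x h t).norm_sq).const_add 1
  have hq' : ∀ x h t, HasDerivAt (q' x h) (2 * ‖h‖ ^ 2) t := by
    intro x h t
    have := ((hlin x h t).inner ℝ (hasDerivAt_const t h)).const_mul 2
    simpa [q'] using this
  have hq'b : ∀ x h t, |q' x h t| ≤ 2 * ‖h‖ * q x h t := by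
    intro x h t
    have e1 := abs_real_inner_le_norm (x + t • h) h
    have e2 : ‖x + t • h‖ ≤ 1 + ‖x + t • h‖ ^ 2 := by nlinarith [sq_nonneg (‖x + t • h‖ - 1)]
    simp only [q', q, abs_mul, abs_two]
    nlinarith [norm_nonneg h, mul_le_mul_of_nonneg_right e2 (norm_nonneg h)]
  have hq'b2 : ∀ x h t, (q' x h t) ^ 2 ≤ 4 * ‖h‖ ^ 2 * q x h t := by
    intro x h t
    have e1 := abs_real_inner_le_norm (x + t • h) h
    have e2 := pow_le_pow_left₀ (abs_nonneg _) e1 2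
    rw [sq_abs, mul_pow] at e2
    simp only [q', q]
    nlinarith [sq_nonneg ‖h‖]
  let f : E N → E N → ℝ → ℝ := fun x h t => q x h t ^ (-m)
  let f' : E N → E N → ℝ → ℝ := fun x h t => q' x h t * -m * q x h t ^ (-m - 1)
  let f'' : E N → E N → ℝ → ℝ := fun x h t => 2 * ‖h‖ ^ 2 * -m * q x h t ^ (-m - 1) +
    q' x h t * -m * (q' x h t * (-m - 1) * q x h t ^ (-m - 1 - 1))
  have hf : ∀ x h t, HasDerivAt (f x h) (f' x h t) t := fun x h t =>
    (hq x h t).rpow_const (Or.inl (by linarith [hq1 x h t]))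
  have hf' : ∀ x h t, HasDerivAt (f' x h) (f'' x h t) t := fun x h t =>
    ((hq' x h t).mul_const _).mul ((hq x h t).rpow_const (Or.inl (by linarith [hq1 x h t])))
  have hfw : ∀ x h t, f x h t = weight N β (x + t • h) := fun x h t => rfl
  have hcomp : ∀ x h t, ‖h‖ ≤ 1 → t ∈ Icc (-1 : ℝ) 1 → f x h t ≤ 3 ^ m * weight N β x := by
    intro x h t hh ht
    rw [hfw]
    apply weight_le_mul_of_le hβ (by norm_num)
    have e : ‖x‖ ≤ ‖x + t • h‖ + ‖t • h‖ := by
      have := norm_sub_le (x + t • h) (t • h)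
      rwa [add_sub_cancel_right] at this
    have e2 : ‖t • h‖ ≤ 1 := by
      rw [norm_smul, Real.norm_eq_abs]
      exact mul_le_one₀ (abs_le.2 ht) (norm_nonneg _) hh
    have e3 : ‖x‖ ≤ ‖x + t • h‖ + 1 := by linarith
    have := pow_le_pow_left₀ (norm_nonneg x) e3 2
    nlinarith [sq_nonneg (‖x + t • h‖ - 1)]
  have hr1 : ∀ x h t, q x h t ^ (-m - 1) * q x h t = f x h t := by
    intro x h t
    rw [← Real.rpow_add_one (by linarith [hq1 x h t])]
    congr 1; ring
  have hr2 : ∀ x h t, q x h t ^ (-m - 1 - 1) * q x h t = q x h t ^ (-m - 1) := by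
    intro x h t
    rw [← Real.rpow_add_one (by linarith [hq1 x h t])]
    congr 1; ring
  have hr3 : ∀ x h t, q x h t ^ (-m - 1) ≤ f x h t := by
    intro x h t
    rw [← hr1]
    exact le_mul_of_one_le_right (Real.rpow_nonneg (by linarith [hq1 x h t]) _) (hq1 x h t)
  have hf'b : ∀ x h t, ‖h‖ ≤ 1 → t ∈ Icc (-1 : ℝ) 1 →
      |f' x h t| ≤ 2 * m * 3 ^ m * weight N β x * ‖h‖ := by
    intro x h t hh ht
    have e0 : 0 ≤ q x h t ^ (-m - 1) := Real.rpow_nonneg (by linarith [hq1 x h t]) _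
    simp only [f']
    rw [abs_mul, abs_mul, abs_neg, abs_of_pos hm0, abs_of_nonneg e0]
    calc |q' x h t| * m * q x h t ^ (-m - 1) ≤ (2 * ‖h‖ * q x h t) * m * q x h t ^ (-m - 1) := by
          gcongr; exact hq'b x h t
      _ = 2 * m * ‖h‖ * (q x h t ^ (-m - 1) * q x h t) := by ring
      _ ≤ 2 * m * ‖h‖ * (3 ^ m * weight N β x) := by
          rw [hr1]; gcongr; exact hcomp x h t hh ht
      _ = _ := by ring
  have hf''b : ∀ x h t, ‖h‖ ≤ 1 → t ∈ Icc (-1 : ℝ) 1 →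
      |f'' x h t| ≤ (2 * m + 4 * m * (m + 1)) * 3 ^ m * weight N β x * ‖h‖ ^ 2 := by
    intro x h t hh ht
    have e0 : 0 ≤ q x h t ^ (-m - 1) := Real.rpow_nonneg (by linarith [hq1 x h t]) _
    have e1 : 0 ≤ q x h t ^ (-m - 1 - 1) := Real.rpow_nonneg (by linarith [hq1 x h t]) _
    have hc := hcomp x h t hh ht
    have a1 : |2 * ‖h‖ ^ 2 * -m * q x h t ^ (-m - 1)| ≤ 2 * m * ‖h‖ ^ 2 * (3 ^ m * weight N β x) := by
      rw [mul_neg, neg_mul, abs_neg, abs_of_nonneg (by positivity)]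
      calc 2 * ‖h‖ ^ 2 * m * q x h t ^ (-m - 1) ≤ 2 * ‖h‖ ^ 2 * m * (3 ^ m * weight N β x) := by
            gcongr; exact (hr3 x h t).trans hc
        _ = _ := by ring
    have a2 : |q' x h t * -m * (q' x h t * (-m - 1) * q x h t ^ (-m - 1 - 1))| ≤
        4 * m * (m + 1) * ‖h‖ ^ 2 * (3 ^ m * weight N β x) := by
      have : q' x h t * -m * (q' x h t * (-m - 1) * q x h t ^ (-m - 1 - 1)) =
          m * (m + 1) * (q' x h t) ^ 2 * q x h t ^ (-m - 1 - 1) := by ring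
      rw [this, abs_of_nonneg (by positivity)]
      calc m * (m + 1) * (q' x h t) ^ 2 * q x h t ^ (-m - 1 - 1)
          ≤ m * (m + 1) * (4 * ‖h‖ ^ 2 * q x h t) * q x h t ^ (-m - 1 - 1) := by
            gcongr; exact hq'b2 x h t
        _ = 4 * m * (m + 1) * ‖h‖ ^ 2 * (q x h t ^ (-m - 1 - 1) * q x h t) := by ring
        _ ≤ _ := by
            rw [hr2]; gcongr; exact (hr3 x h t).trans hc
    refine (abs_add_le _ _).trans ?_
    linarith
  set A := 1 + 2 * m * 3 ^ m + (2 * m + 4 * m * (m + 1)) * 3 ^ m with hA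
  have hA1 : 1 ≤ A := by
    have : 0 ≤ 2 * m * 3 ^ m + (2 * m + 4 * m * (m + 1)) * 3 ^ m := by positivity
    linarith
  have hA2 : 2 * m * 3 ^ m ≤ A := by
    have : 0 ≤ (2 * m + 4 * m * (m + 1)) * 3 ^ m := by positivity
    linarith
  have hA3 : (2 * m + 4 * m * (m + 1)) * 3 ^ m ≤ A := by
    have : 0 ≤ 2 * m * 3 ^ m := by positivity
    linarith
  refine ⟨A, continuous_weight N β, fun x => ?_, fun x h hh => ?_, fun x h hh => ?_⟩
  · rw [abs_of_pos (weight_pos N β x)]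
    exact le_mul_of_one_le_left (weight_pos N β x).le hA1
  · have := (convex_Icc (-1 : ℝ) 1).norm_image_sub_le_of_norm_hasDerivWithin_le
      (f := f x h) (f' := f' x h) (x := 0) (y := 1) (fun s _ => (hf x h s).hasDerivWithinAt)
      (fun s hs => hf'b x h s hh hs) ⟨by norm_num, by norm_num⟩ ⟨by norm_num, by norm_num⟩
    simp only [hfw, one_smul, zero_smul, add_zero, sub_zero, norm_one, mul_one,
      Real.norm_eq_abs] at this
    refine this.trans ?_
    have := weight_pos N β x
    gcongr
  · have := abs_second_difference_le (hf x h) (hf' x h) (fun s hs => hf''b x h s hh hs)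
    simp only [hfw, one_smul, zero_smul, add_zero, neg_smul, ← sub_eq_add_neg] at this
    refine this.trans ?_
    have := weight_pos N β x
    gcongr
/-! ### The fractional Laplacian of controlled functions -/

lemma integrable_indicator_norm_rpow_gt {N : ℕ} {β r : ℝ} (hβ : 0 < β) (hr : 0 < r) :
    Integrable (indicator {h : E N | r < ‖h‖} fun h => 1 / ‖h‖ ^ ((N : ℝ) + β)) := by
  have hN : (0 : ℝ) ≤ N := Nat.cast_nonneg N
  have hS : MeasurableSet {h : E N | r < ‖h‖} := measurableSet_lt measurable_const measurable_norm
  have h := (integrable_one_add_norm (E := E N) (μ := volume) (r := (N : ℝ) + β)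
    (by rw [finrank_euclideanSpace_fin]; linarith)).const_mul ((1 / r + 1) ^ ((N : ℝ) + β))
  refine h.mono' ?_ (Eventually.of_forall fun x => ?_)
  · have : Measurable fun h : E N => 1 / ‖h‖ ^ ((N : ℝ) + β) := by fun_prop
    exact (this.indicator hS).aestronglyMeasurable
  · by_cases hx : r < ‖x‖
    · rw [indicator_of_mem (by exact hx)]
      have hx0 : 0 < ‖x‖ := hr.trans hx
      rw [Real.norm_of_nonneg (by positivity), Real.rpow_neg (by positivity), one_div,
        ← div_eq_mul_inv, inv_eq_one_div, div_le_div_iff₀ (by positivity) (by positivity), one_mul,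
        ← Real.mul_rpow (by positivity) hx0.le]
      apply Real.rpow_le_rpow (by positivity) _ (by positivity)
      have : 1 ≤ 1 / r * ‖x‖ := by
        rw [one_div, ← div_eq_inv_mul]; exact (one_le_div hr).2 hx.le
      linarith
    · rw [indicator_of_notMem (by exact hx), norm_zero]
      positivity

/-- In polar coordinates the exponent becomes 1 - β, which is integrable at 0 because β < 2. -/
lemma integrable_indicator_norm_rpow_le {N : ℕ} (hN : 1 ≤ N) {β : ℝ} (hβ₂ : β < 2) :
    Integrable (indicator {h : E N | ‖h‖ ≤ 1} fun h => ‖h‖ ^ (2 - ((N : ℝ) + β))) := by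
  have : Nontrivial (E N) := by
    have : Nonempty (Fin N) := ⟨⟨0, hN⟩⟩
    infer_instance
  have hS : MeasurableSet {h : E N | ‖h‖ ≤ 1} := measurableSet_le measurable_norm measurable_const
  rw [integrable_indicator_iff hS]
  have h := (integrableOn_fun_norm_addHaar (E := E N) (volume : Measure (E N)) (r := 2)
    (f := fun y => y ^ (2 - ((N : ℝ) + β)))).2 ?_
  · refine h.mono_set fun x hx => ?_
    rw [Metric.mem_ball, dist_zero_right]
    exact lt_of_le_of_lt hx (by norm_num)
  · have h1 : IntegrableOn (fun y : ℝ => y ^ (1 - β)) (Ioo 0 2) := by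
      rw [← integrableOn_Ioc_iff_integrableOn_Ioo, ← intervalIntegrable_iff_integrableOn_Ioc_of_le
        (by norm_num)]
      exact intervalIntegral.intervalIntegrable_rpow' (by linarith)
    refine h1.congr_fun (fun y hy => ?_) measurableSet_Ioo
    rw [finrank_euclideanSpace_fin, smul_eq_mul, ← Real.rpow_natCast, ← Real.rpow_add hy.1,
      Nat.cast_sub hN]
    push_cast
    ring_nf

/-- An integrable majorant for the singular integral of a controlled function at `x`. -/
def singularBound (N : ℕ) (β : ℝ) (x h : E N) : ℝ :=
  indicator {h : E N | ‖h‖ ≤ 1} (fun h => ‖h‖ ^ (2 - ((N : ℝ) + β))) h +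
    2 * indicator {h : E N | 1 < ‖h‖} (fun h => 1 / ‖h‖ ^ ((N : ℝ) + β)) h +
    8 ^ (((N : ℝ) + β) / 2) * (weight N β (x + h) + weight N β (x - h) + 2 * weight N β h)

/-- The integral of the majorant. -/
def singularMass (N : ℕ) (β : ℝ) : ℝ :=
  (∫ h, indicator {h : E N | ‖h‖ ≤ 1} (fun h => ‖h‖ ^ (2 - ((N : ℝ) + β))) h) +
    2 * (∫ h, indicator {h : E N | 1 < ‖h‖} (fun h => 1 / ‖h‖ ^ ((N : ℝ) + β)) h) +
    8 ^ (((N : ℝ) + β) / 2) * (weightMass N β + weightMass N β + 2 * weightMass N β)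

lemma integrable_singularBound {N : ℕ} (hN : 1 ≤ N) {β : ℝ} (hβ₀ : 0 < β) (hβ₂ : β < 2) (x : E N) :
    Integrable (singularBound N β x) := by
  have h1 := integrable_indicator_norm_rpow_le hN hβ₂
  have h2 := integrable_indicator_norm_rpow_gt (N := N) hβ₀ one_pos
  have h3 := integrable_weight (N := N) hβ₀
  exact (h1.add (h2.const_mul 2)).add
    (((h3.comp_add_left x).add (h3.comp_sub_left x)).add (h3.const_mul 2) |>.const_mul _)

lemma integral_singularBound {N : ℕ} (hN : 1 ≤ N) {β : ℝ} (hβ₀ : 0 < β) (hβ₂ : β < 2) (x : E N) :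
    ∫ h, singularBound N β x h = singularMass N β := by
  have h1 := integrable_indicator_norm_rpow_le hN hβ₂
  have h2 := (integrable_indicator_norm_rpow_gt (N := N) hβ₀ one_pos).const_mul 2
  have h3 := integrable_weight (N := N) hβ₀
  have h4 := h3.comp_add_left x
  have h5 := h3.comp_sub_left x
  unfold singularBound singularMass
  refine (integral_add (h1.add h2) (((h4.add h5).add (h3.const_mul 2)).const_mul _)).trans ?_
  congr 1
  · refine (integral_add h1 h2).trans ?_
    rw [integral_const_mul]
  · rw [integral_const_mul]
    congr 1
    refine (integral_add (h4.add h5) (h3.const_mul 2)).trans ?_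
    rw [integral_const_mul]
    congr 1
    refine (integral_add h4 h5).trans ?_
    rw [integral_add_left_eq_self (weight N β) x, integral_sub_left_eq_self (weight N β) volume x]
    rfl

lemma one_div_norm_rpow_le_weight {N : ℕ} {β : ℝ} (hβ : 0 < β) {h : E N} (hh : 1 < ‖h‖) :
    1 / ‖h‖ ^ ((N : ℝ) + β) ≤ 2 ^ (((N : ℝ) + β) / 2) * weight N β h := by
  have hN : (0 : ℝ) ≤ N := Nat.cast_nonneg N
  have h0 : 0 < ‖h‖ := by linarith
  unfold weight
  rw [Real.rpow_neg (by positivity), ← div_eq_mul_inv, div_le_div_iff₀ (by positivity)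
    (by positivity), one_mul]
  have e : ‖h‖ ^ ((N : ℝ) + β) = (‖h‖ ^ 2) ^ (((N : ℝ) + β) / 2) := by
    rw [← Real.rpow_natCast, ← Real.rpow_mul h0.le]
    congr 1; push_cast; ring
  rw [e, ← Real.mul_rpow (by norm_num) (by positivity)]
  apply Real.rpow_le_rpow (by positivity) _ (by positivity)
  nlinarith

/-- Near h = 0 the second difference supplies |h|². For |h| > 1 the kernel is comparable to the
weight at h, and `weight_mul_weight_le` extracts the weight at x from the products; the constant 8
is 2 · 4 from these two steps. -/
lemma IsTame.abs_secondDiff_div_le {N : ℕ} {β A : ℝ} {v : E N → ℝ} (hβ : 0 < β)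
    (hv : IsTame N β A v) (x h : E N) :
    |FracSchrodinger.secondDiff v x h / ‖h‖ ^ ((N : ℝ) + β)| ≤
      A * weight N β x * singularBound N β x h := by
  have hN : (0 : ℝ) ≤ N := Nat.cast_nonneg N
  have hA := hv.nonneg
  have hφ := weight_pos N β x
  have hφ1 := weight_pos N β (x + h)
  have hφ2 := weight_pos N β (x - h)
  have hφ3 := weight_pos N β h
  have hAφ : 0 ≤ A * weight N β x := by positivity
  have h8 : (0 : ℝ) < 8 ^ (((N : ℝ) + β) / 2) := by positivity
  have hden : 0 ≤ ‖h‖ ^ ((N : ℝ) + β) := by positivity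
  rw [abs_div, abs_of_nonneg hden]
  unfold singularBound
  by_cases hh : ‖h‖ ≤ 1
  · rw [indicator_of_mem (by exact hh), indicator_of_notMem (by simpa using hh)]
    have e0 : 0 ≤ 8 ^ (((N : ℝ) + β) / 2) *
      (weight N β (x + h) + weight N β (x - h) + 2 * weight N β h) := by positivity
    have e1 : |FracSchrodinger.secondDiff v x h| / ‖h‖ ^ ((N : ℝ) + β) ≤
        A * weight N β x * ‖h‖ ^ (2 - ((N : ℝ) + β)) := by
      rcases eq_or_ne h 0 with rfl | hne
      · rw [norm_zero, Real.zero_rpow (by positivity), div_zero]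
        have := Real.rpow_nonneg (le_refl (0 : ℝ)) (2 - ((N : ℝ) + β))
        positivity
      · have h0 : 0 < ‖h‖ := norm_pos_iff.2 hne
        rw [Real.rpow_sub h0, Real.rpow_two, ← mul_div_assoc]
        gcongr
        exact hv.secondDiff x h hh
    nlinarith [mul_nonneg hAφ e0]
  · have hh' : 1 < ‖h‖ := not_le.1 hh
    rw [indicator_of_notMem (by exact hh), indicator_of_mem (by exact hh')]
    set κ := 1 / ‖h‖ ^ ((N : ℝ) + β) with hκ
    have hκ0 : 0 ≤ κ := by positivity
    have hκφ := one_div_norm_rpow_le_weight hβ hh'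
    rw [← hκ] at hκφ
    have e1 : |FracSchrodinger.secondDiff v x h| ≤
        A * (2 * weight N β x + weight N β (x + h) + weight N β (x - h)) := by
      have b1 := hv.bound x
      have b2 := hv.bound (x + h)
      have b3 := hv.bound (x - h)
      unfold FracSchrodinger.secondDiff
      rw [abs_le] at b1 b2 b3 ⊢
      constructor <;> linarith
    have h82 : (8 : ℝ) ^ (((N : ℝ) + β) / 2) = 2 ^ (((N : ℝ) + β) / 2) * 4 ^ (((N : ℝ) + β) / 2) := by
      rw [← Real.mul_rpow (by norm_num) (by norm_num)]; norm_num
    have h2 : (0 : ℝ) < 2 ^ (((N : ℝ) + β) / 2) := by positivity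
    have e2 : weight N β (x + h) * κ ≤ 8 ^ (((N : ℝ) + β) / 2) * weight N β x *
        (weight N β (x + h) + weight N β h) := by
      calc weight N β (x + h) * κ ≤ weight N β (x + h) * (2 ^ (((N : ℝ) + β) / 2) * weight N β h) := by
            gcongr
        _ = 2 ^ (((N : ℝ) + β) / 2) * (weight N β (x + h) * weight N β h) := by ring
        _ ≤ 2 ^ (((N : ℝ) + β) / 2) * (4 ^ (((N : ℝ) + β) / 2) * weight N β x *
            (weight N β (x + h) + weight N β h)) := by
            exact mul_le_mul_of_nonneg_left (weight_mul_weight_le hβ x h) h2.le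
        _ = _ := by rw [h82]; ring
    have e3 : weight N β (x - h) * κ ≤ 8 ^ (((N : ℝ) + β) / 2) * weight N β x *
        (weight N β (x - h) + weight N β h) := by
      have hw := weight_mul_weight_le hβ x (-h)
      rw [weight_neg, ← sub_eq_add_neg] at hw
      calc weight N β (x - h) * κ ≤ weight N β (x - h) * (2 ^ (((N : ℝ) + β) / 2) * weight N β h) := by
            gcongr
        _ = 2 ^ (((N : ℝ) + β) / 2) * (weight N β (x - h) * weight N β h) := by ring
        _ ≤ 2 ^ (((N : ℝ) + β) / 2) * (4 ^ (((N : ℝ) + β) / 2) * weight N β x *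
            (weight N β (x - h) + weight N β h)) := mul_le_mul_of_nonneg_left hw h2.le
        _ = _ := by rw [h82]; ring
    calc |FracSchrodinger.secondDiff v x h| / ‖h‖ ^ ((N : ℝ) + β)
        = |FracSchrodinger.secondDiff v x h| * κ := by rw [hκ, mul_one_div]
      _ ≤ A * (2 * weight N β x + weight N β (x + h) + weight N β (x - h)) * κ := by gcongr
      _ = A * (2 * weight N β x * κ + weight N β (x + h) * κ + weight N β (x - h) * κ) := by ring
      _ ≤ A * (2 * weight N β x * κ + 8 ^ (((N : ℝ) + β) / 2) * weight N β x *
        (weight N β (x + h) + weight N β h) + 8 ^ (((N : ℝ) + β) / 2) * weight N β x *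
        (weight N β (x - h) + weight N β h)) := by gcongr
      _ = _ := by ring

lemma measurable_secondDiff_div {N : ℕ} {β : ℝ} {v : E N → ℝ} (hv : Continuous v) :
    Measurable fun z : E N × E N => FracSchrodinger.secondDiff v z.1 z.2 / ‖z.2‖ ^ ((N : ℝ) + β) := by
  have h1 : Continuous fun z : E N × E N => FracSchrodinger.secondDiff v z.1 z.2 := by
    unfold FracSchrodinger.secondDiff
    fun_prop
  exact h1.measurable.div (by fun_prop)

lemma IsTame.integrable_secondDiff_div {N : ℕ} (hN : 1 ≤ N) {β A : ℝ} {v : E N → ℝ} (hβ₀ : 0 < β)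
    (hβ₂ : β < 2) (hv : IsTame N β A v) (x : E N) :
    Integrable fun h => FracSchrodinger.secondDiff v x h / ‖h‖ ^ ((N : ℝ) + β) := by
  refine ((integrable_singularBound hN hβ₀ hβ₂ x).const_mul (A * weight N β x)).mono' ?_
    (Eventually.of_forall fun h => hv.abs_secondDiff_div_le hβ₀ x h)
  exact ((measurable_secondDiff_div (β := β) hv.continuous).comp
    (measurable_const.prodMk measurable_id)).aestronglyMeasurable

/-- The principal value is half the absolutely convergent integral of second differences. -/
theorem IsTame.fracLaplacian_eq {N : ℕ} (hN : 1 ≤ N) {β A : ℝ} {v : E N → ℝ} (hβ₀ : 0 < β)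
    (hβ₂ : β < 2) (hv : IsTame N β A v) (x : E N) :
    fracLaplacian (β / 2) v x = fracLaplacianConst N (β / 2) *
      (2⁻¹ * ∫ h, FracSchrodinger.secondDiff v x h / ‖h‖ ^ ((N : ℝ) + β)) := by
  have hA := hv.nonneg
  unfold fracLaplacian
  rw [mul_div_cancel₀ β two_ne_zero]
  congr 1
  apply Tendsto.limUnder_eq
  have hSr : ∀ r : ℝ, MeasurableSet {h : E N | r < ‖h‖} := fun r =>
    measurableSet_lt measurable_const measurable_norm
  -- The region r < |x - y| is symmetric about x, so averaging the substitutions y = x + h and y = x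
  -- - h produces half a second difference. Away from the singularity each substituted integral
  -- converges separately.
  have hkey : ∀ r : ℝ, 0 < r →
      ∫ y in {y : E N | r < ‖x - y‖}, (v x - v y) / ‖x - y‖ ^ ((N : ℝ) + β) =
      2⁻¹ * ∫ h, indicator {h : E N | r < ‖h‖}
        (fun h => FracSchrodinger.secondDiff v x h / ‖h‖ ^ ((N : ℝ) + β)) h := by
    intro r hr
    have hS : MeasurableSet {y : E N | r < ‖x - y‖} :=
      measurableSet_lt measurable_const (by fun_prop)
    rw [← integral_indicator hS]
    set F : E N → ℝ := indicator {y : E N | r < ‖x - y‖}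
      fun y => (v x - v y) / ‖x - y‖ ^ ((N : ℝ) + β) with hF
    have e1 : (fun h => F (x + h)) = indicator {h : E N | r < ‖h‖}
        fun h => (v x - v (x + h)) / ‖h‖ ^ ((N : ℝ) + β) := by
      ext h
      simp only [hF, indicator, mem_ofPred_eq, sub_add_cancel_left, norm_neg]
    have e2 : (fun h => F (x - h)) = indicator {h : E N | r < ‖h‖}
        fun h => (v x - v (x - h)) / ‖h‖ ^ ((N : ℝ) + β) := by
      ext h
      simp only [hF, indicator, mem_ofPred_eq, sub_sub_cancel]
    have hFi : Integrable F := by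
      have h1 : Integrable (fun h => F (x + h)) := by
        rw [e1]
        refine ((integrable_indicator_norm_rpow_gt (N := N) hβ₀ hr).const_mul (2 * A)).mono' ?_
          (Eventually.of_forall fun h => ?_)
        · have : Measurable fun h : E N => (v x - v (x + h)) / ‖h‖ ^ ((N : ℝ) + β) := by
            have := hv.continuous
            exact (Continuous.measurable (by fun_prop)).div (by fun_prop)
          exact (this.indicator (hSr r)).aestronglyMeasurable
        · by_cases hh : r < ‖h‖
          · rw [indicator_of_mem (by exact hh), indicator_of_mem (by exact hh), Real.norm_eq_abs,
              abs_div, abs_of_nonneg (by positivity : 0 ≤ ‖h‖ ^ ((N : ℝ) + β)), mul_one_div]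
            gcongr
            have b1 := hv.bound x
            have b2 := hv.bound (x + h)
            have b3 := mul_le_mul_of_nonneg_left (weight_le_one (N := N) hβ₀ x) hA
            have b4 := mul_le_mul_of_nonneg_left (weight_le_one (N := N) hβ₀ (x + h)) hA
            rw [abs_le] at b1 b2 ⊢
            constructor <;> linarith
          · rw [indicator_of_notMem (by exact hh), indicator_of_notMem (by exact hh), norm_zero,
              mul_zero]
      have := h1.comp_sub_right x
      simpa using this
    have i1 : ∫ h, F (x + h) = ∫ y, F y := integral_add_left_eq_self F x
    have i2 : ∫ h, F (x - h) = ∫ y, F y := integral_sub_left_eq_self F volume x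
    have i3 : ∫ h, indicator {h : E N | r < ‖h‖}
        (fun h => FracSchrodinger.secondDiff v x h / ‖h‖ ^ ((N : ℝ) + β)) h =
        ∫ h, (F (x + h) + F (x - h)) := by
      congr 1
      ext h
      rw [congrFun e1 h, congrFun e2 h]
      by_cases hh : r < ‖h‖
      · simp only [indicator, mem_ofPred_eq, hh, if_true, FracSchrodinger.secondDiff]
        rw [← add_div]
        congr 1; ring
      · simp [indicator, hh]
    rw [i3, integral_add (hFi.comp_add_left x) (hFi.comp_sub_left x), i1, i2]
    ring
  have hlim : Tendsto (fun r : ℝ => 2⁻¹ * ∫ h, indicator {h : E N | r < ‖h‖}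
        (fun h => FracSchrodinger.secondDiff v x h / ‖h‖ ^ ((N : ℝ) + β)) h) (𝓝[>] 0)
      (𝓝 (2⁻¹ * ∫ h, FracSchrodinger.secondDiff v x h / ‖h‖ ^ ((N : ℝ) + β))) := by
    apply Tendsto.const_mul
    have hi := hv.integrable_secondDiff_div hN hβ₀ hβ₂ x
    apply tendsto_integral_filter_of_dominated_convergence
      (fun h => |FracSchrodinger.secondDiff v x h / ‖h‖ ^ ((N : ℝ) + β)|)
    · exact Eventually.of_forall fun r => (hi.indicator (hSr r)).aestronglyMeasurable
    · refine Eventually.of_forall fun r => Eventually.of_forall fun h => ?_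
      exact norm_indicator_le_norm_self _ _
    · exact hi.norm
    · refine Eventually.of_forall fun h => ?_
      rcases eq_or_ne h 0 with rfl | hne
      · have : ∀ r : ℝ, indicator {h : E N | r < ‖h‖}
            (fun h => FracSchrodinger.secondDiff v x h / ‖h‖ ^ ((N : ℝ) + β)) 0 = 0 := by
          intro r
          simp [indicator, FracSchrodinger.secondDiff, two_mul]
        simp only [this]
        simp [FracSchrodinger.secondDiff, two_mul]
      · have h0 : 0 < ‖h‖ := norm_pos_iff.2 hne
        apply tendsto_const_nhds.congr'
        filter_upwards [nhdsWithin_le_nhds (Iio_mem_nhds h0)] with r hr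
        rw [indicator_of_mem (by exact hr)]
  refine hlim.congr' ?_
  filter_upwards [self_mem_nhdsWithin] with r hr
  exact (hkey r hr).symm

/-- The integral of the majorant is independent of x by translation invariance, so x enters only
through the weight. -/
theorem IsTame.abs_fracLaplacian_le {N : ℕ} (hN : 1 ≤ N) {β A : ℝ} {v : E N → ℝ} (hβ₀ : 0 < β)
    (hβ₂ : β < 2) (hv : IsTame N β A v) (x : E N) :
    |fracLaplacian (β / 2) v x| ≤
      |fracLaplacianConst N (β / 2)| * singularMass N β * A * weight N β x := by
  rw [hv.fracLaplacian_eq hN hβ₀ hβ₂, abs_mul, abs_mul, abs_of_pos (by norm_num : (0 : ℝ) < 2⁻¹)]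
  have h1 : |∫ h, FracSchrodinger.secondDiff v x h / ‖h‖ ^ ((N : ℝ) + β)| ≤
      A * weight N β x * singularMass N β := by
    rw [← integral_singularBound hN hβ₀ hβ₂ x, ← integral_const_mul, ← Real.norm_eq_abs]
    exact norm_integral_le_of_norm_le
      ((integrable_singularBound hN hβ₀ hβ₂ x).const_mul _)
      (Eventually.of_forall fun h => hv.abs_secondDiff_div_le hβ₀ x h)
  have h2 : 0 ≤ A * weight N β x * singularMass N β := (abs_nonneg _).trans h1
  calc |fracLaplacianConst N (β / 2)| *
        (2⁻¹ * |∫ h, FracSchrodinger.secondDiff v x h / ‖h‖ ^ ((N : ℝ) + β)|)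
      ≤ |fracLaplacianConst N (β / 2)| * (A * weight N β x * singularMass N β) := by
        apply mul_le_mul_of_nonneg_left _ (abs_nonneg _)
        have := abs_nonneg (∫ h, FracSchrodinger.secondDiff v x h / ‖h‖ ^ ((N : ℝ) + β))
        linarith
    _ = _ := by ring

theorem exists_isWeightConst {N : ℕ} (hN : 1 ≤ N) {β : ℝ} (hβ₀ : 0 < β) (hβ₂ : β < 2) :
    ∃ K, IsWeightConst N β K := by
  obtain ⟨A, hA⟩ := exists_isTame_weight N hβ₀
  -- The maximum with 1 only secures positivity of the constant.
  refine ⟨max 1 (|fracLaplacianConst N (β / 2)| * singularMass N β * A),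
    lt_of_lt_of_le one_pos (le_max_left _ _), fun x => ?_⟩
  exact (hA.abs_fracLaplacian_le hN hβ₀ hβ₂ x).trans
    (mul_le_mul_of_nonneg_right (le_max_right _ _) (weight_pos N β x).le)

/-- The tameness constant common to all members of the sequence gives a single dominating function
for the second-difference integrals. -/
theorem IsTame.tendsto_fracLaplacian {N : ℕ} (hN : 1 ≤ N) {β A : ℝ} {v : E N → ℝ}
    {vn : ℕ → E N → ℝ} (hβ₀ : 0 < β) (hβ₂ : β < 2) (hv : IsTame N β A v)
    (hvn : ∀ n, IsTame N β A (vn n)) (hlim : ∀ x, Tendsto (fun n => vn n x) atTop (𝓝 (v x)))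
    (x : E N) : Tendsto (fun n => fracLaplacian (β / 2) (vn n) x) atTop
      (𝓝 (fracLaplacian (β / 2) v x)) := by
  simp only [hv.fracLaplacian_eq hN hβ₀ hβ₂, (hvn _).fracLaplacian_eq hN hβ₀ hβ₂]
  apply Tendsto.const_mul
  apply Tendsto.const_mul
  apply tendsto_integral_of_dominated_convergence
    (fun h => A * weight N β x * singularBound N β x h)
  · exact fun n => ((hvn n).integrable_secondDiff_div hN hβ₀ hβ₂ x).aestronglyMeasurable
  · exact (integrable_singularBound hN hβ₀ hβ₂ x).const_mul _
  · exact fun n => Eventually.of_forall fun h => (hvn n).abs_secondDiff_div_le hβ₀ x h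
  · refine Eventually.of_forall fun h => ?_
    apply Tendsto.div_const
    exact (((hlim x).const_mul 2).sub (hlim _)).sub (hlim _)

lemma IsTame.measurable_fracLaplacian {N : ℕ} (hN : 1 ≤ N) {β A : ℝ} {v : E N → ℝ} (hβ₀ : 0 < β)
    (hβ₂ : β < 2) (hv : IsTame N β A v) : Measurable (fracLaplacian (β / 2) v) := by
  have h1 := (measurable_secondDiff_div (β := β) hv.continuous).stronglyMeasurable
  have h2 := (h1.integral_prod_right' (ν := (volume : Measure (E N)))).measurable
  have h3 : fracLaplacian (β / 2) v = fun x => fracLaplacianConst N (β / 2) *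
      (2⁻¹ * ∫ h, FracSchrodinger.secondDiff v x h / ‖h‖ ^ ((N : ℝ) + β)) :=
    funext fun x => hv.fracLaplacian_eq hN hβ₀ hβ₂ x
  rw [h3]
  exact (h2.const_mul _).const_mul _

/-- Substituting h ↦ h/R in the second-difference integral produces R^{-(N+β)} from the kernel and
R^N from the volume. -/
theorem IsTame.fracLaplacian_comp_inv_smul {N : ℕ} (hN : 1 ≤ N) {β A R : ℝ} {v : E N → ℝ}
    (hβ₀ : 0 < β) (hβ₂ : β < 2) (hv : IsTame N β A v) (hR : 1 ≤ R) (x : E N) :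
    fracLaplacian (β / 2) (fun x => v (R⁻¹ • x)) x =
      R ^ (-β) * fracLaplacian (β / 2) v (R⁻¹ • x) := by
  have hR0 : 0 < R := by linarith
  rw [(hv.comp_inv_smul hβ₀ hR).fracLaplacian_eq hN hβ₀ hβ₂, hv.fracLaplacian_eq hN hβ₀ hβ₂]
  have e : (fun h : E N => FracSchrodinger.secondDiff (fun x => v (R⁻¹ • x)) x h /
      ‖h‖ ^ ((N : ℝ) + β)) = fun h => R ^ (-((N : ℝ) + β)) *
      (fun h : E N => FracSchrodinger.secondDiff v (R⁻¹ • x) h / ‖h‖ ^ ((N : ℝ) + β)) (R⁻¹ • h) := by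
    ext h
    simp only [FracSchrodinger.secondDiff, smul_add, smul_sub]
    rw [norm_smul, norm_inv, Real.norm_of_nonneg hR0.le, Real.mul_rpow (by positivity) (norm_nonneg _),
      Real.inv_rpow hR0.le, Real.rpow_neg hR0.le]
    have : 0 < R ^ ((N : ℝ) + β) := by positivity
    rcases eq_or_ne (‖h‖ ^ ((N : ℝ) + β)) 0 with h0 | h0
    · simp [h0]
    · field_simp
  have e1 := Measure.integral_comp_inv_smul_of_nonneg (volume : Measure (E N))
    (fun h : E N => FracSchrodinger.secondDiff v (R⁻¹ • x) h / ‖h‖ ^ ((N : ℝ) + β)) hR0.le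
  rw [e, integral_const_mul, e1, finrank_euclideanSpace_fin, smul_eq_mul]
  have e2 : R ^ (-((N : ℝ) + β)) * R ^ N = R ^ (-β) := by
    rw [← Real.rpow_natCast, ← Real.rpow_add hR0]
    congr 1; ring
  rw [← e2]
  ring

/-! ### Cutoffs -/

/-- A smooth cutoff function: one on the unit ball and zero outside the ball of radius two. -/
def cutoffBump (N : ℕ) : ContDiffBump (0 : E N) := ⟨1, 2, one_pos, one_lt_two⟩

/-- The cutoff rescaled to the ball of radius `n + 1`. -/
def cutoff (N n : ℕ) (x : E N) : ℝ := cutoffBump N (((n : ℝ) + 1)⁻¹ • x)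

lemma contDiff_cutoff (N n : ℕ) : ContDiff ℝ ∞ (cutoff N n) :=
  (cutoffBump N).contDiff.comp (contDiff_const_smul _)

lemma hasCompactSupport_cutoff (N n : ℕ) : HasCompactSupport (cutoff N n) :=
  (cutoffBump N).hasCompactSupport.comp_homeomorph
    (Homeomorph.smulOfNeZero (((n : ℝ) + 1)⁻¹) (by positivity))

lemma abs_cutoff_le_one (N n : ℕ) (x : E N) : |cutoff N n x| ≤ 1 := by
  unfold cutoff
  rw [abs_of_nonneg (cutoffBump N).nonneg]
  exact (cutoffBump N).le_one

lemma tendsto_cutoff (N : ℕ) (x : E N) : Tendsto (fun n => cutoff N n x) atTop (𝓝 1) := by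
  apply tendsto_const_nhds.congr'
  obtain ⟨n₀, hn₀⟩ := exists_nat_ge ‖x‖
  filter_upwards [eventually_ge_atTop n₀] with n hn
  symm
  apply (cutoffBump N).one_of_mem_closedBall
  have hn' : (n₀ : ℝ) ≤ n := by exact_mod_cast hn
  rw [mem_closedBall_zero_iff, norm_smul, norm_inv, Real.norm_of_nonneg (by positivity),
    inv_mul_le_iff₀ (by positivity)]
  change ‖x‖ ≤ (n + 1) * 1
  linarith

/-- One L serves all n because rescaling by 1/(n+1) ≤ 1 only shrinks increments. The unscaled bump
and its derivative are Lipschitz, being smooth with compact support. -/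
lemma exists_cutoff_bound (N : ℕ) : ∃ L : ℝ, 0 ≤ L ∧
    (∀ n (x h : E N), |cutoff N n (x + h) - cutoff N n x| ≤ L * ‖h‖) ∧
    ∀ n (x h : E N), |secondDiff (cutoff N n) x h| ≤ L * ‖h‖ ^ 2 := by
  set χ : E N → ℝ := fun x => cutoffBump N x with hχ
  have hc : ContDiff ℝ ∞ χ := (cutoffBump N).contDiff
  have hs : HasCompactSupport χ := (cutoffBump N).hasCompactSupport
  obtain ⟨L₁, hL₁⟩ := hc.lipschitzWith_of_hasCompactSupport hs (by simp)
  have hc' : ContDiff ℝ ∞ (fderiv ℝ χ) := hc.fderiv_right (by simp)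
  obtain ⟨L₂, hL₂⟩ := hc'.lipschitzWith_of_hasCompactSupport (hs.fderiv ℝ) (by simp)
  have hd : ∀ x h : E N, |χ (x + h) - χ x| ≤ L₁ * ‖h‖ := by
    intro x h
    have := hL₁.dist_le_mul (x + h) x
    simpa [Real.dist_eq, dist_eq_norm] using this
  have hsd : ∀ x h : E N, |secondDiff χ x h| ≤ 2 * L₂ * ‖h‖ ^ 2 := by
    intro x h
    have hdiff : ∀ y, HasFDerivAt χ (fderiv ℝ χ y) y := fun y =>
      (hc.differentiable (by simp) y).hasFDerivAt
    have hlin : ∀ (h : E N) (t : ℝ), HasDerivAt (fun t : ℝ => x + t • h) h t := by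
      intro h t
      simpa using ((hasDerivAt_id t).smul_const h).const_add x
    have h1 : ∀ t ∈ Icc (0 : ℝ) 1, HasDerivWithinAt (fun t : ℝ => χ (x + t • h) + χ (x + t • (-h)))
        (fderiv ℝ χ (x + t • h) h + fderiv ℝ χ (x + t • (-h)) (-h)) (Icc 0 1) t := fun t _ =>
      (((hdiff _).comp_hasDerivAt t (hlin h t)).add
        ((hdiff _).comp_hasDerivAt t (hlin (-h) t))).hasDerivWithinAt
    have h2 : ∀ t ∈ Icc (0 : ℝ) 1,
        ‖fderiv ℝ χ (x + t • h) h + fderiv ℝ χ (x + t • (-h)) (-h)‖ ≤ 2 * L₂ * ‖h‖ ^ 2 := by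
      intro t ht
      have e : fderiv ℝ χ (x + t • h) h + fderiv ℝ χ (x + t • (-h)) (-h) =
          (fderiv ℝ χ (x + t • h) - fderiv ℝ χ (x + t • (-h))) h := by
        rw [map_neg, sub_apply]; ring
      rw [e]
      refine (ContinuousLinearMap.le_opNorm _ _).trans ?_
      have h3 := hL₂.dist_le_mul (x + t • h) (x + t • (-h))
      rw [dist_eq_norm, dist_eq_norm] at h3
      have h4 : ‖x + t • h - (x + t • -h)‖ ≤ 2 * ‖h‖ := by
        have : x + t • h - (x + t • -h) = (2 * t) • h := by
          rw [smul_neg, mul_smul, two_smul]; abel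
        rw [this, norm_smul, Real.norm_of_nonneg (by linarith [ht.1])]
        have := norm_nonneg h
        nlinarith [ht.2]
      calc _ ≤ (L₂ * (2 * ‖h‖)) * ‖h‖ := by
            apply mul_le_mul_of_nonneg_right _ (norm_nonneg h)
            exact h3.trans (mul_le_mul_of_nonneg_left h4 L₂.coe_nonneg)
        _ = _ := by ring
    have := (convex_Icc (0 : ℝ) 1).norm_image_sub_le_of_norm_hasDerivWithin_le h1 h2
      (left_mem_Icc.2 zero_le_one) (right_mem_Icc.2 zero_le_one)
    simp only [one_smul, zero_smul, add_zero, sub_zero, norm_one, mul_one, Real.norm_eq_abs] at this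
    rw [abs_sub_comm] at this
    refine le_trans (le_of_eq ?_) this
    unfold secondDiff
    rw [← sub_eq_add_neg]
    congr 1; ring
  have hn : ∀ (n : ℕ) (h : E N), ‖((n : ℝ) + 1)⁻¹ • h‖ ≤ ‖h‖ := by
    intro n h
    rw [norm_smul, norm_inv, Real.norm_of_nonneg (by positivity)]
    exact mul_le_of_le_one_left (norm_nonneg _) (inv_le_one_of_one_le₀ (by
      have : (0 : ℝ) ≤ n := Nat.cast_nonneg n
      linarith))
  refine ⟨L₁ + 2 * L₂, by positivity, fun n x h => ?_, fun n x h => ?_⟩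
  · unfold cutoff
    rw [smul_add]
    refine (hd _ _).trans ?_
    have := hn n h
    have h0 : (0 : ℝ) ≤ L₂ := L₂.coe_nonneg
    gcongr
    linarith
  · have e : secondDiff (cutoff N n) x h = secondDiff χ (((n : ℝ) + 1)⁻¹ • x) (((n : ℝ) + 1)⁻¹ • h) := by
      simp only [secondDiff, cutoff, smul_add, smul_sub, hχ]
    rw [e]
    refine (hsd _ _).trans ?_
    have := hn n h
    have h0 : (0 : ℝ) ≤ L₁ := L₁.coe_nonneg
    gcongr
    linarith
/-! ### From the weak to the integral form of a fractional differential inequality -/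

/-- Cutting the integral at b < T keeps all later arguments on a compact part of [0,T), where the
solution is controlled. -/
lemma rightCaputo_eq {δ T b t : ℝ} {ψ : ℝ → ℝ} (hb : ∀ r, b ≤ r → deriv ψ r = 0) (htb : t ≤ b)
    (hbT : b ≤ T) : rightCaputo δ T ψ t =
      -(1 / Real.Gamma (1 - δ) * ∫ s in t..b, (s - t) ^ (-(1 - (1 - δ))) * deriv ψ s) := by
  unfold rightCaputo rightFracIntegral
  rw [intervalIntegral.integral_of_le (htb.trans hbT), intervalIntegral.integral_of_le htb]
  congr 2
  apply setIntegral_eq_of_subset_of_forall_sdiff_eq_zero measurableSet_Ioc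
    (Ioc_subset_Ioc le_rfl hbT)
  intro s hs
  have : b ≤ s := by
    by_contra hc
    exact hs.2 ⟨hs.1.1, (not_le.1 hc).le⟩
  rw [hb s this, mul_zero]

lemma rightCaputo_eq_zero {δ T b t : ℝ} {ψ : ℝ → ℝ} (hb : ∀ r, b ≤ r → deriv ψ r = 0)
    (htb : b ≤ t) (htT : t ≤ T) : rightCaputo δ T ψ t = 0 := by
  rw [rightCaputo_eq (b := t) (fun r hr => hb r (htb.trans hr)) le_rfl htT]
  simp

/-- Fractional integration by parts: both sides are the same double integral over the triangle s <
r, taken in the two orders. -/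
lemma integral_mul_rightCaputo {δ T b : ℝ} {V ψ : ℝ → ℝ} (hδ₁ : δ < 1) (hb0 : 0 ≤ b)
    (hbT : b < T) (hV : ContinuousOn V (Ico 0 T)) (hψ : Continuous (deriv ψ))
    (hb : ∀ r, b ≤ r → deriv ψ r = 0) :
    ∫ t in (0 : ℝ)..T, V t * rightCaputo δ T ψ t =
      -∫ r in (0 : ℝ)..b, deriv ψ r * leftFracIntegral (1 - δ) V r := by
  have hδ : 0 < 1 - δ := by linarith
  have h1 : ∫ t in (0 : ℝ)..T, V t * rightCaputo δ T ψ t =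
      ∫ t in (0 : ℝ)..b, V t * rightCaputo δ T ψ t := by
    rw [intervalIntegral.integral_of_le (hb0.trans hbT.le), intervalIntegral.integral_of_le hb0]
    apply setIntegral_eq_of_subset_of_forall_sdiff_eq_zero measurableSet_Ioc
      (Ioc_subset_Ioc le_rfl hbT.le)
    intro s hs
    have : b ≤ s := by
      by_contra hc
      exact hs.2 ⟨hs.1.1, (not_le.1 hc).le⟩
    rw [rightCaputo_eq_zero hb this hs.1.2, mul_zero]
  have hIcc : Icc 0 b ⊆ Ico 0 T := fun x hx => ⟨hx.1, lt_of_le_of_lt hx.2 hbT⟩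
  obtain ⟨K₁, hK₁⟩ := isCompact_Icc.exists_bound_of_continuousOn (hV.mono hIcc)
  obtain ⟨K₂, hK₂⟩ := (isCompact_Icc (a := (0 : ℝ)) (b := b)).exists_bound_of_continuousOn
    hψ.continuousOn
  have hker : ∀ s r t : ℝ, IntervalIntegrable (fun x => (x - s) ^ (-(1 - (1 - δ)))) volume r t := by
    intro s r t
    have := (intervalIntegral.intervalIntegrable_rpow' (a := r - s) (b := t - s)
      (r := -(1 - (1 - δ))) (by linarith)).comp_sub_right s
    simpa using this
  have hswap := integral_triangle_swap hb0
    (f := fun r s => (r - s) ^ (-(1 - (1 - δ))) * deriv ψ r * V s)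
    (G := fun s => ((b - s) ^ (1 - δ) / (1 - δ)) * (K₂ * K₁)) ?_ ?_ ?_ ?_
  · rw [h1]
    have e1 : ∫ t in (0 : ℝ)..b, V t * rightCaputo δ T ψ t = -(1 / Real.Gamma (1 - δ)) *
        ∫ s in (0 : ℝ)..b, ∫ r in s..b, (r - s) ^ (-(1 - (1 - δ))) * deriv ψ r * V s := by
      rw [← intervalIntegral.integral_const_mul]
      apply intervalIntegral.integral_congr
      intro s hs
      rw [uIcc_of_le hb0] at hs
      simp only
      rw [rightCaputo_eq hb hs.2 hbT.le, intervalIntegral.integral_mul_const]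
      ring
    have e2 : ∫ r in (0 : ℝ)..b, deriv ψ r * leftFracIntegral (1 - δ) V r = 1 / Real.Gamma (1 - δ) *
        ∫ r in (0 : ℝ)..b, ∫ s in (0 : ℝ)..r, (r - s) ^ (-(1 - (1 - δ))) * deriv ψ r * V s := by
      rw [← intervalIntegral.integral_const_mul]
      apply intervalIntegral.integral_congr
      intro r hr
      simp only [leftFracIntegral]
      rw [← intervalIntegral.integral_const_mul, ← intervalIntegral.integral_const_mul,
        ← intervalIntegral.integral_const_mul]
      congr 1; ext s; ring
    rw [e1, e2, hswap]
    ring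
  · have m1 : Measurable fun z : ℝ × ℝ => (z.1 - z.2) ^ (-(1 - (1 - δ))) * deriv ψ z.1 :=
      (by fun_prop : Measurable fun z : ℝ × ℝ => (z.1 - z.2) ^ (-(1 - (1 - δ)))).mul
        (hψ.measurable.comp measurable_fst)
    exact m1.aestronglyMeasurable.mul (((hV.mono hIcc).mono
      Ioc_subset_Icc_self).aestronglyMeasurable measurableSet_Ioc).comp_snd
  · refine Eventually.of_forall fun s => ?_
    exact ((hker s s b).mul_continuousOn hψ.continuousOn).mul_const _
  · have : IntervalIntegrable (fun s => ((b - s) ^ (1 - δ) / (1 - δ)) * (K₂ * K₁)) volume 0 b := by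
      apply IntervalIntegrable.mul_const
      apply IntervalIntegrable.div_const
      apply ContinuousOn.intervalIntegrable
      exact ContinuousOn.rpow_const (by fun_prop) fun _ _ => Or.inr hδ.le
    exact (intervalIntegrable_iff_integrableOn_Ioc_of_le hb0).1 this
  · filter_upwards [ae_restrict_mem measurableSet_Ioc] with s hs
    have e : ∫ r in s..b, (r - s) ^ (-(1 - (1 - δ))) = (b - s) ^ (1 - δ) / (1 - δ) := by
      rw [intervalIntegral.integral_comp_sub_right (fun x => x ^ (-(1 - (1 - δ)))) s, sub_self,
        integral_rpow (Or.inl (by linarith))]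
      have h : -(1 - (1 - δ)) + 1 = 1 - δ := by ring
      rw [h, Real.zero_rpow hδ.ne', sub_zero]
    rw [← e, ← intervalIntegral.integral_mul_const]
    apply intervalIntegral.integral_mono_on hs.2
    · exact (((hker s s b).mul_continuousOn hψ.continuousOn).mul_const _).norm
    · exact (hker s s b).mul_const _
    · intro r hr
      have hr0 : 0 ≤ r := hs.1.le.trans hr.1
      have h0 : 0 ≤ (r - s) ^ (-(1 - (1 - δ))) := Real.rpow_nonneg (by linarith [hr.1]) _
      rw [abs_mul, abs_mul, abs_of_nonneg h0, mul_assoc]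
      apply mul_le_mul_of_nonneg_left _ h0
      exact mul_le_mul (hK₂ r ⟨hr0, hr.2⟩) (hK₁ s ⟨hs.1.le, hs.2⟩) (abs_nonneg _)
        ((norm_nonneg _).trans (hK₂ r ⟨hr0, hr.2⟩))

/-! ### Monotonicity from a weak derivative -/

/-- A smooth step of width `2 d` centred at `a`. -/
def smoothStep (a d t : ℝ) : ℝ := Real.smoothTransition ((t - a + d) / (2 * d))

lemma contDiff_smoothStep (a d : ℝ) : ContDiff ℝ ∞ (smoothStep a d) := by
  unfold smoothStep
  exact Real.smoothTransition.contDiff.comp (by fun_prop)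

lemma smoothStep_of_le {a d t : ℝ} (hd : 0 < d) (h : t ≤ a - d) : smoothStep a d t = 0 := by
  apply Real.smoothTransition.zero_of_nonpos
  apply div_nonpos_of_nonpos_of_nonneg <;> linarith

lemma smoothStep_of_ge {a d t : ℝ} (hd : 0 < d) (h : a + d ≤ t) : smoothStep a d t = 1 := by
  apply Real.smoothTransition.one_of_one_le
  rw [one_le_div (by linarith)]
  linarith

lemma monotone_smoothStep {a d : ℝ} (hd : 0 < d) : Monotone (smoothStep a d) := by
  intro s t hst
  apply Real.smoothTransition.monotone
  gcongr

lemma smoothStep_anti_left {a b d t : ℝ} (hd : 0 < d) (hab : a ≤ b) :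
    smoothStep b d t ≤ smoothStep a d t := by
  apply Real.smoothTransition.monotone
  gcongr

lemma deriv_smoothStep_nonneg {a d : ℝ} (hd : 0 < d) (t : ℝ) : 0 ≤ deriv (smoothStep a d) t :=
  (monotone_smoothStep hd).deriv_nonneg

lemma deriv_smoothStep_eq_zero {a d t : ℝ} (hd : 0 < d) (ht : t ∉ Icc (a - d) (a + d)) :
    deriv (smoothStep a d) t = 0 := by
  rw [mem_Icc, not_and_or, not_le, not_le] at ht
  rcases ht with h | h
  · have : smoothStep a d =ᶠ[𝓝 t] fun _ => 0 := by
      filter_upwards [Iio_mem_nhds h] with s hs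
      exact smoothStep_of_le hd (le_of_lt hs)
    rw [this.deriv_eq, deriv_const]
  · have : smoothStep a d =ᶠ[𝓝 t] fun _ => 1 := by
      filter_upwards [Ioi_mem_nhds h] with s hs
      exact smoothStep_of_ge hd (le_of_lt hs)
    rw [this.deriv_eq, deriv_const]

lemma continuous_deriv_smoothStep (a d : ℝ) : Continuous (deriv (smoothStep a d)) :=
  (contDiff_smoothStep a d).continuous_deriv (by simp)

/-- The derivative of the step is a nonnegative kernel of total mass 1 supported near a, so
integration against it is an average of H. -/
lemma integral_deriv_smoothStep_mul_le {a b d c : ℝ} {H : ℝ → ℝ} (hd : 0 < d) (h0 : 0 ≤ a - d)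
    (hb : a + d ≤ b) (hH : ContinuousOn H (Icc 0 b)) (hc : ∀ t ∈ Icc (a - d) (a + d), H t ≤ c) :
    ∫ t in (0 : ℝ)..b, deriv (smoothStep a d) t * H t ≤ c := by
  have hb0 : 0 ≤ b := by linarith
  have hcd := continuous_deriv_smoothStep a d
  have h1 : ∫ t in (0 : ℝ)..b, deriv (smoothStep a d) t * c = c := by
    rw [intervalIntegral.integral_mul_const, intervalIntegral.integral_deriv_eq_sub
      (fun x _ => (contDiff_smoothStep a d).differentiable (by simp) x)
      (hcd.intervalIntegrable _ _), smoothStep_of_ge hd hb, smoothStep_of_le hd h0]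
    ring
  calc _ ≤ ∫ t in (0 : ℝ)..b, deriv (smoothStep a d) t * c := by
        apply intervalIntegral.integral_mono_on hb0
        · apply ContinuousOn.intervalIntegrable
          rw [uIcc_of_le hb0]
          exact hcd.continuousOn.mul hH
        · exact (hcd.mul continuous_const).intervalIntegrable _ _
        · intro t _
          by_cases ht : t ∈ Icc (a - d) (a + d)
          · exact mul_le_mul_of_nonneg_left (hc t ht) (deriv_smoothStep_nonneg hd t)
          · rw [deriv_smoothStep_eq_zero hd ht, zero_mul, zero_mul]
    _ = c := h1

lemma le_integral_deriv_smoothStep_mul {a b d c : ℝ} {H : ℝ → ℝ} (hd : 0 < d) (h0 : 0 ≤ a - d)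
    (hb : a + d ≤ b) (hH : ContinuousOn H (Icc 0 b)) (hc : ∀ t ∈ Icc (a - d) (a + d), c ≤ H t) :
    c ≤ ∫ t in (0 : ℝ)..b, deriv (smoothStep a d) t * H t := by
  have := integral_deriv_smoothStep_mul_le (H := fun t => -H t) (c := -c) hd h0 hb hH.fun_neg
    fun t ht => neg_le_neg (hc t ht)
  simp only [mul_neg, intervalIntegral.integral_neg] at this
  linarith

/-- A continuous function whose distributional derivative is nonnegative is nondecreasing. -/
theorem monotoneOn_of_weak_deriv_nonneg {T : ℝ} {H : ℝ → ℝ} (hH : ContinuousOn H (Ico 0 T))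
    (hw : ∀ (ψ : ℝ → ℝ) (b : ℝ), b ∈ Ioo 0 T → ContDiff ℝ ∞ ψ → HasCompactSupport ψ →
      tsupport ψ ⊆ Ioo 0 b → (∀ t, 0 ≤ ψ t) → ∫ t in (0 : ℝ)..b, deriv ψ t * H t ≤ 0) :
    MonotoneOn H (Ico 0 T) := by
  have hmain : ∀ x y, 0 < x → x < y → y < T → H x ≤ H y := by
    intro x y hx hxy hy
    by_contra! hcon
    -- Two levels H(y) < c₂ < c₁ < H(x) are separated; averages of H near x and near y stay on their
    -- own sides of them.
    obtain ⟨c₁, hc₁, hc₁'⟩ := exists_between hcon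
    obtain ⟨c₂, hc₂, hc₂'⟩ := exists_between hc₁
    have hxc : ContinuousAt H x := hH.continuousAt (Ico_mem_nhds hx (hxy.trans hy))
    have hyc : ContinuousAt H y := hH.continuousAt (Ico_mem_nhds (hx.trans hxy) hy)
    obtain ⟨d₁, hd₁, hd₁'⟩ := Metric.eventually_nhds_iff.1 (hxc.eventually (lt_mem_nhds hc₁'))
    obtain ⟨d₂, hd₂, hd₂'⟩ := Metric.eventually_nhds_iff.1 (hyc.eventually (gt_mem_nhds hc₂))
    obtain ⟨b, hb1, hb2⟩ := exists_between hy
    obtain ⟨d, hd0, hd⟩ : ∃ d, 0 < d ∧ d < min (min d₁ d₂) (min x (b - y)) :=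
      exists_between (by simp only [lt_min_iff]; exact ⟨⟨hd₁, hd₂⟩, hx, by linarith⟩)
    simp only [lt_min_iff] at hd
    obtain ⟨⟨hd1, hd2⟩, hd3, hd4⟩ := hd
    -- A smooth version of the indicator of [x,y]: its derivative compares the average of H near x
    -- with the one near y, and the weak hypothesis gives c₁ ≤ c₂.
    set ψ : ℝ → ℝ := fun t => smoothStep x d t - smoothStep y d t with hψ
    have hψz : ∀ t, t ∉ Icc (x - d) (y + d) → ψ t = 0 := by
      intro t ht
      rw [mem_Icc, not_and_or, not_le, not_le] at ht
      simp only [hψ]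
      rcases ht with h | h
      · rw [smoothStep_of_le hd0 h.le, smoothStep_of_le hd0 (by linarith), sub_zero]
      · rw [smoothStep_of_ge hd0 h.le, smoothStep_of_ge hd0 (by linarith), sub_self]
    have hts : tsupport ψ ⊆ Icc (x - d) (y + d) :=
      closure_minimal (fun t ht => by_contra fun h => ht (hψz t h)) isClosed_Icc
    have hHb : ContinuousOn H (Icc 0 b) := hH.mono fun t ht => ⟨ht.1, lt_of_le_of_lt ht.2 hb2⟩
    have h1 := hw ψ b ⟨by linarith, hb2⟩ ((contDiff_smoothStep x d).sub (contDiff_smoothStep y d))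
      (isCompact_Icc.of_isClosed_subset (isClosed_tsupport ψ) hts)
      (hts.trans fun t ht => ⟨by linarith [ht.1], by linarith [ht.2]⟩)
      (fun t => sub_nonneg.2 (smoothStep_anti_left hd0 hxy.le))
    have h2 : ∀ t, deriv ψ t = deriv (smoothStep x d) t - deriv (smoothStep y d) t := fun t =>
      deriv_fun_sub ((contDiff_smoothStep x d).differentiable (by simp) t)
        ((contDiff_smoothStep y d).differentiable (by simp) t)
    have hi : ∀ z, IntervalIntegrable (fun t => deriv (smoothStep z d) t * H t) volume 0 b := by
      intro z
      apply ContinuousOn.intervalIntegrable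
      rw [uIcc_of_le (by linarith)]
      exact (continuous_deriv_smoothStep z d).continuousOn.mul hHb
    simp only [h2, sub_mul] at h1
    rw [intervalIntegral.integral_sub (hi x) (hi y)] at h1
    have h3 := le_integral_deriv_smoothStep_mul (a := x) (c := c₁) hd0 (by linarith)
      (by linarith : x + d ≤ b) hHb (fun t ht => (hd₁' (by
        rw [Real.dist_eq, abs_lt]; constructor <;> linarith [ht.1, ht.2])).le)
    have h4 := integral_deriv_smoothStep_mul_le (a := y) (c := c₂) hd0 (by linarith)
      (by linarith : y + d ≤ b) hHb (fun t ht => (hd₂' (by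
        rw [Real.dist_eq, abs_lt]; constructor <;> linarith [ht.1, ht.2])).le)
    linarith
  intro x hx y hy hxy
  rcases eq_or_lt_of_le hxy with rfl | hlt
  · exact le_rfl
  rcases eq_or_lt_of_le hx.1 with h0 | h0
  · subst h0
    have ht : Tendsto H (𝓝[Ioo 0 y] 0) (𝓝 (H 0)) :=
      (hH 0 hx).mono_left (nhdsWithin_mono 0 fun z hz => ⟨hz.1.le, hz.2.trans hy.2⟩)
    have hne : (𝓝[Ioo 0 y] (0 : ℝ)).NeBot := by
      rw [← mem_closure_iff_nhdsWithin_neBot, closure_Ioo hlt.ne]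
      exact left_mem_Icc.2 hlt.le
    refine le_of_tendsto ht ?_
    filter_upwards [self_mem_nhdsWithin] with z hz
    exact hmain z y hz.1 hz.2 hy.2
  · exact hmain x y h0 hlt hy.2

/-- The weak form of `ᶜD^α M ≥ F` implies its integral form. -/
theorem le_of_weak_caputo_inequality {α T : ℝ} {M F : ℝ → ℝ} (hα₀ : 0 < α) (hα₁ : α < 1)
    (hM : ContinuousOn M (Ico 0 T)) (hF : ContinuousOn F (Ico 0 T))
    (hw : ∀ ψ : ℝ → ℝ, ContDiff ℝ ∞ ψ → HasCompactSupport ψ → tsupport ψ ⊆ Ioo 0 T →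
      (∀ t, 0 ≤ ψ t) →
      ∫ t in (0 : ℝ)..T, F t * ψ t ≤ ∫ t in (0 : ℝ)..T, (M t - M 0) * rightCaputo α T ψ t) :
    ∀ t ∈ Ico 0 T, M 0 + leftFracIntegral α F t ≤ M t := by
  have h1α : 0 < 1 - α := by linarith
  set V : ℝ → ℝ := fun t => M t - M 0 with hV
  have hVc : ContinuousOn V (Ico 0 T) := hM.sub continuousOn_const
  have hIc : ContinuousOn (leftFracIntegral α F) (Ico 0 T) := continuousOn_leftFracIntegral hα₀ hα₁ hF
  have hZc : ContinuousOn (fun s => V s - leftFracIntegral α F s) (Ico 0 T) := hVc.sub hIc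
  have hcomp : ∀ t ∈ Ico 0 T,
      leftFracIntegral (1 - α) (fun s => V s - leftFracIntegral α F s) t =
        leftFracIntegral (1 - α) V t - ∫ s in (0 : ℝ)..t, F s := by
    intro t ht
    have h2 := leftFracIntegral_leftFracIntegral (a := 1 - α) h1α (by linarith) ht.1
      (intervalIntegrable_of_continuousOn_Ico hF ht)
    rw [sub_sub_cancel] at h2
    rw [leftFracIntegral_sub (intervalIntegrable_kernel_mul_of_continuousOn h1α hVc ht)
      (intervalIntegrable_kernel_mul_of_continuousOn h1α hIc ht), h2]
  -- After both integrations by parts the hypothesis says that I^{1-α} of M - M(0) - I^α F has a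
  -- nonnegative distributional derivative. The positivity principle then gives M - M(0) ≥ I^α F.
  have hmono : MonotoneOn (leftFracIntegral (1 - α) (fun s => V s - leftFracIntegral α F s))
      (Ico 0 T) := by
    apply monotoneOn_of_weak_deriv_nonneg (continuousOn_leftFracIntegral h1α (by linarith) hZc)
    intro ψ b hb hψ hψc hψs hψ0
    have hψ' : Continuous (deriv ψ) := hψ.continuous_deriv (by simp)
    have hψz : ∀ t, t ∉ Ioo 0 b → ψ t = 0 := fun t ht =>
      image_eq_zero_of_notMem_tsupport fun h => ht (hψs h)
    have hψz' : ∀ r, b ≤ r → deriv ψ r = 0 := by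
      intro r hr
      have : r ∉ tsupport (deriv ψ) := fun h =>
        absurd (hψs (tsupport_deriv_subset h)).2 (not_lt.2 hr)
      exact image_eq_zero_of_notMem_tsupport this
    have hw1 := hw ψ hψ hψc (hψs.trans (Ioo_subset_Ioo le_rfl hb.2.le)) hψ0
    rw [integral_mul_rightCaputo hα₁ hb.1.le hb.2 hVc hψ' hψz'] at hw1
    have hFb : ∫ t in (0 : ℝ)..T, F t * ψ t = ∫ t in (0 : ℝ)..b, F t * ψ t := by
      rw [intervalIntegral.integral_of_le (hb.1.trans hb.2).le, intervalIntegral.integral_of_le hb.1.le]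
      apply setIntegral_eq_of_subset_of_forall_sdiff_eq_zero measurableSet_Ioc
        (Ioc_subset_Ioc le_rfl hb.2.le)
      intro s hs
      rw [hψz s fun h => hs.2 ⟨h.1, h.2.le⟩, mul_zero]
    have hIccb : Icc 0 b ⊆ Ico 0 T := fun x hx => ⟨hx.1, lt_of_le_of_lt hx.2 hb.2⟩
    have hbT : b ∈ Ico 0 T := ⟨hb.1.le, hb.2⟩
    have hFi := intervalIntegrable_of_continuousOn_Ico hF hbT
    have hΦc : ContinuousOn (fun t => ∫ s in (0 : ℝ)..t, F s) (Icc 0 b) := by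
      have := intervalIntegral.continuousOn_primitive_interval (f := F) (μ := volume) (a := 0) (b := b)
        (by rw [uIcc_of_le hb.1.le]; exact (hF.mono hIccb).integrableOn_Icc)
      rwa [uIcc_of_le hb.1.le] at this
    have hparts : ∫ t in (0 : ℝ)..b, ψ t * F t =
        -∫ t in (0 : ℝ)..b, deriv ψ t * ∫ s in (0 : ℝ)..t, F s := by
      have := intervalIntegral.integral_mul_deriv_eq_deriv_mul_of_hasDerivAt (a := 0) (b := b)
        (u := ψ) (v := fun t => ∫ s in (0 : ℝ)..t, F s) (u' := deriv ψ) (v' := F)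
        hψ.continuous.continuousOn (by rwa [uIcc_of_le hb.1.le])
        (fun x _ => (hψ.differentiable (by simp) x).hasDerivAt) (by
          intro x hx
          rw [min_eq_left hb.1.le, max_eq_right hb.1.le] at hx
          exact hasDerivAt_integral_of_continuousOn hF ⟨hx.1, hx.2.trans hb.2⟩)
        (hψ'.intervalIntegrable _ _) hFi
      rw [this, hψz b (fun h => lt_irrefl _ h.2), intervalIntegral.integral_same]
      ring
    have hGc := continuousOn_leftFracIntegral h1α (by linarith) hVc
    have hfin : ∫ t in (0 : ℝ)..b,
        deriv ψ t * leftFracIntegral (1 - α) (fun s => V s - leftFracIntegral α F s) t =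
        (∫ t in (0 : ℝ)..b, deriv ψ t * leftFracIntegral (1 - α) V t) -
          ∫ t in (0 : ℝ)..b, deriv ψ t * ∫ s in (0 : ℝ)..t, F s := by
      rw [← intervalIntegral.integral_sub]
      · apply intervalIntegral.integral_congr
        intro t ht
        rw [uIcc_of_le hb.1.le] at ht
        simp only
        rw [hcomp t (hIccb ht), mul_sub]
      · apply ContinuousOn.intervalIntegrable
        rw [uIcc_of_le hb.1.le]
        exact hψ'.continuousOn.mul (hGc.mono hIccb)
      · apply ContinuousOn.intervalIntegrable
        rw [uIcc_of_le hb.1.le]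
        exact hψ'.continuousOn.mul hΦc
    rw [hfin]
    rw [hFb] at hw1
    have hcomm : ∫ t in (0 : ℝ)..b, F t * ψ t = ∫ t in (0 : ℝ)..b, ψ t * F t := by
      congr 1; ext t; ring
    rw [hcomm, hparts] at hw1
    linarith
  have hnn := nonneg_of_monotoneOn_leftFracIntegral hα₀ hα₁ hZc hmono
  intro t ht
  rcases eq_or_lt_of_le ht.1 with h0 | h0
  · subst h0; rw [leftFracIntegral_zero, add_zero]
  · have := hnn t ⟨h0, ht.2⟩
    simp only [hV] at this
    linarith
/-! ### Pairings of `L²` functions with controlled functions -/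

lemma memLp_weight {N : ℕ} {β : ℝ} (hβ : 0 < β) :
    MemLp (fun x : E N => (weight N β x : ℂ)) 2 := by
  have hm : AEStronglyMeasurable (fun x : E N => (weight N β x : ℂ)) :=
    (Complex.continuous_ofReal.comp (continuous_weight N β)).aestronglyMeasurable
  rw [memLp_two_iff_integrable_sq_norm hm]
  refine (integrable_weight hβ).mono' (hm.norm.pow 2) (Eventually.of_forall fun x => ?_)
  have h0 := weight_pos N β x
  have h1 := weight_le_one (N := N) hβ x
  rw [Complex.norm_real, Real.norm_of_nonneg h0.le, Real.norm_of_nonneg (by positivity)]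
  nlinarith

lemma memLp_of_abs_le_weight {N : ℕ} {β A : ℝ} (hβ : 0 < β) {f : E N → ℝ} (hf : Measurable f)
    (hb : ∀ x, |f x| ≤ A * weight N β x) : MemLp (fun x : E N => (f x : ℂ)) 2 := by
  refine (memLp_weight hβ).of_le_mul (c := A)
    (Complex.measurable_ofReal.comp hf).aestronglyMeasurable (Eventually.of_forall fun x => ?_)
  rw [Complex.norm_real, Complex.norm_real, Real.norm_of_nonneg (weight_pos N β x).le]
  exact hb x

/-- The pairing `∫ w f` of an `L²` function with a real function. -/
def pairing {N : ℕ} (f : E N → ℝ) (w : L2 N) : ℂ := ∫ x, w x * (f x : ℂ)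

lemma pairing_eq_inner {N : ℕ} {f : E N → ℝ} (hf : MemLp (fun x : E N => (f x : ℂ)) 2) (w : L2 N) :
    pairing f w = inner ℂ (hf.toLp _) w := by
  rw [L2.inner_def]
  apply integral_congr_ae
  filter_upwards [hf.coeFn_toLp] with x hx
  rw [hx, RCLike.inner_apply, Complex.conj_ofReal]

lemma continuous_pairing {N : ℕ} {f : E N → ℝ} (hf : MemLp (fun x : E N => (f x : ℂ)) 2) :
    Continuous (pairing (N := N) f) := by
  have : pairing (N := N) f = fun w => inner ℂ (hf.toLp _) w := funext (pairing_eq_inner hf)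
  rw [this]
  fun_prop

lemma integrable_mul_of_memLp {N : ℕ} {f : E N → ℝ} (hf : MemLp (fun x : E N => (f x : ℂ)) 2)
    (w : L2 N) : Integrable fun x => w x * (f x : ℂ) :=
  (Lp.memLp w).integrable_mul hf

lemma norm_pairing_le {N : ℕ} {β A : ℝ} (hβ : 0 < β) {f : E N → ℝ} (hf : Measurable f)
    (hb : ∀ x, |f x| ≤ A * weight N β x) (w : L2 N) :
    ‖pairing f w‖ ≤ A * ‖(memLp_weight (N := N) hβ).toLp _‖ * ‖w‖ := by
  have hfm := memLp_of_abs_le_weight hβ hf hb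
  rw [pairing_eq_inner hfm]
  refine (norm_inner_le_norm _ _).trans (mul_le_mul_of_nonneg_right ?_ (norm_nonneg _))
  apply Lp.norm_le_mul_norm_of_ae_le_mul
  filter_upwards [hfm.coeFn_toLp, (memLp_weight (N := N) hβ).coeFn_toLp] with x h1 h2
  rw [h1, h2, Complex.norm_real, Complex.norm_real, Real.norm_of_nonneg (weight_pos N β x).le]
  exact hb x

lemma integrable_norm_mul_of_abs_le {N : ℕ} {β A : ℝ} (hβ : 0 < β) {f : E N → ℝ}
    (hf : Measurable f) (hb : ∀ x, |f x| ≤ A * weight N β x) (w : L2 N) :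
    Integrable fun x => ‖w x‖ * f x := by
  refine (integrable_mul_of_memLp (memLp_of_abs_le_weight hβ hf hb) w).norm.mono'
    ((Lp.aestronglyMeasurable w).norm.mul hf.aestronglyMeasurable) (Eventually.of_forall fun x => ?_)
  rw [norm_mul, norm_mul, norm_norm, Complex.norm_real]

lemma integral_norm_mul_weight_le {N : ℕ} {β : ℝ} (hβ : 0 < β) (w : L2 N) :
    ∫ x, ‖w x‖ * weight N β x ≤ ‖(memLp_weight (N := N) hβ).toLp _‖ * ‖w‖ := by
  have hn : MemLp (fun x => ((‖w x‖ : ℝ) : ℂ)) 2 (volume : Measure (E N)) := by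
    refine (Lp.memLp w).of_le (Complex.continuous_ofReal.comp_aestronglyMeasurable
      (Lp.aestronglyMeasurable w).norm) (Eventually.of_forall fun x => ?_)
    rw [Complex.norm_real, norm_norm]
  have h1 := norm_pairing_le (A := 1) hβ (continuous_weight N β).measurable
    (fun x => by rw [one_mul, abs_of_pos (weight_pos N β x)]) (hn.toLp _)
  have h2 : ‖hn.toLp _‖ ≤ ‖w‖ := by
    apply Lp.norm_le_norm_of_ae_le
    filter_upwards [hn.coeFn_toLp] with x hx
    rw [hx, Complex.norm_real, norm_norm]
  have h3 : pairing (weight N β) (hn.toLp _) = ((∫ x, ‖w x‖ * weight N β x : ℝ) : ℂ) := by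
    unfold pairing
    refine Eq.trans ?_ (integral_ofReal (𝕜 := ℂ))
    apply integral_congr_ae
    filter_upwards [hn.coeFn_toLp] with x hx
    rw [hx]; push_cast; rfl
  rw [h3, Complex.norm_real, one_mul] at h1
  refine (Real.le_norm_self _).trans (h1.trans ?_)
  gcongr

lemma tendsto_pairing {N : ℕ} {β A : ℝ} (hβ : 0 < β) {f : E N → ℝ} {fn : ℕ → E N → ℝ}
    (hfn : ∀ n, Measurable (fn n)) (hb : ∀ n x, |fn n x| ≤ A * weight N β x)
    (hlim : ∀ x, Tendsto (fun n => fn n x) atTop (𝓝 (f x))) (w : L2 N) :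
    Tendsto (fun n => pairing (fn n) w) atTop (𝓝 (pairing f w)) := by
  have hAw : Measurable fun x : E N => A * weight N β x :=
    (continuous_weight N β).measurable.const_mul A
  apply tendsto_integral_of_dominated_convergence (fun x => ‖w x‖ * (A * weight N β x))
  · exact fun n => (integrable_mul_of_memLp (memLp_of_abs_le_weight hβ (hfn n) (hb n)) w).1
  · apply integrable_norm_mul_of_abs_le hβ hAw (A := |A|)
    intro x
    rw [abs_mul, abs_of_pos (weight_pos N β x)]
  · refine fun n => Eventually.of_forall fun x => ?_
    rw [norm_mul, Complex.norm_real]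
    exact mul_le_mul_of_nonneg_left (hb n x) (norm_nonneg _)
  · exact Eventually.of_forall fun x =>
      (Complex.continuous_ofReal.tendsto _ |>.comp (hlim x)).const_mul _

lemma aestronglyMeasurable_Ioc_of_continuousOn_Ico {F : Type*} [NormedAddCommGroup F] {T : ℝ}
    {f : ℝ → F} (hf : ContinuousOn f (Ico 0 T)) :
    AEStronglyMeasurable f (volume.restrict (Ioc 0 T)) := by
  rw [← Measure.restrict_congr_set Ioo_ae_eq_Ioc]
  exact (hf.mono Ioo_subset_Ico_self).aestronglyMeasurable measurableSet_Ioo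

/-- Passage to the limit in a pairing integrated in time against a function vanishing near the
final time. -/
theorem tendsto_integral_pairing {N : ℕ} {β A T b : ℝ} (hβ : 0 < β) (hA : 0 ≤ A) {f : E N → ℝ}
    {fn : ℕ → E N → ℝ} (hfn : ∀ n, Measurable (fn n)) (hb : ∀ n x, |fn n x| ≤ A * weight N β x)
    (hlim : ∀ x, Tendsto (fun n => fn n x) atTop (𝓝 (f x))) {u : ℝ → L2 N}
    (hu : ContinuousOn u (Ico 0 T)) {ρ : ℝ → ℝ} (hρ : ContinuousOn ρ (Icc 0 T)) (hb0 : 0 ≤ b)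
    (hbT : b < T) (hρb : ∀ t, b ≤ t → t ≤ T → ρ t = 0) :
    Tendsto (fun n => ∫ t in (0 : ℝ)..T, pairing (fn n) (u t) * (ρ t : ℂ)) atTop
      (𝓝 (∫ t in (0 : ℝ)..T, pairing f (u t) * (ρ t : ℂ))) := by
  have hT : 0 ≤ T := hb0.trans hbT.le
  -- The L² norm of u need not be bounded up to T. Since ρ vanishes after b, a bound on the compact
  -- interval [0,b] suffices.
  obtain ⟨U, hU⟩ := (isCompact_Icc (a := (0 : ℝ)) (b := b)).exists_bound_of_continuousOn
    (hu.mono fun x hx => ⟨hx.1, lt_of_le_of_lt hx.2 hbT⟩)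
  obtain ⟨D, hD⟩ := isCompact_Icc.exists_bound_of_continuousOn hρ
  set Λ := ‖(memLp_weight (N := N) hβ).toLp _‖
  apply intervalIntegral.tendsto_integral_filter_of_dominated_convergence
    (fun _ => A * Λ * U * D)
  · refine Eventually.of_forall fun n => ?_
    rw [uIoc_of_le hT]
    have h1 : ContinuousOn (fun t => pairing (fn n) (u t)) (Ico 0 T) :=
      (continuous_pairing (memLp_of_abs_le_weight hβ (hfn n) (hb n))).comp_continuousOn hu
    exact aestronglyMeasurable_Ioc_of_continuousOn_Ico
      (h1.mul (Complex.continuous_ofReal.comp_continuousOn (hρ.mono Ico_subset_Icc_self)))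
  · refine Eventually.of_forall fun n => Eventually.of_forall fun t ht => ?_
    rw [uIoc_of_le hT] at ht
    have hD' := hD t ⟨ht.1.le, ht.2⟩
    rw [norm_mul, Complex.norm_real]
    rcases le_or_gt t b with htb | htb
    · have hU' := hU t ⟨ht.1.le, htb⟩
      have h1 := norm_pairing_le hβ (hfn n) (hb n) (u t)
      have h2 : ‖pairing (fn n) (u t)‖ ≤ A * Λ * U :=
        h1.trans (mul_le_mul_of_nonneg_left hU' (by positivity))
      exact mul_le_mul h2 hD' (norm_nonneg _) ((norm_nonneg _).trans h2)
    · rw [hρb t htb.le ht.2, norm_zero, mul_zero]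
      have hU0 := (norm_nonneg _).trans (hU 0 ⟨le_rfl, hb0⟩)
      have hD0 := (norm_nonneg _).trans hD'
      positivity
  · exact _root_.intervalIntegrable_const
  · exact Eventually.of_forall fun t _ => (tendsto_pairing hβ hfn hb hlim (u t)).mul_const _

/-! ### The nonlinear term -/

lemma abs_rpow_sub_rpow_le {p k x y : ℝ} (hp : 1 ≤ p) (hx : x ∈ Icc 0 k) (hy : y ∈ Icc 0 k) :
    |x ^ p - y ^ p| ≤ p * k ^ (p - 1) * |x - y| := by
  have := (convex_Icc (0 : ℝ) k).norm_image_sub_le_of_norm_hasDerivWithin_le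
    (f := fun x => x ^ p) (f' := fun x => p * x ^ (p - 1)) (C := p * k ^ (p - 1)) (x := y) (y := x)
    (fun z _ => (Real.hasDerivAt_rpow_const (Or.inr hp)).hasDerivWithinAt) (fun z hz => by
      rw [Real.norm_of_nonneg (mul_nonneg (by linarith) (Real.rpow_nonneg hz.1 _))]
      exact mul_le_mul_of_nonneg_left (Real.rpow_le_rpow hz.1 hz.2 (by linarith)) (by linarith))
    hy hx
  simpa [Real.norm_eq_abs] using this

/-- `∫ |w|^p f`. -/
def powerPairing {N : ℕ} (p : ℝ) (f : E N → ℝ) (w : L2 N) : ℝ := ∫ x, ‖w x‖ ^ p * f x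

/-- `∫ min(|w|, k)^p f`. -/
def truncatedPairing {N : ℕ} (p k : ℝ) (f : E N → ℝ) (w : L2 N) : ℝ :=
  ∫ x, (min ‖w x‖ k) ^ p * f x

lemma integrable_of_abs_le_weight {N : ℕ} {β A : ℝ} (hβ : 0 < β) {f : E N → ℝ}
    (hf : Measurable f) (hb : ∀ x, |f x| ≤ A * weight N β x) : Integrable f :=
  ((integrable_weight hβ).const_mul A).mono' hf.aestronglyMeasurable (Eventually.of_forall hb)

lemma aestronglyMeasurable_min_norm {N : ℕ} (p k : ℝ) (w : L2 N) :
    AEStronglyMeasurable (fun x => (min ‖w x‖ k) ^ p) (volume : Measure (E N)) := by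
  have h : AEMeasurable (fun x => min ‖w x‖ k) (volume : Measure (E N)) :=
    (Lp.aestronglyMeasurable w).norm.aemeasurable.min aemeasurable_const
  exact (h.pow_const p).aestronglyMeasurable

lemma integrable_truncated {N : ℕ} {β A p k : ℝ} (hβ : 0 < β) (hp : 0 ≤ p) (hk : 0 ≤ k)
    {f : E N → ℝ} (hf : Measurable f) (hb : ∀ x, |f x| ≤ A * weight N β x) (w : L2 N) :
    Integrable fun x => (min ‖w x‖ k) ^ p * f x := by
  refine (integrable_of_abs_le_weight hβ hf hb).bdd_mul (c := k ^ p)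
    (aestronglyMeasurable_min_norm p k w) (Eventually.of_forall fun x => ?_)
  have h0 : 0 ≤ min ‖w x‖ k := le_min (norm_nonneg _) hk
  rw [Real.norm_of_nonneg (Real.rpow_nonneg h0 _)]
  exact Real.rpow_le_rpow h0 (min_le_right _ _) hp

/-- On [0,k] the map y ↦ y^p is Lipschitz, so the truncated functional is Lipschitz on L². The
untruncated one need not be continuous there, and measurability in time along u is obtained from the
truncations. -/
lemma continuous_truncatedPairing {N : ℕ} {β A p k : ℝ} (hβ : 0 < β) (hp : 1 ≤ p) (hk : 0 ≤ k)
    {f : E N → ℝ} (hf : Measurable f) (hb : ∀ x, |f x| ≤ A * weight N β x) :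
    Continuous (truncatedPairing (N := N) p k f) := by
  set Λ := ‖(memLp_weight (N := N) hβ).toLp _‖
  have hA : 0 ≤ A :=
    nonneg_of_mul_nonneg_left ((abs_nonneg _).trans (hb 0)) (weight_pos N β 0)
  have hc : 0 ≤ p * k ^ (p - 1) := mul_nonneg (by linarith) (Real.rpow_nonneg hk _)
  have hl : LipschitzWith (Real.toNNReal (p * k ^ (p - 1) * A * Λ)) (truncatedPairing (N := N) p k f) := by
    apply LipschitzWith.of_dist_le_mul
    intro w w'
    have hi := integrable_truncated (p := p) hβ (by linarith) hk hf hb w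
    have hi' := integrable_truncated (p := p) hβ (by linarith) hk hf hb w'
    have hAw : Measurable fun x : E N => p * k ^ (p - 1) * (A * weight N β x) :=
      ((continuous_weight N β).measurable.const_mul A).const_mul _
    have hint : Integrable fun x => ‖(w - w' : L2 N) x‖ * (p * k ^ (p - 1) * (A * weight N β x)) := by
      apply integrable_norm_mul_of_abs_le hβ hAw (A := p * k ^ (p - 1) * A)
      intro x
      rw [abs_of_nonneg (mul_nonneg hc (mul_nonneg hA (weight_pos N β x).le))]
      exact le_of_eq (by ring)
    rw [Real.dist_eq, dist_eq_norm, Real.coe_toNNReal _ (by positivity)]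
    unfold truncatedPairing
    rw [← integral_sub hi hi', ← Real.norm_eq_abs]
    calc ‖∫ x, ((min ‖w x‖ k) ^ p * f x - (min ‖w' x‖ k) ^ p * f x)‖
        ≤ ∫ x, ‖(w - w' : L2 N) x‖ * (p * k ^ (p - 1) * (A * weight N β x)) := by
          apply norm_integral_le_of_norm_le hint
          filter_upwards [Lp.coeFn_sub w w'] with x hx
          rw [hx, Pi.sub_apply, ← sub_mul, norm_mul, Real.norm_eq_abs, Real.norm_eq_abs]
          have e1 := abs_rpow_sub_rpow_le (p := p) (k := k) hp
            (x := min ‖w x‖ k) (y := min ‖w' x‖ k)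
            ⟨le_min (norm_nonneg _) hk, min_le_right _ _⟩ ⟨le_min (norm_nonneg _) hk, min_le_right _ _⟩
          have e2 : |min ‖w x‖ k - min ‖w' x‖ k| ≤ ‖w x - w' x‖ := by
            have h1 := abs_min_sub_min_le_max ‖w x‖ k ‖w' x‖ k
            rw [sub_self, abs_zero, max_eq_left (abs_nonneg _)] at h1
            exact h1.trans (abs_norm_sub_norm_le _ _)
          calc _ ≤ (p * k ^ (p - 1) * ‖w x - w' x‖) * (A * weight N β x) := by
                apply mul_le_mul _ (hb x) (abs_nonneg _) (mul_nonneg hc (norm_nonneg _))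
                exact e1.trans (mul_le_mul_of_nonneg_left e2 hc)
            _ = _ := by ring
      _ = p * k ^ (p - 1) * A * ∫ x, ‖(w - w' : L2 N) x‖ * weight N β x := by
          rw [← integral_const_mul]
          congr 1; ext x; ring
      _ ≤ p * k ^ (p - 1) * A * (Λ * ‖w - w'‖) :=
          mul_le_mul_of_nonneg_left (integral_norm_mul_weight_le hβ _) (mul_nonneg hc hA)
      _ = _ := by ring
  exact hl.continuous

lemma integrable_power_mul {N : ℕ} {β A p : ℝ} (hβ : 0 < β) (hp : 0 < p) {f : E N → ℝ}
    (hf : Measurable f) (hb : ∀ x, |f x| ≤ A * weight N β x) {w : L2 N}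
    (hw : MemLp w (ENNReal.ofReal p) (volume : Measure (E N))) :
    Integrable fun x => ‖w x‖ ^ p * f x := by
  have hA : 0 ≤ A :=
    nonneg_of_mul_nonneg_left ((abs_nonneg _).trans (hb 0)) (weight_pos N β 0)
  have h1 := hw.integrable_norm_rpow (by simpa using hp) ENNReal.ofReal_ne_top
  rw [ENNReal.toReal_ofReal hp.le] at h1
  refine h1.mul_bdd (c := A) hf.aestronglyMeasurable (Eventually.of_forall fun x => ?_)
  exact (hb x).trans (mul_le_of_le_one_right hA (weight_le_one hβ x))

lemma abs_powerPairing_le {N : ℕ} {β A p : ℝ} (hβ : 0 < β) (hp : 0 < p) {f : E N → ℝ}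
    (hb : ∀ x, |f x| ≤ A * weight N β x) {C : NNReal} {w : L2 N}
    (hw : eLpNorm w (ENNReal.ofReal p) (volume : Measure (E N)) ≤ C) :
    |powerPairing p f w| ≤ C ^ p * A := by
  have hA : 0 ≤ A :=
    nonneg_of_mul_nonneg_left ((abs_nonneg _).trans (hb 0)) (weight_pos N β 0)
  have hm : MemLp w (ENNReal.ofReal p) (volume : Measure (E N)) :=
    ⟨Lp.aestronglyMeasurable w, lt_of_le_of_lt hw ENNReal.coe_lt_top⟩
  have h1 := hm.integrable_norm_rpow (by simpa using hp) ENNReal.ofReal_ne_top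
  have h2 := hm.eLpNorm_eq_integral_rpow_norm (by simpa using hp) ENNReal.ofReal_ne_top
  rw [ENNReal.toReal_ofReal hp.le] at h1 h2
  have h0 : 0 ≤ ∫ x, ‖w x‖ ^ p := integral_nonneg fun x => Real.rpow_nonneg (norm_nonneg _) _
  have h3 : ∫ x, ‖w x‖ ^ p ≤ C ^ p := by
    rw [h2] at hw
    have h4 : (∫ x, ‖w x‖ ^ p) ^ p⁻¹ ≤ C := by
      have := (ENNReal.ofReal_le_iff_le_toReal ENNReal.coe_ne_top).1 hw
      simpa using this
    have h5 := Real.rpow_le_rpow (Real.rpow_nonneg h0 _) h4 hp.le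
    rwa [← Real.rpow_mul h0, inv_mul_cancel₀ hp.ne', Real.rpow_one] at h5
  unfold powerPairing
  rw [← Real.norm_eq_abs]
  calc _ ≤ ∫ x, ‖w x‖ ^ p * A := by
        apply norm_integral_le_of_norm_le (h1.mul_const A)
        refine Eventually.of_forall fun x => ?_
        have h4 : 0 ≤ ‖w x‖ ^ p := Real.rpow_nonneg (norm_nonneg _) _
        rw [norm_mul, Real.norm_of_nonneg h4]
        exact mul_le_mul_of_nonneg_left
          ((hb x).trans (mul_le_of_le_one_right hA (weight_le_one hβ x))) h4
    _ ≤ _ := by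
        rw [integral_mul_const]
        exact mul_le_mul_of_nonneg_right h3 hA

lemma tendsto_truncatedPairing {N : ℕ} {β A p : ℝ} (hβ : 0 < β) (hp : 0 < p) {f : E N → ℝ}
    (hf : Measurable f) (hb : ∀ x, |f x| ≤ A * weight N β x) {w : L2 N}
    (hw : MemLp w (ENNReal.ofReal p) (volume : Measure (E N))) :
    Tendsto (fun k : ℕ => truncatedPairing p k f w) atTop (𝓝 (powerPairing p f w)) := by
  apply tendsto_integral_of_dominated_convergence (fun x => ‖‖w x‖ ^ p * f x‖)
  · exact fun k => (integrable_truncated hβ hp.le (Nat.cast_nonneg k) hf hb w).1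
  · exact (integrable_power_mul hβ hp hf hb hw).norm
  · refine fun k => Eventually.of_forall fun x => ?_
    have h0 : 0 ≤ min ‖w x‖ (k : ℝ) := le_min (norm_nonneg _) (Nat.cast_nonneg k)
    rw [norm_mul, norm_mul, Real.norm_of_nonneg (Real.rpow_nonneg h0 _),
      Real.norm_of_nonneg (Real.rpow_nonneg (norm_nonneg _) _)]
    exact mul_le_mul_of_nonneg_right (Real.rpow_le_rpow h0 (min_le_left _ _) hp.le) (norm_nonneg _)
  · refine Eventually.of_forall fun x => tendsto_const_nhds.congr' ?_
    obtain ⟨k₀, hk₀⟩ := exists_nat_ge ‖w x‖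
    filter_upwards [eventually_ge_atTop k₀] with k hk
    have : (k₀ : ℝ) ≤ k := by exact_mod_cast hk
    rw [min_eq_left (hk₀.trans this)]

lemma tendsto_powerPairing {N : ℕ} {β A p : ℝ} (hβ : 0 < β) (hp : 0 < p) {f : E N → ℝ}
    {fn : ℕ → E N → ℝ} (hfn : ∀ n, Measurable (fn n)) (hb : ∀ n x, |fn n x| ≤ A * weight N β x)
    (hlim : ∀ x, Tendsto (fun n => fn n x) atTop (𝓝 (f x))) {w : L2 N}
    (hw : MemLp w (ENNReal.ofReal p) (volume : Measure (E N))) :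
    Tendsto (fun n => powerPairing p (fn n) w) atTop (𝓝 (powerPairing p f w)) := by
  have hA : 0 ≤ A :=
    nonneg_of_mul_nonneg_left ((abs_nonneg _).trans (hb 0 0)) (weight_pos N β 0)
  apply tendsto_integral_of_dominated_convergence (fun x => ‖w x‖ ^ p * (A * weight N β x))
  · exact fun n => (integrable_power_mul hβ hp (hfn n) (hb n) hw).1
  · exact integrable_power_mul hβ hp ((continuous_weight N β).measurable.const_mul A)
      (fun x => by rw [abs_of_nonneg (mul_nonneg hA (weight_pos N β x).le)]) hw
  · refine fun n => Eventually.of_forall fun x => ?_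
    have h0 : 0 ≤ ‖w x‖ ^ p := Real.rpow_nonneg (norm_nonneg _) _
    rw [norm_mul, Real.norm_of_nonneg h0]
    exact mul_le_mul_of_nonneg_left (hb n x) h0
  · exact Eventually.of_forall fun x => (hlim x).const_mul _

/-- For almost every t the value u(t) lies in L^p, and the pairing is the limit of its truncations,
which are continuous in t. -/
lemma aestronglyMeasurable_powerPairing {N : ℕ} {β A p T : ℝ} (hβ : 0 < β) (hp : 1 ≤ p)
    {f : E N → ℝ} (hf : Measurable f) (hb : ∀ x, |f x| ≤ A * weight N β x) {u : ℝ → L2 N}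
    (hu : ContinuousOn u (Ico 0 T))
    (hm : ∀ᵐ t ∂(volume.restrict (Ioc 0 T)),
      MemLp (u t) (ENNReal.ofReal p) (volume : Measure (E N))) :
    AEStronglyMeasurable (fun t => powerPairing p f (u t)) (volume.restrict (Ioc 0 T)) := by
  apply aestronglyMeasurable_of_tendsto_ae atTop (f := fun (k : ℕ) t => truncatedPairing p k f (u t))
  · intro k
    exact aestronglyMeasurable_Ioc_of_continuousOn_Ico
      ((continuous_truncatedPairing hβ hp (Nat.cast_nonneg k) hf hb).comp_continuousOn hu)
  · filter_upwards [hm] with t ht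
    exact tendsto_truncatedPairing hβ (by linarith) hf hb ht

/-- The L^∞ bound in time with values in L^p provides a constant majorant in t, and for almost every
t an integrable one in x. -/
theorem tendsto_integral_powerPairing {N : ℕ} {β A p T : ℝ} (hβ : 0 < β) (hp : 1 ≤ p) (hT : 0 ≤ T)
    {f : E N → ℝ} {fn : ℕ → E N → ℝ} (hfn : ∀ n, Measurable (fn n))
    (hb : ∀ n x, |fn n x| ≤ A * weight N β x)
    (hlim : ∀ x, Tendsto (fun n => fn n x) atTop (𝓝 (f x))) {u : ℝ → L2 N}
    (hu : ContinuousOn u (Ico 0 T)) {C : NNReal}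
    (hC : ∀ᵐ t ∂(volume.restrict (Ioc 0 T)),
      eLpNorm (u t) (ENNReal.ofReal p) (volume : Measure (E N)) ≤ C)
    {ψ : ℝ → ℝ} (hψ : Continuous ψ) :
    Tendsto (fun n => ∫ t in (0 : ℝ)..T, powerPairing p (fn n) (u t) * ψ t) atTop
      (𝓝 (∫ t in (0 : ℝ)..T, powerPairing p f (u t) * ψ t)) := by
  have hp0 : 0 < p := by linarith
  have hA : 0 ≤ A :=
    nonneg_of_mul_nonneg_left ((abs_nonneg _).trans (hb 0 0)) (weight_pos N β 0)
  obtain ⟨D, hD⟩ := (isCompact_Icc (a := (0 : ℝ)) (b := T)).exists_bound_of_continuousOn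
    hψ.continuousOn
  have hm : ∀ᵐ t ∂(volume.restrict (Ioc 0 T)),
      MemLp (u t) (ENNReal.ofReal p) (volume : Measure (E N)) := by
    filter_upwards [hC] with t ht
    exact ⟨Lp.aestronglyMeasurable _, lt_of_le_of_lt ht ENNReal.coe_lt_top⟩
  apply intervalIntegral.tendsto_integral_filter_of_dominated_convergence (fun _ => C ^ p * A * D)
  · refine Eventually.of_forall fun n => ?_
    rw [uIoc_of_le hT]
    exact (aestronglyMeasurable_powerPairing hβ hp (hfn n) (hb n) hu hm).mul
      hψ.aestronglyMeasurable
  · refine Eventually.of_forall fun n => ?_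
    rw [uIoc_of_le hT]
    filter_upwards [(ae_restrict_iff' measurableSet_Ioc).1 hC] with t ht ht'
    rw [norm_mul]
    have h1 := abs_powerPairing_le hβ hp0 (hb n) (ht ht')
    exact mul_le_mul h1 (hD t ⟨ht'.1.le, ht'.2⟩) (norm_nonneg _) ((abs_nonneg _).trans h1)
  · exact _root_.intervalIntegrable_const
  · rw [uIoc_of_le hT]
    filter_upwards [(ae_restrict_iff' measurableSet_Ioc).1 hm] with t ht ht'
    exact (tendsto_powerPairing hβ hp0 hfn hb hlim (ht ht')).mul_const _
-- Integrability in time and supports of time test functions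
lemma intervalIntegrable_powerPairing_mul {N : ℕ} {β A p T : ℝ} (hβ : 0 < β) (hp : 1 ≤ p)
    (hT : 0 ≤ T) {f : E N → ℝ} (hf : Measurable f) (hb : ∀ x, |f x| ≤ A * weight N β x)
    {u : ℝ → L2 N} (hu : ContinuousOn u (Ico 0 T)) {C : NNReal}
    (hC : ∀ᵐ t ∂(volume.restrict (Ioc 0 T)),
      eLpNorm (u t) (ENNReal.ofReal p) (volume : Measure (E N)) ≤ C)
    {ψ : ℝ → ℝ} (hψ : Continuous ψ) :
    IntervalIntegrable (fun t => powerPairing p f (u t) * ψ t) volume 0 T := by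
  have hm : ∀ᵐ t ∂(volume.restrict (Ioc 0 T)),
      MemLp (u t) (ENNReal.ofReal p) (volume : Measure (E N)) := by
    filter_upwards [hC] with t ht
    exact ⟨Lp.aestronglyMeasurable _, lt_of_le_of_lt ht ENNReal.coe_lt_top⟩
  rw [intervalIntegrable_iff_integrableOn_Ioc_of_le hT]
  have hψi : IntegrableOn ψ (Ioc 0 T) :=
    (intervalIntegrable_iff_integrableOn_Ioc_of_le hT).1 (hψ.intervalIntegrable 0 T)
  refine hψi.bdd_mul (c := C ^ p * A) (aestronglyMeasurable_powerPairing hβ hp hf hb hu hm) ?_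
  filter_upwards [hC] with t ht
  exact abs_powerPairing_le hβ (by linarith) hb ht

lemma intervalIntegrable_of_eq_zero {F : Type*} [NormedAddCommGroup F] {T b : ℝ} {f : ℝ → F}
    (hf : ContinuousOn f (Ico 0 T)) (hb0 : 0 ≤ b) (hbT : b < T)
    (hz : ∀ t, b ≤ t → t ≤ T → f t = 0) : IntervalIntegrable f volume 0 T := by
  refine IntervalIntegrable.trans (b := b) ?_ ?_
  · apply ContinuousOn.intervalIntegrable
    rw [uIcc_of_le hb0]
    exact hf.mono fun x hx => ⟨hx.1, lt_of_le_of_lt hx.2 hbT⟩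
  · refine (_root_.intervalIntegrable_const (c := (0 : F))).congr fun t ht => ?_
    rw [uIoc_of_le hbT.le] at ht
    exact (hz t ht.1.le ht.2).symm

lemma exists_vanishing_time {T : ℝ} (hT : 0 < T) {ψ : ℝ → ℝ} (hψc : HasCompactSupport ψ)
    (hψs : tsupport ψ ⊆ Ioo 0 T) :
    ∃ b ∈ Ioo 0 T, (∀ t, b ≤ t → ψ t = 0) ∧ ∀ t, b ≤ t → deriv ψ t = 0 := by
  obtain ⟨c, hcT, hc⟩ : ∃ c < T, ∀ t ∈ tsupport ψ, t ≤ c := by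
    rcases (tsupport ψ).eq_empty_or_nonempty with h | h
    · exact ⟨0, hT, by simp [h]⟩
    · obtain ⟨c, hc, hc'⟩ := hψc.isCompact.exists_isGreatest h
      exact ⟨c, (hψs hc).2, fun t ht => hc' ht⟩
  obtain ⟨b, hb1, hb2⟩ := exists_between (max_lt hcT hT)
  have hnot : ∀ t, b ≤ t → t ∉ tsupport ψ := fun t ht h =>
    absurd (hc t h) (not_le.2 ((le_max_left _ _).trans_lt (hb1.trans_le ht)))
  exact ⟨b, ⟨(le_max_right _ _).trans_lt hb1, hb2⟩,
    fun t ht => image_eq_zero_of_notMem_tsupport (hnot t ht),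
    fun t ht => image_eq_zero_of_notMem_tsupport fun h => hnot t ht (tsupport_deriv_subset h)⟩

/-- The shift s = x + t fixes the singular kernel, and the vanishing of ψ' after b allows the fixed
interval [0,T]. What remains is a parameter integral depending on t through ψ' alone. -/
lemma continuousOn_rightCaputo {δ T b : ℝ} {ψ : ℝ → ℝ} (hδ₁ : δ < 1)
    (hT : 0 ≤ T) (hbT : b ≤ T) (hψ : Continuous (deriv ψ)) (hψc : HasCompactSupport ψ)
    (hb : ∀ r, b ≤ r → deriv ψ r = 0) : ContinuousOn (rightCaputo δ T ψ) (Icc 0 T) := by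
  obtain ⟨K, hK⟩ := hψ.bounded_above_of_compact_support hψc.deriv
  have hc : Continuous fun t => -(1 / Real.Gamma (1 - δ) *
      ∫ x in (0 : ℝ)..T, x ^ (-(1 - (1 - δ))) * deriv ψ (x + t)) := by
    apply Continuous.neg
    apply Continuous.mul continuous_const
    apply intervalIntegral.continuous_of_dominated_interval
      (bound := fun x => ‖x ^ (-(1 - (1 - δ)))‖ * K)
    · intro t
      have h1 : Measurable fun x : ℝ => x ^ (-(1 - (1 - δ))) := by fun_prop
      exact (h1.mul (hψ.measurable.comp (by fun_prop))).aestronglyMeasurable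
    · refine fun t => Eventually.of_forall fun x _ => ?_
      rw [norm_mul]
      exact mul_le_mul_of_nonneg_left (hK _) (norm_nonneg _)
    · exact (intervalIntegral.intervalIntegrable_rpow' (by linarith)).norm.mul_const K
    · exact Eventually.of_forall fun x _ => by fun_prop
  refine hc.continuousOn.congr fun t ht => ?_
  unfold rightCaputo rightFracIntegral
  congr 2
  have h1 := intervalIntegral.integral_comp_add_right (a := 0) (b := T - t)
    (fun s => (s - t) ^ (-(1 - (1 - δ))) * deriv ψ s) t
  simp only [add_sub_cancel_right, zero_add, sub_add_cancel] at h1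
  rw [← h1, intervalIntegral.integral_of_le (sub_nonneg.2 ht.2), intervalIntegral.integral_of_le hT]
  symm
  apply setIntegral_eq_of_subset_of_forall_sdiff_eq_zero measurableSet_Ioc
    (Ioc_subset_Ioc le_rfl (by linarith [ht.1]))
  intro x hx
  have : T - t < x := by
    by_contra hcon
    exact hx.2 ⟨hx.1.1, not_lt.1 hcon⟩
  rw [hb (x + t) (by linarith), mul_zero]

/-! ### The weak formulation tested with the weight -/

lemma IsTame.mono {N : ℕ} {β A A' : ℝ} {v : E N → ℝ} (hv : IsTame N β A v) (h : A ≤ A') :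
    IsTame N β A' v := by
  have hw : ∀ x, A * weight N β x ≤ A' * weight N β x := fun x =>
    mul_le_mul_of_nonneg_right h (weight_pos N β x).le
  exact ⟨hv.continuous, fun x => (hv.bound x).trans (hw x),
    fun x y hy => (hv.diff x y hy).trans (mul_le_mul_of_nonneg_right (hw x) (norm_nonneg _)),
    fun x y hy => (hv.secondDiff x y hy).trans (mul_le_mul_of_nonneg_right (hw x) (by positivity))⟩

/-- `limUnder` is linear only where limits exist, so homogeneity is read off from the
second-difference formula instead. -/
lemma IsTame.fracLaplacian_const_mul {N : ℕ} (hN : 1 ≤ N) {β A : ℝ} {v : E N → ℝ} (hβ₀ : 0 < β)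
    (hβ₂ : β < 2) (hv : IsTame N β A v) (c : ℝ) (x : E N) :
    fracLaplacian (β / 2) (fun y => c * v y) x = c * fracLaplacian (β / 2) v x := by
  have hA := hv.nonneg
  have e : ∀ x h, FracSchrodinger.secondDiff (fun y => c * v y) x h =
      c * FracSchrodinger.secondDiff v x h := fun x h => by
    simp only [FracSchrodinger.secondDiff]; ring
  have hcv : IsTame N β (|c| * A) fun y => c * v y := by
    refine ⟨hv.continuous.const_mul c, fun x => ?_, fun x h hh => ?_, fun x h hh => ?_⟩
    · rw [abs_mul, mul_assoc]
      exact mul_le_mul_of_nonneg_left (hv.bound x) (abs_nonneg c)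
    · rw [← mul_sub, abs_mul, mul_assoc, mul_assoc, ← mul_assoc A]
      exact mul_le_mul_of_nonneg_left (hv.diff x h hh) (abs_nonneg c)
    · rw [e, abs_mul, mul_assoc, mul_assoc, ← mul_assoc A]
      exact mul_le_mul_of_nonneg_left (hv.secondDiff x h hh) (abs_nonneg c)
  rw [hcv.fracLaplacian_eq hN hβ₀ hβ₂, hv.fracLaplacian_eq hN hβ₀ hβ₂]
  simp only [e, mul_div_assoc]
  rw [integral_const_mul]
  ring

/-- The weight at scale `R`. -/
def scaledWeight (N : ℕ) (β R : ℝ) (x : E N) : ℝ := weight N β (R⁻¹ • x)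

lemma contDiff_weight (N : ℕ) (β : ℝ) : ContDiff ℝ ∞ (weight N β) := by
  unfold weight
  apply ContDiff.rpow_const_of_ne
  · exact contDiff_const.add (contDiff_norm_sq ℝ)
  · intro x; positivity

lemma contDiff_scaledWeight (N : ℕ) (β R : ℝ) : ContDiff ℝ ∞ (scaledWeight N β R) :=
  (contDiff_weight N β).comp (contDiff_const_smul _)

lemma exists_isTame_scaledWeight (N : ℕ) {β R : ℝ} (hβ : 0 < β) (hR : 1 ≤ R) :
    ∃ A, IsTame N β A (scaledWeight N β R) := by
  obtain ⟨A, hA⟩ := exists_isTame_weight N hβ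
  exact ⟨_, hA.comp_inv_smul hβ hR⟩

lemma isTestFunction_mul {N : ℕ} {T : ℝ} {ψ : ℝ → ℝ} {v : E N → ℝ} (hψ : ContDiff ℝ ∞ ψ)
    (hψc : HasCompactSupport ψ) (hψs : tsupport ψ ⊆ Ioo 0 T) (hv : ContDiff ℝ ∞ v)
    (hvc : HasCompactSupport v) : IsTestFunction N T fun z => ψ z.1 * v z.2 := by
  have hts : tsupport (fun z : ℝ × E N => ψ z.1 * v z.2) ⊆ tsupport ψ ×ˢ tsupport v := by
    apply closure_minimal _ ((isClosed_tsupport ψ).prod (isClosed_tsupport v))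
    intro z hz
    rw [Function.mem_support] at hz
    exact ⟨subset_tsupport _ (left_ne_zero_of_mul hz), subset_tsupport _ (right_ne_zero_of_mul hz)⟩
  refine ⟨(hψ.comp contDiff_fst).mul (hv.comp contDiff_snd), ?_, ?_⟩
  · exact (hψc.isCompact.prod hvc.isCompact).of_isClosed_subset (isClosed_tsupport _) hts
  · exact hts.trans (Set.prod_mono hψs (subset_univ _))

lemma rightCaputo_mul_const (δ T c t : ℝ) (ψ : ℝ → ℝ) :
    rightCaputo δ T (fun τ => ψ τ * c) t = rightCaputo δ T ψ t * c := by
  unfold rightCaputo rightFracIntegral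
  have : deriv (fun τ => ψ τ * c) = fun τ => deriv ψ τ * c := by
    ext τ; exact deriv_mul_const_field c
  rw [this]
  simp only [← mul_assoc]
  rw [intervalIntegral.integral_mul_const]
  ring

/-- The weak formulation extends to products of test functions in time with the weight. -/
theorem IsDistributionalSolution.identity_weight {N : ℕ} (hN : 1 ≤ N) {α β p ε R T : ℝ} {lam : ℂ}
    {u₀ : L2 N} {u : ℝ → L2 N} (hα₁ : α < 1) (hβ₀ : 0 < β) (hβ₂ : β < 2) (hp : 1 ≤ p)
    (hR : 1 ≤ R) (hT : 0 < T) (hX : MemX N β p T u)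
    (hsol : IsDistributionalSolution N α β p ε lam u₀ T u) {ψ : ℝ → ℝ} (hψ : ContDiff ℝ ∞ ψ)
    (hψc : HasCompactSupport ψ) (hψs : tsupport ψ ⊆ Ioo 0 T) :
    lam * ((∫ t in (0 : ℝ)..T, powerPairing p (scaledWeight N β R) (u t) * ψ t : ℝ) : ℂ) +
      (ε : ℂ) * Complex.I ^ (α : ℂ) * (∫ t in (0 : ℝ)..T,
        pairing (scaledWeight N β R) u₀ * (rightCaputo α T ψ t : ℂ)) =
    Complex.I ^ (α : ℂ) * (∫ t in (0 : ℝ)..T,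
        pairing (scaledWeight N β R) (u t) * (rightCaputo α T ψ t : ℂ)) -
      ∫ t in (0 : ℝ)..T,
        pairing (fracLaplacian (β / 2) (scaledWeight N β R)) (u t) * (ψ t : ℂ) := by
  obtain ⟨b, ⟨hb0, hbT⟩, hbψ, hbψ'⟩ := exists_vanishing_time hT hψc hψs
  have hψ' : Continuous (deriv ψ) := hψ.continuous_deriv (by simp)
  have hDc := continuousOn_rightCaputo hα₁ hT.le hbT.le hψ' hψc hbψ'
  have hDb : ∀ t, b ≤ t → t ≤ T → rightCaputo α T ψ t = 0 := fun t h1 h2 =>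
    rightCaputo_eq_zero hbψ' h1 h2
  obtain ⟨C, hC⟩ := hX.bounded
  have hC' : ∀ᵐ t ∂(volume.restrict (Ioc 0 T)),
      eLpNorm (u t) (ENNReal.ofReal p) (volume : Measure (E N)) ≤ C := by
    rwa [← Measure.restrict_congr_set Ioo_ae_eq_Ioc]
  obtain ⟨A₁, hA₁⟩ := exists_isTame_scaledWeight N (β := β) hβ₀ hR
  obtain ⟨L, hL0, hL1, hL2⟩ := exists_cutoff_bound N
  set A := A₁ * (1 + 3 * L) with hA
  have hΦ : IsTame N β A (scaledWeight N β R) := hA₁.mono (by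
    have := hA₁.nonneg
    have : 0 ≤ A₁ * L := by positivity
    rw [hA]; linarith)
  -- Multiplication by the cutoff gives admissible test functions, tame with the same constant A for
  -- every n; each of the four integrals then passes to the limit by dominated convergence.
  set v : ℕ → E N → ℝ := fun n x => scaledWeight N β R x * cutoff N n x with hv
  have hvt : ∀ n, IsTame N β A (v n) := fun n =>
    hA₁.mul (contDiff_cutoff N n).continuous hL0 (abs_cutoff_le_one N n) (hL1 n) (hL2 n)
  have hvlim : ∀ x, Tendsto (fun n => v n x) atTop (𝓝 (scaledWeight N β R x)) := by
    intro x
    simpa using (tendsto_cutoff N x).const_mul (scaledWeight N β R x)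
  have hid : ∀ n, lam * ((∫ t in (0 : ℝ)..T, powerPairing p (v n) (u t) * ψ t : ℝ) : ℂ) +
      (ε : ℂ) * Complex.I ^ (α : ℂ) * (∫ t in (0 : ℝ)..T,
        pairing (v n) u₀ * (rightCaputo α T ψ t : ℂ)) =
    Complex.I ^ (α : ℂ) * (∫ t in (0 : ℝ)..T,
        pairing (v n) (u t) * (rightCaputo α T ψ t : ℂ)) -
      ∫ t in (0 : ℝ)..T, pairing (fracLaplacian (β / 2) (v n)) (u t) * (ψ t : ℂ) := by
    intro n
    have h := hsol.2 _ (isTestFunction_mul hψ hψc hψs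
      ((contDiff_scaledWeight N β R).mul (contDiff_cutoff N n))
      ((hasCompactSupport_cutoff N n).mul_left (f := scaledWeight N β R)))
    have e1 : ∀ t, ∫ x, ((‖u t x‖ ^ p * (ψ t * v n x) : ℝ) : ℂ) =
        ((powerPairing p (v n) (u t) * ψ t : ℝ) : ℂ) := by
      intro t
      refine (integral_ofReal (𝕜 := ℂ) (f := fun x => ‖u t x‖ ^ p * (ψ t * v n x))).trans ?_
      unfold powerPairing
      rw [← integral_mul_const]
      congr 1
      refine integral_congr_ae (Eventually.of_forall fun x => ?_)
      simp only
      ring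
    have e2 : ∀ (w : L2 N) t, ∫ x, w x * (rightCaputo α T (fun τ => ψ τ * v n x) t : ℂ) =
        pairing (v n) w * (rightCaputo α T ψ t : ℂ) := by
      intro w t
      unfold pairing
      rw [← integral_mul_const]
      congr 1; ext x
      rw [rightCaputo_mul_const]
      push_cast
      ring
    have e3 : ∀ t, ∫ x, u t x * (fracLaplacian (β / 2) (fun y => ψ t * v n y) x : ℂ) =
        pairing (fracLaplacian (β / 2) (v n)) (u t) * (ψ t : ℂ) := by
      intro t
      unfold pairing
      rw [← integral_mul_const]
      congr 1; ext x
      rw [(hvt n).fracLaplacian_const_mul hN hβ₀ hβ₂]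
      push_cast
      ring
    have e4 : ∫ t in (0 : ℝ)..T, ((powerPairing p (v n) (u t) * ψ t : ℝ) : ℂ) =
        ((∫ t in (0 : ℝ)..T, powerPairing p (v n) (u t) * ψ t : ℝ) : ℂ) :=
      intervalIntegral.integral_ofReal
    rw [← e4]
    simp only [← e1, ← e2, ← e3]
    exact h
  have l1 := tendsto_integral_powerPairing hβ₀ hp hT.le (fun n => (hvt n).continuous.measurable)
    (fun n => (hvt n).bound) hvlim hX.continuousOn hC' hψ.continuous
  have l2 := tendsto_integral_pairing hβ₀ hΦ.nonneg (fun n => (hvt n).continuous.measurable)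
    (fun n => (hvt n).bound) hvlim (u := fun _ => u₀) continuousOn_const hDc hb0.le hbT hDb
  have l3 := tendsto_integral_pairing hβ₀ hΦ.nonneg (fun n => (hvt n).continuous.measurable)
    (fun n => (hvt n).bound) hvlim hX.continuousOn hDc hb0.le hbT hDb
  have hlap : ∀ n x, |fracLaplacian (β / 2) (v n) x| ≤
      |fracLaplacianConst N (β / 2)| * singularMass N β * A * weight N β x := fun n x =>
    (hvt n).abs_fracLaplacian_le hN hβ₀ hβ₂ x
  have l4 := tendsto_integral_pairing hβ₀
    (nonneg_of_mul_nonneg_left ((abs_nonneg _).trans (hlap 0 0)) (weight_pos N β 0))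
    (fun n => (hvt n).measurable_fracLaplacian hN hβ₀ hβ₂) hlap
    (fun x => hΦ.tendsto_fracLaplacian hN hβ₀ hβ₂ hvt hvlim x) hX.continuousOn
    hψ.continuous.continuousOn hb0.le hbT (fun t h1 _ => hbψ t h1)
  have hl := (((Complex.continuous_ofReal.tendsto _).comp l1).const_mul lam).add
    (l2.const_mul ((ε : ℂ) * Complex.I ^ (α : ℂ)))
  have hr := (l3.const_mul (Complex.I ^ (α : ℂ))).sub l4
  exact tendsto_nhds_unique hl (hr.congr fun n => (hid n).symm)

/-- The moment `Re (i^α γ ∫ w(x) φ(x/R) dx)`. -/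
def moment (N : ℕ) (α β R : ℝ) (γ : ℂ) (w : L2 N) : ℝ :=
  (Complex.I ^ (α : ℂ) * γ * pairing (scaledWeight N β R) w).re

lemma continuous_moment {N : ℕ} {α β R : ℝ} (hβ : 0 < β) (hR : 1 ≤ R) (γ : ℂ) :
    Continuous (moment N α β R γ) := by
  obtain ⟨A, hA⟩ := exists_isTame_scaledWeight N (β := β) hβ hR
  exact Complex.continuous_re.comp (continuous_const.mul
    (continuous_pairing (memLp_of_abs_le_weight hβ hA.continuous.measurable hA.bound)))

lemma pairing_smul {N : ℕ} (f : E N → ℝ) (ε : ℝ) (w : L2 N) :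
    pairing f (ε • w) = (ε : ℂ) * pairing f w := by
  unfold pairing
  rw [← integral_const_mul]
  apply integral_congr_ae
  filter_upwards [Lp.coeFn_smul ε w] with x hx
  rw [hx, Pi.smul_apply, Complex.real_smul]
  ring

/-- The moment of a solution satisfies a fractional differential inequality in the weak sense. -/
theorem IsDistributionalSolution.weak_moment_inequality {N : ℕ} (hN : 1 ≤ N) {α β p ε R T : ℝ}
    {lam γ : ℂ} {u₀ : L2 N} {u : ℝ → L2 N} (hα₁ : α < 1) (hβ₀ : 0 < β) (hβ₂ : β < 2) (hp : 1 ≤ p)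
    (hR : 1 ≤ R) (hT : 0 < T) (hX : MemX N β p T u)
    (hsol : IsDistributionalSolution N α β p ε lam u₀ T u) {F : ℝ → ℝ}
    (hF : ContinuousOn F (Ico 0 T))
    (hle : ∀ w : L2 N, ∀ t ∈ Ioc 0 T, u t = w →
      MemLp w (ENNReal.ofReal p) (volume : Measure (E N)) →
      F t ≤ (γ * lam).re * powerPairing p (scaledWeight N β R) w +
        (γ * pairing (fracLaplacian (β / 2) (scaledWeight N β R)) w).re)
    {ψ : ℝ → ℝ} (hψ : ContDiff ℝ ∞ ψ) (hψc : HasCompactSupport ψ) (hψs : tsupport ψ ⊆ Ioo 0 T)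
    (hψ0 : ∀ t, 0 ≤ ψ t) :
    ∫ t in (0 : ℝ)..T, F t * ψ t ≤ ∫ t in (0 : ℝ)..T,
      (moment N α β R γ (u t) - moment N α β R γ (u 0)) * rightCaputo α T ψ t := by
  obtain ⟨b, ⟨hb0, hbT⟩, hbψ, hbψ'⟩ := exists_vanishing_time hT hψc hψs
  have hψ' : Continuous (deriv ψ) := hψ.continuous_deriv (by simp)
  have hDc := continuousOn_rightCaputo hα₁ hT.le hbT.le hψ' hψc hbψ'
  have hDb : ∀ t, b ≤ t → t ≤ T → rightCaputo α T ψ t = 0 := fun t h1 h2 =>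
    rightCaputo_eq_zero hbψ' h1 h2
  obtain ⟨C, hC⟩ := hX.bounded
  have hC' : ∀ᵐ t ∂(volume.restrict (Ioc 0 T)),
      eLpNorm (u t) (ENNReal.ofReal p) (volume : Measure (E N)) ≤ C := by
    rwa [← Measure.restrict_congr_set Ioo_ae_eq_Ioc]
  obtain ⟨A, hA⟩ := exists_isTame_scaledWeight N (β := β) hβ₀ hR
  set Φ := scaledWeight N β R with hΦ
  set Lap := fracLaplacian (β / 2) Φ with hLap
  have hid := hsol.identity_weight hN hα₁ hβ₀ hβ₂ hp hR hT hX hψ hψc hψs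
  have hpc : ContinuousOn (fun t => pairing Φ (u t)) (Ico 0 T) :=
    (continuous_pairing (memLp_of_abs_le_weight hβ₀ hA.continuous.measurable
      hA.bound)).comp_continuousOn hX.continuousOn
  have hqc : ContinuousOn (fun t => pairing Lap (u t)) (Ico 0 T) :=
    (continuous_pairing (memLp_of_abs_le_weight hβ₀ (hA.measurable_fracLaplacian hN hβ₀ hβ₂)
      (hA.abs_fracLaplacian_le hN hβ₀ hβ₂))).comp_continuousOn hX.continuousOn
  have hDC : ContinuousOn (fun t => (rightCaputo α T ψ t : ℂ)) (Ico 0 T) :=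
    Complex.continuous_ofReal.comp_continuousOn (hDc.mono Ico_subset_Icc_self)
  have hψC : ContinuousOn (fun t => (ψ t : ℂ)) (Ico 0 T) :=
    Complex.continuous_ofReal.comp_continuousOn hψ.continuous.continuousOn
  have re_int : ∀ (c : ℂ) (f : ℝ → ℂ), IntervalIntegrable f volume 0 T →
      (c * ∫ t in (0 : ℝ)..T, f t).re = ∫ t in (0 : ℝ)..T, (c * f t).re := by
    intro c f hf
    rw [← intervalIntegral.integral_const_mul]
    exact (Complex.reCLM.intervalIntegral_comp_comm (hf.const_mul c)).symm
  have i1 : IntervalIntegrable (fun t => pairing Φ (u 0) * (rightCaputo α T ψ t : ℂ)) volume 0 T :=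
    intervalIntegrable_of_eq_zero (continuousOn_const.mul hDC) hb0.le hbT
      (fun t h1 h2 => by rw [hDb t h1 h2]; simp)
  have i2 : IntervalIntegrable (fun t => pairing Φ (u t) * (rightCaputo α T ψ t : ℂ)) volume 0 T :=
    intervalIntegrable_of_eq_zero (hpc.mul hDC) hb0.le hbT
      (fun t h1 h2 => by rw [hDb t h1 h2]; simp)
  have i3 : IntervalIntegrable (fun t => pairing Lap (u t) * (ψ t : ℂ)) volume 0 T :=
    intervalIntegrable_of_eq_zero (hqc.mul hψC) hb0.le hbT
      (fun t h1 _ => by rw [hbψ t h1]; simp)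
  have i4 := intervalIntegrable_powerPairing_mul hβ₀ hp hT.le hA.continuous.measurable hA.bound
    hX.continuousOn hC' hψ.continuous
  have hε : (ε : ℂ) * Complex.I ^ (α : ℂ) * (∫ t in (0 : ℝ)..T,
        pairing Φ u₀ * (rightCaputo α T ψ t : ℂ)) = Complex.I ^ (α : ℂ) * ∫ t in (0 : ℝ)..T,
        pairing Φ (u 0) * (rightCaputo α T ψ t : ℂ) := by
    rw [hsol.1, pairing_smul]
    simp only [mul_assoc, intervalIntegral.integral_const_mul]
    ring
  rw [hε] at hid
  -- Multiplying by γ before taking real parts turns i^α u into the moment and lam |u|^p into the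
  -- positive factor Re(γ lam) times a real integral.
  have hre := congrArg (fun z => (γ * z).re) hid
  simp only [mul_add, mul_sub, ← mul_assoc, Complex.add_re, Complex.sub_re] at hre
  rw [re_int _ _ i1, re_int _ _ i2, re_int _ _ i3, Complex.re_mul_ofReal] at hre
  have m1 : ∀ w t, (γ * Complex.I ^ (α : ℂ) * (pairing Φ w * (rightCaputo α T ψ t : ℂ))).re =
      moment N α β R γ w * rightCaputo α T ψ t := by
    intro w t
    unfold moment
    rw [← Complex.re_mul_ofReal]
    congr 1; ring
  have m2 : ∀ t, (γ * (pairing Lap (u t) * (ψ t : ℂ))).re = (γ * pairing Lap (u t)).re * ψ t := by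
    intro t
    rw [← Complex.re_mul_ofReal]
    congr 1; ring
  simp only [m1, m2] at hre
  have hMc : ContinuousOn (fun t => moment N α β R γ (u t)) (Ico 0 T) :=
    (continuous_moment hβ₀ hR γ).comp_continuousOn hX.continuousOn
  have hD' := hDc.mono (Ico_subset_Icc_self : Ico (0 : ℝ) T ⊆ Icc 0 T)
  have j1 : IntervalIntegrable (fun t => moment N α β R γ (u 0) * rightCaputo α T ψ t) volume 0 T :=
    intervalIntegrable_of_eq_zero (continuousOn_const.mul hD') hb0.le hbT
      (fun t h1 h2 => by rw [hDb t h1 h2, mul_zero])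
  have j2 : IntervalIntegrable (fun t => moment N α β R γ (u t) * rightCaputo α T ψ t) volume 0 T :=
    intervalIntegrable_of_eq_zero (hMc.mul hD') hb0.le hbT
      (fun t h1 h2 => by rw [hDb t h1 h2, mul_zero])
  have j3 : IntervalIntegrable (fun t => (γ * pairing Lap (u t)).re * ψ t) volume 0 T :=
    intervalIntegrable_of_eq_zero ((Complex.continuous_re.comp_continuousOn
      (continuousOn_const.mul hqc)).mul hψ.continuous.continuousOn) hb0.le hbT
      (fun t h1 _ => by rw [hbψ t h1, mul_zero])
  have j4 : IntervalIntegrable (fun t => F t * ψ t) volume 0 T :=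
    intervalIntegrable_of_eq_zero (hF.mul hψ.continuous.continuousOn) hb0.le hbT
      (fun t h1 _ => by rw [hbψ t h1, mul_zero])
  have hrhs : ∫ t in (0 : ℝ)..T,
      (moment N α β R γ (u t) - moment N α β R γ (u 0)) * rightCaputo α T ψ t =
      ∫ t in (0 : ℝ)..T, ((γ * lam).re * (powerPairing p Φ (u t) * ψ t) +
        (γ * pairing Lap (u t)).re * ψ t) := by
    rw [intervalIntegral.integral_add (i4.const_mul _) j3, intervalIntegral.integral_const_mul]
    simp only [sub_mul]
    rw [intervalIntegral.integral_sub j2 j1]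
    linarith
  rw [hrhs]
  -- The pointwise inequality is available only where u(t) lies in L^p, that is, for almost every t.
  apply intervalIntegral.integral_mono_ae_restrict hT.le j4 ((i4.const_mul _).add j3)
  rw [Measure.restrict_congr_set Ioc_ae_eq_Icc.symm]
  filter_upwards [hC', ae_restrict_mem measurableSet_Ioc] with t ht ht'
  have := hle (u t) t ht' rfl ⟨Lp.aestronglyMeasurable _, lt_of_le_of_lt ht ENNReal.coe_lt_top⟩
  have h2 := mul_le_mul_of_nonneg_right this (hψ0 t)
  refine h2.trans (le_of_eq ?_)
  ring
/-! ### The pointwise-in-time inequality -/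

/-- Convexity of y ↦ y^p, in the form of Bernoulli's inequality at y/c. Jensen's and Young's
inequalities below are two choices of the point of tangency c. -/
lemma rpow_tangent_le {p c y : ℝ} (hp : 1 ≤ p) (hc : 0 ≤ c) (hy : 0 ≤ y) :
    c ^ p + p * c ^ (p - 1) * (y - c) ≤ y ^ p := by
  rcases eq_or_lt_of_le hc with rfl | hc
  · rcases eq_or_lt_of_le hp with rfl | hp'
    · simp
    · rw [Real.zero_rpow (by linarith), Real.zero_rpow (by linarith)]
      simpa using Real.rpow_nonneg hy p
  · have h1 := one_add_mul_self_le_rpow_one_add (s := y / c - 1) (by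
      have : 0 ≤ y / c := by positivity
      linarith) hp
    rw [add_sub_cancel, Real.div_rpow hy hc.le] at h1
    have hcp : 0 < c ^ p := Real.rpow_pos_of_pos hc _
    rw [le_div_iff₀ hcp] at h1
    refine le_trans (le_of_eq ?_) h1
    rw [Real.rpow_sub_one hc.ne']
    field_simp

/-- Jensen's inequality for `t ↦ t^p` with respect to a positive weight. -/
lemma rpow_integral_le {N : ℕ} {β A p : ℝ} (hβ : 0 < β) (hp : 1 ≤ p) {f : E N → ℝ}
    (hf : Measurable f) (hf0 : ∀ x, 0 ≤ f x) (hb : ∀ x, |f x| ≤ A * weight N β x)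
    (hpos : 0 < ∫ x, f x) {w : L2 N}
    (hw : MemLp w (ENNReal.ofReal p) (volume : Measure (E N))) :
    (∫ x, ‖w x‖ * f x) ^ p * (∫ x, f x) ^ (-(p - 1)) ≤ powerPairing p f w := by
  set Q := ∫ x, f x with hQ
  set S := ∫ x, ‖w x‖ * f x with hS
  have hS0 : 0 ≤ S := integral_nonneg fun x => mul_nonneg (norm_nonneg _) (hf0 x)
  -- At the weighted mean the linear part of the tangent integrates to zero.
  set c := S / Q with hc
  have hc0 : 0 ≤ c := div_nonneg hS0 hpos.le
  have hfi := integrable_of_abs_le_weight hβ hf hb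
  have hwi := integrable_norm_mul_of_abs_le hβ hf hb w
  have hle : ∫ x, ((c ^ p - p * c ^ (p - 1) * c) * f x + p * c ^ (p - 1) * (‖w x‖ * f x)) ≤
      powerPairing p f w := by
    apply integral_mono ((hfi.const_mul _).add (hwi.const_mul _))
      (integrable_power_mul hβ (by linarith) hf hb hw)
    intro x
    have := mul_le_mul_of_nonneg_right (rpow_tangent_le hp hc0 (norm_nonneg (w x))) (hf0 x)
    change (c ^ p - p * c ^ (p - 1) * c) * f x + p * c ^ (p - 1) * (‖w x‖ * f x) ≤
      ‖w x‖ ^ p * f x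
    linarith
  rw [integral_add (hfi.const_mul _) (hwi.const_mul _), integral_const_mul, integral_const_mul,
    ← hQ, ← hS] at hle
  refine le_trans (le_of_eq ?_) hle
  have hSQ : S = c * Q := by rw [hc]; field_simp
  rw [hSQ, Real.mul_rpow hc0 hpos.le, mul_assoc, ← Real.rpow_add hpos]
  have : p + -(p - 1) = 1 := by ring
  rw [this, Real.rpow_one]
  ring

/-- Young's inequality with the optimal constant. -/
lemma young_le {p a b S : ℝ} (hp : 1 < p) (ha : 0 < a) (hb : 0 ≤ b) (hS : 0 ≤ S) :
    b * S ≤ a * S ^ p + (p - 1) * a * (b / (a * p)) ^ (p / (p - 1)) := by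
  have hp1 : 0 < p - 1 := by linarith
  -- The point where the tangent to a y^p has slope b.
  set c := (b / (a * p)) ^ (1 / (p - 1)) with hc
  have hbase : 0 ≤ b / (a * p) := by positivity
  have hc0 : 0 ≤ c := by positivity
  have h1 := mul_le_mul_of_nonneg_left (rpow_tangent_le hp.le hc0 hS) ha.le
  have h2 : c ^ (p - 1) = b / (a * p) := by
    rw [hc, ← Real.rpow_mul hbase, one_div_mul_cancel hp1.ne', Real.rpow_one]
  have h3 : c ^ p = (b / (a * p)) ^ (p / (p - 1)) := by
    rw [hc, ← Real.rpow_mul hbase]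
    congr 1; field_simp
  have h4 : c ^ p = c * c ^ (p - 1) := by
    rw [← Real.rpow_one_add' hc0 (by linarith)]
    congr 1; ring
  rw [← h3]
  have h5 : a * (p * c ^ (p - 1) * (S - c)) = b * S - a * p * c ^ p := by
    rw [h4, h2]; field_simp
  linarith

lemma integral_scaledWeight {N : ℕ} {β R : ℝ} (hR : 0 < R) :
    ∫ x, scaledWeight N β R x = R ^ (N : ℝ) * weightMass N β := by
  have := Measure.integral_comp_inv_smul_of_nonneg (volume : Measure (E N)) (weight N β) hR.le
  rw [finrank_euclideanSpace_fin, smul_eq_mul] at this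
  rw [Real.rpow_natCast]
  exact this

lemma norm_I_cpow (α : ℝ) : ‖Complex.I ^ (α : ℂ)‖ = 1 := by
  rw [Complex.norm_cpow_of_ne_zero Complex.I_ne_zero]
  simp

lemma scaledWeight_pos (N : ℕ) (β R : ℝ) (x : E N) : 0 < scaledWeight N β R x := weight_pos N β _

lemma norm_pairing_le_integral {N : ℕ} {β A : ℝ} (hβ : 0 < β) {f g : E N → ℝ}
    (hg : Measurable g) (hgb : ∀ x, |g x| ≤ A * weight N β x) (hfg : ∀ x, |f x| ≤ g x) (w : L2 N) :
    ‖pairing f w‖ ≤ ∫ x, ‖w x‖ * g x := by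
  apply norm_integral_le_of_norm_le (integrable_norm_mul_of_abs_le hβ hg hgb w)
  refine Eventually.of_forall fun x => ?_
  rw [norm_mul, Complex.norm_real]
  exact mul_le_mul_of_nonneg_left (hfg x) (norm_nonneg _)

lemma youngConst_pos {p : ℝ} (hp : 1 < p) : 0 < youngConst p := by
  have hp1 : 0 < p - 1 := by linarith
  unfold youngConst
  positivity

lemma constC_pos {N : ℕ} {β p K : ℝ} {lam γ : ℂ} (hβ : 0 < β) (hp : 1 < p)
    (hγ : 0 < (γ * lam).re) (hγ0 : 0 < ‖γ‖) (hK : 0 < K) : 0 < constC N β p lam γ K := by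
  have := weightMass_pos (N := N) hβ
  have := youngConst_pos hp
  unfold constC
  positivity

lemma constD_pos {N : ℕ} {β p : ℝ} {lam γ : ℂ} (hβ : 0 < β)
    (hγ : 0 < (γ * lam).re) (hγ0 : 0 < ‖γ‖) : 0 < constD N β p lam γ := by
  have := weightMass_pos (N := N) hβ
  unfold constD
  positivity

/-- The constant C is made for this identity: with m the threshold C R^{N-β/(p-1)}, the product B
m^p equals the remainder of Young's inequality when half of the nonlinear coefficient absorbs the
Laplacian. Logarithms reduce the identity between powers to linear algebra. -/
lemma constD_mul_constC_rpow {N : ℕ} {β p K R : ℝ} {lam γ : ℂ} (hβ : 0 < β) (hp : 1 < p)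
    (hγ : 0 < (γ * lam).re) (hγ0 : 0 < ‖γ‖) (hK : 0 < K) (hR : 0 < R) :
    constD N β p lam γ * R ^ (-(N * (p - 1))) *
        (constC N β p lam γ K * R ^ (N - β / (p - 1))) ^ p =
      (p - 1) * ((γ * lam).re / 2 * (R ^ (N : ℝ) * weightMass N β) ^ (-(p - 1))) *
        ((‖γ‖ * (K * R ^ (-β))) / (((γ * lam).re / 2 *
          (R ^ (N : ℝ) * weightMass N β) ^ (-(p - 1))) * p)) ^ (p / (p - 1)) := by
  have hA := weightMass_pos (N := N) hβ
  have hp1 : 0 < p - 1 := by linarith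
  have hp0 : 0 < p := by linarith
  have hp0' := hp0.ne'
  have hp1' := hp1.ne'
  unfold constD constC youngConst
  generalize (γ * lam).re = σ at *
  generalize ‖γ‖ = G at *
  generalize weightMass N β = A at *
  apply Real.log_injOn_pos (by simp only [mem_Ioi]; positivity) (by simp only [mem_Ioi]; positivity)
  simp (disch := positivity) only [Real.log_mul, Real.log_rpow, Real.log_div, Real.log_inv]
  field_simp
  ring

/-- The differential inequality satisfied by the moment, at a fixed time. -/
theorem moment_inequality {N : ℕ} (hN : 1 ≤ N) {α β p K R : ℝ} {lam γ : ℂ} (hβ₀ : 0 < β)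
    (hβ₂ : β < 2) (hp : 1 < p) (hγ : 0 < (γ * lam).re) (hγ0 : 0 < ‖γ‖) (hK : IsWeightConst N β K)
    (hR : 1 ≤ R) {w : L2 N} (hw : MemLp w (ENNReal.ofReal p) (volume : Measure (E N))) :
    constD N β p lam γ * R ^ (-(N * (p - 1))) *
        (|moment N α β R γ w| ^ p - (constC N β p lam γ K * R ^ (N - β / (p - 1))) ^ p) ≤
      (γ * lam).re * powerPairing p (scaledWeight N β R) w +
        (γ * pairing (fracLaplacian (β / 2) (scaledWeight N β R)) w).re := by
  have hR0 : 0 < R := by linarith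
  have hA := weightMass_pos (N := N) hβ₀
  obtain ⟨A₁, hA₁⟩ := exists_isTame_scaledWeight N (β := β) hβ₀ hR
  obtain ⟨A₂, hA₂⟩ := exists_isTame_weight N hβ₀
  set S := ∫ x, ‖w x‖ * scaledWeight N β R x with hS
  have hS0 : 0 ≤ S := integral_nonneg fun x =>
    mul_nonneg (norm_nonneg _) (scaledWeight_pos N β R x).le
  set Q := R ^ (N : ℝ) * weightMass N β with hQ
  have hQ0 : 0 < Q := by positivity
  have hQi : ∫ x, scaledWeight N β R x = Q := integral_scaledWeight hR0
  have hJ := rpow_integral_le hβ₀ hp.le hA₁.continuous.measurable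
    (fun x => (scaledWeight_pos N β R x).le) hA₁.bound (by rw [hQi]; exact hQ0) hw
  rw [hQi, ← hS] at hJ
  have hLap : ∀ x, |fracLaplacian (β / 2) (scaledWeight N β R) x| ≤
      K * R ^ (-β) * scaledWeight N β R x := by
    intro x
    have h1 := hA₂.fracLaplacian_comp_inv_smul hN hβ₀ hβ₂ hR x
    have h2 : 0 < R ^ (-β) := Real.rpow_pos_of_pos hR0 _
    change |fracLaplacian (β / 2) (fun x => weight N β (R⁻¹ • x)) x| ≤ _
    rw [h1, abs_mul, abs_of_pos h2]
    calc _ ≤ R ^ (-β) * (K * weight N β (R⁻¹ • x)) := mul_le_mul_of_nonneg_left (hK.2 _) h2.le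
      _ = _ := by unfold scaledWeight; ring
  have hc0 : 0 < K * R ^ (-β) := mul_pos hK.1 (Real.rpow_pos_of_pos hR0 _)
  have hL := norm_pairing_le_integral (A := K * R ^ (-β) * A₁) hβ₀
    (hA₁.continuous.measurable.const_mul (K * R ^ (-β))) (fun x => by
      rw [abs_mul, abs_of_pos hc0]
      exact (mul_le_mul_of_nonneg_left (hA₁.bound x) hc0.le).trans (le_of_eq (by ring))) hLap w
  have hLS : ∫ x, ‖w x‖ * (K * R ^ (-β) * scaledWeight N β R x) = K * R ^ (-β) * S := by
    rw [hS, ← integral_const_mul]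
    congr 1; ext x; ring
  rw [hLS] at hL
  have hre : -(‖γ‖ * (K * R ^ (-β)) * S) ≤
      (γ * pairing (fracLaplacian (β / 2) (scaledWeight N β R)) w).re := by
    have h1 := (abs_le.1 (Complex.abs_re_le_norm
      (γ * pairing (fracLaplacian (β / 2) (scaledWeight N β R)) w))).1
    rw [norm_mul] at h1
    have h2 := mul_le_mul_of_nonneg_left hL hγ0.le
    linarith
  have hM : |moment N α β R γ w| ≤ ‖γ‖ * S := by
    refine (Complex.abs_re_le_norm _).trans ?_
    rw [norm_mul, norm_mul, norm_I_cpow, one_mul]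
    exact mul_le_mul_of_nonneg_left (norm_pairing_le_integral hβ₀ hA₁.continuous.measurable
      hA₁.bound (fun x => (abs_of_pos (scaledWeight_pos N β R x)).le) w) hγ0.le
  -- Half of the coefficient supplied by Jensen's inequality. One copy of a S^p dominates B|M|^p,
  -- since B|γ|^p = a and |M| ≤ |γ| S; the other absorbs the Laplacian term.
  set a := (γ * lam).re / 2 * Q ^ (-(p - 1)) with ha
  have ha0 : 0 < a := by positivity
  have hY := young_le (b := ‖γ‖ * (K * R ^ (-β))) hp ha0 (by positivity) hS0
  have hB : constD N β p lam γ * R ^ (-(N * (p - 1))) * ‖γ‖ ^ p = a := by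
    rw [ha, hQ]
    unfold constD
    rw [Real.mul_rpow (by positivity) hA.le, ← Real.rpow_mul hR0.le, Real.rpow_neg hγ0.le]
    have : 0 < ‖γ‖ ^ p := Real.rpow_pos_of_pos hγ0 _
    have e : (N : ℝ) * -(p - 1) = -(N * (p - 1)) := by ring
    rw [e]
    field_simp
  have hB0 : 0 < constD N β p lam γ * R ^ (-(N * (p - 1))) :=
    mul_pos (constD_pos hβ₀ hγ hγ0) (Real.rpow_pos_of_pos hR0 _)
  have hMp : constD N β p lam γ * R ^ (-(N * (p - 1))) * |moment N α β R γ w| ^ p ≤ a * S ^ p := by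
    rw [← hB, mul_assoc _ (‖γ‖ ^ p), ← Real.mul_rpow hγ0.le hS0]
    exact mul_le_mul_of_nonneg_left (Real.rpow_le_rpow (abs_nonneg _) hM (by linarith)) hB0.le
  have hC := constD_mul_constC_rpow (N := N) (lam := lam) hβ₀ hp hγ hγ0 hK.1 hR0
  rw [← hQ, ← ha] at hC
  have hσ : 2 * (a * S ^ p) ≤ (γ * lam).re * powerPairing p (scaledWeight N β R) w := by
    have := mul_le_mul_of_nonneg_left hJ hγ.le
    refine le_trans (le_of_eq ?_) this
    rw [ha]; ring
  rw [mul_sub, hC]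
  linarith

/-- The moment of a solution, minus the threshold, is a supersolution of the fractional
differential equation. -/
theorem IsDistributionalSolution.isSupersolution {N : ℕ} (hN : 1 ≤ N) {α β p ε K R T : ℝ}
    {lam γ : ℂ} {u₀ : L2 N} {u : ℝ → L2 N} (hα₀ : 0 < α) (hα₁ : α < 1) (hβ₀ : 0 < β) (hβ₂ : β < 2)
    (hp : 1 < p) (hγ : 0 < (γ * lam).re) (hγ0 : 0 < ‖γ‖) (hK : IsWeightConst N β K) (hR : 1 ≤ R)
    (hT : 0 < T) (hX : MemX N β p T u) (hsol : IsDistributionalSolution N α β p ε lam u₀ T u)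
    (hg : 0 < moment N α β R γ (ε • u₀) - constC N β p lam γ K * R ^ (N - β / (p - 1))) :
    IsSupersolution α p (constD N β p lam γ * R ^ (-(N * (p - 1))))
      (moment N α β R γ (ε • u₀) - constC N β p lam γ K * R ^ (N - β / (p - 1))) T
      (fun t => moment N α β R γ (u t) - constC N β p lam γ K * R ^ (N - β / (p - 1))) := by
  have hR0 : 0 < R := by linarith
  set B := constD N β p lam γ * R ^ (-(N * (p - 1))) with hB
  have hB0 : 0 < B := mul_pos (constD_pos hβ₀ hγ hγ0) (Real.rpow_pos_of_pos hR0 _)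
  set m := constC N β p lam γ K * R ^ (N - β / (p - 1)) with hm
  have hm0 : 0 < m := mul_pos (constC_pos hβ₀ hp hγ hγ0 hK.1) (Real.rpow_pos_of_pos hR0 _)
  set M : ℝ → ℝ := fun t => moment N α β R γ (u t) with hM
  set F : ℝ → ℝ := fun t => B * (|M t| ^ p - m ^ p) with hF
  have hMc : ContinuousOn M (Ico 0 T) := (continuous_moment hβ₀ hR γ).comp_continuousOn hX.continuousOn
  have hFc : ContinuousOn F (Ico 0 T) :=
    continuousOn_const.mul ((hMc.abs.rpow_const fun _ _ => Or.inr (by linarith)).sub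
      continuousOn_const)
  have hM0 : M 0 = moment N α β R γ (ε • u₀) := by simp only [hM, hsol.1]
  have hint := le_of_weak_caputo_inequality hα₀ hα₁ hMc hFc fun ψ h1 h2 h3 h4 =>
    hsol.weak_moment_inequality (γ := γ) hN hα₁ hβ₀ hβ₂ hp.le hR hT hX hFc (by
      rintro w t - rfl hw
      exact moment_inequality hN hβ₀ hβ₂ hp hγ hγ0 hK hR hw) h1 h2 h3 h4
  -- Up to the first time at which M ≤ m the right-hand side F is nonnegative, so the integral
  -- inequality gives M ≥ M(0) > m at that time, a contradiction.
  have hpos : ∀ t ∈ Ico 0 T, m < M t := by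
    intro t₁ ht₁
    by_contra hcon
    have hsub : Icc 0 t₁ ⊆ Ico 0 T := fun x hx => ⟨hx.1, lt_of_le_of_lt hx.2 ht₁.2⟩
    have hcl : IsClosed {t ∈ Icc 0 t₁ | M t ≤ m} :=
      isClosed_Icc.isClosed_le (hMc.mono hsub) continuousOn_const
    have hcpt : IsCompact {t ∈ Icc 0 t₁ | M t ≤ m} :=
      isCompact_Icc.of_isClosed_subset hcl fun x hx => hx.1
    obtain ⟨t, ⟨ht, hmt⟩, hmin⟩ := hcpt.exists_isLeast ⟨t₁, ⟨ht₁.1, le_rfl⟩, not_lt.1 hcon⟩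
    have hle : leftFracIntegral α (fun _ => 0) t ≤ leftFracIntegral α F t := by
      apply leftFracIntegral_mono hα₀ ht.1
        (intervalIntegrable_kernel_mul_of_continuousOn hα₀ continuousOn_const (hsub ht))
        (intervalIntegrable_kernel_mul_of_continuousOn hα₀ hFc (hsub ht))
      intro s hs
      have hs1 : s ∈ Icc 0 t₁ := ⟨hs.1, hs.2.le.trans ht.2⟩
      have hlt : m < M s := by
        by_contra hc
        exact absurd (hmin ⟨hs1, not_lt.1 hc⟩) (not_le.2 hs.2)
      have h1 : m ^ p ≤ |M s| ^ p :=
        Real.rpow_le_rpow hm0.le (hlt.le.trans (le_abs_self _)) (by linarith)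
      exact mul_nonneg hB0.le (by linarith)
    have hz : leftFracIntegral α (fun _ => 0) t = 0 := by simp [leftFracIntegral]
    have := hint t (hsub ht)
    linarith
  have hMm : ContinuousOn (fun s => M s - m) (Ico 0 T) := hMc.sub continuousOn_const
  refine ⟨hMm, fun t ht => (sub_pos.2 (hpos t ht)).le, fun t ht => ?_⟩
  have hle : leftFracIntegral α (fun s => B * (M s - m) ^ p) t ≤ leftFracIntegral α F t := by
    apply leftFracIntegral_mono hα₀ ht.1
      (intervalIntegrable_kernel_mul_of_continuousOn hα₀
        (ContinuousOn.const_mul_rpow hMm B (by linarith)) ht)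
      (intervalIntegrable_kernel_mul_of_continuousOn hα₀ hFc ht)
    intro s hs
    have hlt := hpos s ⟨hs.1, hs.2.trans ht.2⟩
    -- Superadditivity of y ↦ y^p for p ≥ 1, that is (M - m)^p ≤ M^p - m^p, allows the threshold to
    -- be subtracted from M.
    have h1 := Real.add_rpow_le_rpow_add (sub_pos.2 hlt).le hm0.le hp.le
    rw [sub_add_cancel] at h1
    change B * (M s - m) ^ p ≤ B * (|M s| ^ p - m ^ p)
    apply mul_le_mul_of_nonneg_left _ hB0.le
    rw [abs_of_pos (hm0.trans hlt)]
    linarith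
  have := hint t ht
  rw [← hM0]
  linarith

/-! ### Size of the initial moment -/

lemma sphereArea_pos {N : ℕ} (hN : 1 ≤ N) : 0 < sphereArea N := by
  change 0 < (volume : Measure (E N)).toSphere.real univ
  rw [Measure.toSphere_real_apply_univ, finrank_euclideanSpace_fin]
  exact mul_pos (by exact_mod_cast hN)
    (ENNReal.toReal_pos (Metric.measure_ball_pos _ _ one_pos).ne' measure_ball_lt_top.ne)

lemma integral_rpow_pos {a ρ : ℝ} (hρ : 1 < ρ) : 0 < ∫ r in (1 : ℝ)..ρ, r ^ a := by
  apply intervalIntegral.intervalIntegral_pos_of_pos_on _ _ hρ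
  · refine ContinuousOn.intervalIntegrable fun x hx => ?_
    rw [uIcc_of_le hρ.le] at hx
    exact (Real.continuousAt_rpow_const x a (Or.inl (by linarith [hx.1]))).continuousWithinAt
  · intro x hx
    exact Real.rpow_pos_of_pos (by linarith [hx.1]) _

lemma constI₁_pos {N : ℕ} (hN : 1 ≤ N) {β k : ℝ} : 0 < constI₁ N β k := by
  have hs := sphereArea_pos hN
  unfold constI₁
  split_ifs with h
  · have : 0 < (N : ℝ) - k := by linarith
    positivity
  · have := integral_rpow_pos (a := (N : ℝ) - 1 - k) one_lt_two
    positivity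

/-- Integral of a power of the norm over an annulus, in polar coordinates. -/
lemma integral_annulus_norm_rpow {N : ℕ} (hN : 1 ≤ N) {k ρ : ℝ} (hρ : 1 ≤ ρ) :
    ∫ x : E N, (Ioc 1 ρ).indicator (fun r => r ^ (-k)) ‖x‖ =
      sphereArea N * ∫ r in (1 : ℝ)..ρ, r ^ ((N : ℝ) - 1 - k) := by
  have : Nontrivial (E N) := by
    have : Nonempty (Fin N) := ⟨⟨0, hN⟩⟩
    infer_instance
  rw [integral_fun_norm_addHaar volume (fun r => (Ioc 1 ρ).indicator (fun r => r ^ (-k)) r),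
    ← smul_assoc, nsmul_eq_mul, ← Measure.toSphere_real_apply_univ, finrank_euclideanSpace_fin]
  change sphereArea N * _ = _
  congr 1
  have h1 : ∀ y : ℝ, y ^ (N - 1) • (Ioc 1 ρ).indicator (fun r => r ^ (-k)) y =
      (Ioc 1 ρ).indicator (fun r => r ^ (N - 1) * r ^ (-k)) y := fun y => by
    by_cases hy : y ∈ Ioc 1 ρ <;> simp [hy]
  simp_rw [h1]
  rw [setIntegral_indicator measurableSet_Ioc, intervalIntegral.integral_of_le hρ,
    inter_eq_self_of_subset_right (s := Ioi (0 : ℝ)) (t := Ioc 1 ρ)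
      fun y hy => lt_trans one_pos hy.1]
  apply setIntegral_congr_fun measurableSet_Ioc
  intro y hy
  have hy0 : 0 < y := lt_trans one_pos hy.1
  change y ^ (N - 1) * y ^ (-k) = y ^ ((N : ℝ) - 1 - k)
  rw [← Real.rpow_natCast, ← Real.rpow_add hy0, Nat.cast_sub hN, Nat.cast_one]
  congr 1

lemma integrable_annulus_norm_rpow {N : ℕ} {k ρ : ℝ} (hk : 0 < k) :
    Integrable fun x : E N => (Ioc 1 ρ).indicator (fun r : ℝ => r ^ (-k)) ‖x‖ := by
  have hm : Measurable fun x : E N => (Ioc 1 ρ).indicator (fun r : ℝ => r ^ (-k)) ‖x‖ :=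
    ((measurable_id.pow_const _).indicator measurableSet_Ioc).comp measurable_norm
  have h1 : Integrable ((Metric.closedBall (0 : E N) ρ).indicator fun _ => (1 : ℝ)) :=
    (integrable_indicator_iff measurableSet_closedBall).2
      (integrableOn_const measure_closedBall_lt_top.ne)
  refine h1.mono' hm.aestronglyMeasurable (Eventually.of_forall fun x => ?_)
  by_cases hx : ‖x‖ ∈ Ioc 1 ρ
  · have hx' : x ∈ Metric.closedBall (0 : E N) ρ := by simpa using hx.2
    rw [indicator_of_mem hx, indicator_of_mem hx', Real.norm_of_nonneg (by positivity)]
    exact Real.rpow_le_one_of_one_le_of_nonpos hx.1.le (by linarith)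
  · rw [indicator_of_notMem hx, norm_zero]
    exact indicator_nonneg (fun _ _ => zero_le_one) x

lemma two_rpow_le_scaledWeight {N : ℕ} {β R : ℝ} (hβ : 0 < β) (hR : 0 < R) {x : E N}
    (hx : ‖x‖ ≤ R) : (2 : ℝ) ^ (-(N : ℝ) - β) ≤ scaledWeight N β R x := by
  have h1 : ‖R⁻¹ • x‖ ≤ 1 := by
    rw [norm_smul, norm_inv, Real.norm_of_nonneg hR.le, inv_mul_le_iff₀ hR]
    linarith
  have h2 : 1 + ‖R⁻¹ • x‖ ^ 2 ≤ 2 := by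
    have := pow_le_one₀ (n := 2) (norm_nonneg _) h1
    linarith
  have hn : (0 : ℝ) ≤ N := N.cast_nonneg
  -- The weight on the ball of radius R is at least 2^{-(N+β)/2}; the smaller power 2^{-(N+β)} is
  -- the one appearing in I₁.
  calc (2 : ℝ) ^ (-(N : ℝ) - β) ≤ 2 ^ (-(((N : ℝ) + β) / 2)) :=
        Real.rpow_le_rpow_of_exponent_le one_le_two (by linarith)
    _ ≤ _ := Real.rpow_le_rpow_of_nonpos (by positivity) h2 (by linarith)

/-- Lower bound of the moment of data that dominate a power of the norm. -/
lemma integral_le_moment {N : ℕ} (hN : 1 ≤ N) {α β k ρ R : ℝ} {γ : ℂ} {u₀ : L2 N} (hβ : 0 < β)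
    (hk : 0 < k) (hρ : 1 ≤ ρ) (hρR : ρ ≤ R)
    (hdata : ∀ᵐ x : E N,
      (if 1 < ‖x‖ then ‖x‖ ^ (-k) else 0) ≤ (Complex.I ^ (α : ℂ) * γ * u₀ x).re) :
    2 ^ (-(N : ℝ) - β) * sphereArea N * (∫ r in (1 : ℝ)..ρ, r ^ ((N : ℝ) - 1 - k)) ≤
      moment N α β R γ u₀ := by
  have hR : 1 ≤ R := hρ.trans hρR
  obtain ⟨A, hA⟩ := exists_isTame_scaledWeight N hβ hR
  have hint := (integrable_mul_of_memLp
    (memLp_of_abs_le_weight hβ hA.continuous.measurable hA.bound) u₀).const_mul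
      (Complex.I ^ (α : ℂ) * γ)
  have hmom : moment N α β R γ u₀ =
      ∫ x, (Complex.I ^ (α : ℂ) * γ * (u₀ x * (scaledWeight N β R x : ℂ))).re := by
    unfold moment pairing
    rw [← integral_const_mul]
    exact (integral_re hint).symm
  rw [hmom, mul_assoc, ← integral_annulus_norm_rpow hN hρ, ← integral_const_mul]
  apply integral_mono_ae ((integrable_annulus_norm_rpow hk).const_mul _) hint.re
  filter_upwards [hdata] with x hx
  change _ ≤ (Complex.I ^ (α : ℂ) * γ * (u₀ x * (scaledWeight N β R x : ℂ))).re
  rw [← mul_assoc, Complex.re_mul_ofReal]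
  have hw := scaledWeight_pos N β R x
  by_cases h : ‖x‖ ∈ Ioc 1 ρ
  · rw [if_pos h.1] at hx
    rw [indicator_of_mem h, mul_comm]
    exact mul_le_mul hx (two_rpow_le_scaledWeight hβ (by linarith) (h.2.trans hρR))
      (by positivity) ((by positivity : (0 : ℝ) ≤ ‖x‖ ^ (-k)).trans hx)
  · rw [indicator_of_notMem h, mul_zero]
    refine mul_nonneg (le_trans ?_ hx) hw.le
    split_ifs <;> positivity

/-- Growth of the moment of data that dominate a power of the norm. -/
lemma exists_constI₁_mul_le_moment {N : ℕ} (hN : 1 ≤ N) {α β k : ℝ} {γ : ℂ} {u₀ : L2 N}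
    (hβ : 0 < β) (hk : 0 < k)
    (hdata : ∀ᵐ x : E N,
      (if 1 < ‖x‖ then ‖x‖ ^ (-k) else 0) ≤ (Complex.I ^ (α : ℂ) * γ * u₀ x).re) :
    ∃ R₀ : ℝ, 1 ≤ R₀ ∧ ∀ R, R₀ ≤ R →
      constI₁ N β k * R ^ ((N : ℝ) - min (N : ℝ) k) ≤ moment N α β R γ u₀ := by
  have hs := sphereArea_pos hN
  by_cases h : k < N
  · have hNk : 0 < (N : ℝ) - k := by linarith
    -- This R₀ ensures R^{N-k} ≥ 2, hence R^{N-k} - 1 ≥ R^{N-k}/2; the loss is the additional factor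
    -- 1/2 in I₁ for k < N.
    refine ⟨2 ^ (1 / ((N : ℝ) - k)), Real.one_le_rpow one_le_two (by positivity), fun R hR => ?_⟩
    have hR1 : 1 ≤ R := (Real.one_le_rpow one_le_two (by positivity)).trans hR
    have h2 : 2 ≤ R ^ ((N : ℝ) - k) := by
      have := Real.rpow_le_rpow (by positivity) hR hNk.le
      rwa [← Real.rpow_mul two_pos.le, one_div_mul_cancel hNk.ne', Real.rpow_one] at this
    refine le_trans (le_trans (b := 2 ^ (-(N : ℝ) - β) * sphereArea N *
      ((R ^ ((N : ℝ) - k) - 1) / ((N : ℝ) - k))) ?_ (le_of_eq ?_))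
      (integral_le_moment hN hβ hk hR1 le_rfl hdata)
    · rw [constI₁, if_pos h, min_eq_right h.le, Real.rpow_sub_one two_ne_zero]
      have : R ^ ((N : ℝ) - k) / 2 / ((N : ℝ) - k) ≤ (R ^ ((N : ℝ) - k) - 1) / ((N : ℝ) - k) := by
        gcongr
        linarith
      calc _ = 2 ^ (-(N : ℝ) - β) * sphereArea N * (R ^ ((N : ℝ) - k) / 2 / ((N : ℝ) - k)) := by
            ring
        _ ≤ _ := mul_le_mul_of_nonneg_left this (by positivity)
    · rw [integral_rpow (Or.inl (by linarith)), Real.one_rpow]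
      congr 3 <;> ring_nf
  -- For k ≥ N the exponent N - min(N,k) is 0, so the contribution of the fixed annulus 1 < |x| ≤ 2
  -- suffices.
  · refine ⟨2, one_le_two, fun R hR => ?_⟩
    rw [constI₁, if_neg h, min_eq_left (not_lt.1 h), sub_self, Real.rpow_zero, mul_one]
    exact integral_le_moment hN hβ hk one_le_two hR hdata

/-! ### Choice of the scale and the lifespan bound -/

lemma moment_smul {N : ℕ} (α β R : ℝ) (γ : ℂ) (ε : ℝ) (w : L2 N) :
    moment N α β R γ (ε • w) = ε * moment N α β R γ w := by
  unfold moment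
  rw [pairing_smul, mul_left_comm, Complex.re_ofReal_mul]

lemma kappa₁_pos {N : ℕ} {β p k : ℝ} (hβ : 0 < β) (hk : k < β / (p - 1)) :
    0 < kappa₁ N β p k := by
  have h1 : min (N : ℝ) k / β < 1 / (p - 1) := by
    rw [div_lt_iff₀ hβ, one_div_mul_eq_div]
    exact (min_le_right _ _).trans_lt hk
  exact sub_pos.2 h1

/-- At the scale where the moment of the data is twice the threshold, the upper bound of the
maximal time is at most `B₁ ε ^ (-1 / (α κ₁))`. -/
lemma upperTime_le {N : ℕ} (hN : 1 ≤ N) {α β p k K R ε g₀ : ℝ} {lam γ : ℂ} (hα : 0 < α)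
    (hβ : 0 < β) (hp : 1 < p) (hk : k < β / (p - 1)) (hγ : 0 < (γ * lam).re) (hγ0 : 0 < ‖γ‖)
    (hK : 0 < K) (hε : 0 < ε)
    (hR : R = (2 * constC N β p lam γ K / (ε * constI₁ N β k)) ^ (1 / (β * kappa₁ N β p k)))
    (hg : constC N β p lam γ K * R ^ (N - β / (p - 1)) ≤ g₀) :
    upperTime α p (constD N β p lam γ * R ^ (-(N * (p - 1)))) g₀ ≤
      constB₁ N α β p k lam γ K * ε ^ (-(1 / (α * kappa₁ N β p k))) := by
  have hp1 : 0 < p - 1 := by linarith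
  have hC := constC_pos (N := N) hβ hp hγ hγ0 hK
  have hD := constD_pos (N := N) (p := p) hβ hγ hγ0
  have hI := constI₁_pos hN (β := β) (k := k)
  have hκ := kappa₁_pos (N := N) hβ hk
  have hG : 0 < Real.Gamma (1 + α) := Real.Gamma_pos_of_pos (by linarith)
  -- Expressing min(N,k) through κ₁ leaves, after R is substituted, an identity between powers that
  -- logarithms settle.
  have hm : min (N : ℝ) k = β / (p - 1) - β * kappa₁ N β p k := by
    unfold kappa₁
    field_simp
    ring
  unfold constB₁ upperTime
  rw [hm]
  generalize constC N β p lam γ K = C at *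
  generalize constD N β p lam γ = D at *
  generalize constI₁ N β k = I at *
  generalize kappa₁ N β p k = κ at *
  generalize Real.Gamma (1 + α) = G at *
  have hR0 : 0 < R := by rw [hR]; positivity
  -- With g₀ bounded below by the threshold the powers of R combine to R^{-β}. Only the entry p - 1
  -- of the maximum is used, which is why B₁ contains (p-1)^{-1/α}.
  have hden : D * C ^ (p - 1) * R ^ (-β) * (p - 1) ≤
      D * R ^ (-(N * (p - 1))) * g₀ ^ (p - 1) * max (p - 1) (2 ^ (-(p * α / (p - 1)))) := by
    have h1 := Real.rpow_le_rpow (by positivity) hg hp1.le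
    rw [Real.mul_rpow hC.le (by positivity), ← Real.rpow_mul hR0.le] at h1
    have h2 : R ^ (-(N * (p - 1))) * R ^ ((N - β / (p - 1)) * (p - 1)) = R ^ (-β) := by
      rw [← Real.rpow_add hR0]
      congr 1
      field_simp
      ring
    have hg0 : 0 ≤ g₀ := le_trans (by positivity) hg
    calc _ = D * R ^ (-(N * (p - 1))) * (C ^ (p - 1) * R ^ ((N - β / (p - 1)) * (p - 1))) *
          (p - 1) := by rw [← h2]; ring
      _ ≤ _ := by
        gcongr
        exact le_max_left _ _
  have hden0 : 0 < D * C ^ (p - 1) * R ^ (-β) * (p - 1) := by positivity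
  refine (Real.rpow_le_rpow (div_nonneg hG.le (hden0.le.trans hden))
    (div_le_div_of_nonneg_left hG.le hden0 hden) (by positivity)).trans (le_of_eq ?_)
  rw [hR]
  apply Real.log_injOn_pos
  · exact mem_Ioi.2 (by positivity)
  · exact mem_Ioi.2 (by positivity)
  simp (disch := positivity) only [Real.log_mul, Real.log_rpow, Real.log_div]
  field_simp
  ring

end FracSchrodinger

end

theorem corollary2 (N : ℕ) (hN : 1 ≤ N) (α β p s k : ℝ) (lam γ : ℂ)
    (hα₀ : 0 < α) (hα₁ : α < 1) (hβ₀ : 0 < β) (hβ₂ : β < 2)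
    (hp : 1 < p) (hpN : p < 1 + 2 * β / N)
    (hk₁ : (N : ℝ) / 2 < k) (hk₂ : k < β / (p - 1))
    (u₀ : FracSchrodinger.L2 N) (hs : 0 ≤ s)
    (hu₀ : TemperedDistribution.MemSobolev s 2 (u₀ : 𝓢'(FracSchrodinger.E N, ℂ)))
    (hγ : 0 < (γ * lam).re)
    (hdata : ∀ᵐ x : FracSchrodinger.E N,
      (if 1 < ‖x‖ then ‖x‖ ^ (-k) else 0) ≤ (Complex.I ^ (α : ℂ) * γ * u₀ x).re) :
    0 < FracSchrodinger.kappa₁ N β p k ∧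
    (∃ K : ℝ, FracSchrodinger.IsWeightConst N β K) ∧
    ∀ K : ℝ, FracSchrodinger.IsWeightConst N β K →
      ∃ ε₂ : ℝ, 0 < ε₂ ∧ ∀ ε ∈ Set.Ioc (0 : ℝ) ε₂,
        ∃ R : ℝ, 0 < R ∧ ∃ B g₀ Tb : ℝ,
          B = FracSchrodinger.constD N β p lam γ * R ^ (-(N * (p - 1))) ∧
          g₀ = FracSchrodinger.initialMoment N α β γ R (ε • u₀) -
            FracSchrodinger.constC N β p lam γ K * R ^ (N - β / (p - 1)) ∧
          0 < g₀ ∧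
          FracSchrodinger.IsMaximalTime α p B g₀ Tb ∧
          FracSchrodinger.lowerTime α p B g₀ ≤ Tb ∧
          Tb ≤ FracSchrodinger.upperTime α p B g₀ ∧
          (∀ T : ℝ, Tb < T → ¬ ∃ u : ℝ → FracSchrodinger.L2 N,
            FracSchrodinger.MemX N β p T u ∧
            FracSchrodinger.IsDistributionalSolution N α β p ε lam u₀ T u) ∧
          Tb ≤ FracSchrodinger.constB₁ N α β p k lam γ K *
            ε ^ (-(1 / (α * FracSchrodinger.kappa₁ N β p k))) := by
  have hγ0 : 0 < ‖γ‖ := norm_pos_iff.2 fun h => by simp [h] at hγ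
  have hk₀ : 0 < k := lt_of_le_of_lt (by positivity) hk₁
  have hκ := FracSchrodinger.kappa₁_pos (N := N) hβ₀ hk₂
  refine ⟨hκ, FracSchrodinger.exists_isWeightConst hN hβ₀ hβ₂, fun K hK => ?_⟩
  obtain ⟨R₀, hR₀, hmom⟩ :=
    FracSchrodinger.exists_constI₁_mul_le_moment hN hβ₀ hk₀ hdata
  have hC := FracSchrodinger.constC_pos (N := N) hβ₀ hp hγ hγ0 hK.1
  have hD := FracSchrodinger.constD_pos (N := N) (p := p) hβ₀ hγ hγ0
  have hI := FracSchrodinger.constI₁_pos hN (β := β) (k := k)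
  set C := FracSchrodinger.constC N β p lam γ K with hCdef
  set I := FracSchrodinger.constI₁ N β k with hIdef
  set X := β * FracSchrodinger.kappa₁ N β p k with hXdef
  have hX : 0 < X := mul_pos hβ₀ hκ
  have hR₀' : 0 < R₀ := by linarith
  -- This is the ε at which the scale R chosen below equals R₀; smaller ε give R ≥ R₀, where the
  -- growth bound on the moment holds.
  refine ⟨2 * C / (I * R₀ ^ X), by positivity, fun ε ⟨hε₀, hε⟩ => ?_⟩
  -- R solves ε I R^{N-min(N,k)} = 2 C R^{N-β/(p-1)}. The two exponents differ by X = β κ₁ > 0, so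
  -- the moment is at least twice the threshold and g₀ is at least the threshold.
  obtain ⟨R, hR⟩ : ∃ R, R = (2 * C / (ε * I)) ^ (1 / X) := ⟨_, rfl⟩
  have hRX : R ^ X = 2 * C / (ε * I) := by
    rw [hR, ← Real.rpow_mul (by positivity), one_div_mul_cancel hX.ne', Real.rpow_one]
  have hRpos : 0 < R := by rw [hR]; positivity
  have hRR : R₀ ≤ R := by
    rw [← Real.rpow_le_rpow_iff hR₀'.le hRpos.le hX, hRX, le_div_iff₀ (by positivity)]
    rw [le_div_iff₀ (by positivity)] at hε
    linarith
  have hR1 : 1 ≤ R := hR₀.trans hRR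
  have hg : C * R ^ (N - β / (p - 1)) ≤ FracSchrodinger.moment N α β R γ (ε • u₀) -
      C * R ^ (N - β / (p - 1)) := by
    have h1 := mul_le_mul_of_nonneg_left (hmom R hRR) hε₀.le
    rw [FracSchrodinger.moment_smul]
    have h2 : (N : ℝ) - min (N : ℝ) k = X + (N - β / (p - 1)) := by
      rw [hXdef, FracSchrodinger.kappa₁]
      field_simp
      ring
    have h3 : ε * (I * R ^ ((N : ℝ) - min (N : ℝ) k)) = 2 * C * R ^ (N - β / (p - 1)) := by
      rw [h2, Real.rpow_add hRpos, hRX]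
      field_simp
    linarith
  have hg₀ := lt_of_lt_of_le (mul_pos hC (Real.rpow_pos_of_pos hRpos _)) hg
  obtain ⟨Tb, hTb, hlow, hup, hsuper⟩ := FracSchrodinger.exists_isMaximalTime hα₀ hα₁ hp
    (mul_pos hD (Real.rpow_pos_of_pos hRpos (-(N * (p - 1))))) hg₀
  -- The second `rfl` holds because `initialMoment` and `moment` unfold to the same expression.
  refine ⟨R, hRpos, _, _, Tb, rfl, rfl, hg₀, hTb, hlow, hup, ?_, ?_⟩
  · rintro T hT ⟨u, hu, hsol⟩
    have hT₀ : 0 < T := (FracSchrodinger.lowerTime_pos hα₀ hp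
      (mul_pos hD (Real.rpow_pos_of_pos hRpos (-(N * (p - 1))))) hg₀).trans_le hlow |>.trans hT
    exact absurd (hsuper T _ hT₀ (hsol.isSupersolution hN hα₀ hα₁ hβ₀ hβ₂ hp hγ hγ0 hK hR1 hT₀
      hu hg₀)) (not_le.2 hT)
  · exact hup.trans (FracSchrodinger.upperTime_le hN hα₀ hβ₀ hp hk₂ hγ hγ0 hK.1 hε₀ hR hg)
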